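/- **Theorem (well-posedness and stability of the staggered DG method).** Let $d\ge 2$, $k\ge 0$, and let $\Omega\subset\mathbb R^d$ be a bounded Lipschitz polyhedral domain. Let $\mathcal K_h$ be a finite partition of $\overline\Omega$ into closed polytopes $K$ with pairwise disjoint interiors and with a finite set $\mathcal F_h^K$ of flat polytopal $(d-1)$-dimensional faces $F$ overlapping at most in sets of $(d-1)$-dimensional measure zero, such that $\partial K$ is the union of the faces of $K$; each face either lies on $\partial\Omega$ and belongs to exactly one element, or is an interior face shared by exactly two elements. Write $h_D=\operatorname{diam} D$. Assume that the partition is shape regular with parameters $\gamma,\eta>0$: * each $K$ is star-shaped with respect to a ball contained in it, with centre $\boldsymbol x_K$ and radius $\rho_K\ge h_K/\gamma$; * each face $F$ is star-shaped with respect to a $(d-1)$-dimensional ball in its hyperplane, of radius at least $h_F/\gamma$; * $h_K\le \eta\, h_F$ for each face $F$ of $K$. Let $\mathcal T_h$ consist of the pyramids $T$ with apex $\boldsymbol x_K$ and base $F$, for all $K\in\mathcal K_h$ and all faces $F$ of $K$. For each face $F$ fix a unit normal $\boldsymbol n$, outward to the first neighbour $K_1$ of $F$ (outward to $\Omega$ if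 $F\subset\partial\Omega$). Let $$U_h=\prod_{K\in\mathcal K_h}\mathbb P_{k+1}(K),$$ $$\Sigma_h=\{\sigma_h\in L^2(\Omega;\mathbb R^d):\ \sigma_h|_T\in\mathbb P_k(T;\mathbb R^d)\ \forall\, T\in\mathcal T_h,\ \sigma_h\cdot\boldsymbol n \text{ is continuous across each interior face } F\in\mathcal F_h^K\}.$$ For $u_h\in U_h$ let $[u_h]_F=u_h|_{K_1}-u_h|_{K_2}$ on an interior face $F$ shared by $K_1,K_2$, let $[u_h]_F=u_h|_F$ on a boundary face, and let $Q_b$ be the $L^2(F)$-projection onto $\mathbb P_k(F)$ on each face. Put $$a_h(\sigma,\tau)=(\sigma,\tau)_{L^2(\Omega)},\qquad b_h(\sigma,u)=-\sum_{K\in\mathcal K_h}(\sigma,\nabla u)_K+\sum_{F\in\mathcal F_h^K}\langle\sigma\cdot\boldsymbol n,Q_b[u]\rangle_F,$$ $$\|u\|_{1,h}^2=\sum_{K\in\mathcal K_h}\|\nabla u\|_K^2+\sum_{F\in\mathcal F_h^K}h_F^{-1}\|Q_b[u]\|_F^2,\qquad \|\sigma\|_{0,h}^2=\sum_{K\in\mathcal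 K_h}\|\sigma\|_K^2+\sum_{F\in\mathcal F_h^K}h_F\|\sigma\cdot\boldsymbol n\|_F^2,$$ where norms and inner products indexed by $K$ and $F$ are those of $L^2$. Then there is a constant $C>0$ depending only on $d,k,\Omega,\gamma,\eta$ (in particular, not on the partition or its mesh size $h$, nor on $f$) such that, for each such partition and each $f\in L^2(\Omega)$, there is exactly one pair $(\sigma_h,u_h)\in\Sigma_h\times U_h$ with $$a_h(\sigma_h,\tau_h)+b_h(\tau_h,u_h)=0\quad\forall\,\tau_h\in\Sigma_h,\qquad b_h(\sigma_h,v_h)=-(f,v_h)_{L^2(\Omega)}\quad\forall\, v_h\in U_h,$$ and it satisfies $$\|\sigma_h\|_{0,h}+\|u_h\|_{1,h}\le C\,\|f\|_{L^2(\Omega)}.$$ -/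

import Mathlib

open MeasureTheory Topology

namespace SDG

/-- The Euclidean space `ℝ^d`. -/
abbrev Eu (d : ℕ) : Type := EuclideanSpace ℝ (Fin d)

/-- A (closed, bounded, not necessarily convex) polytope: a finite union of convex hulls of finite
sets of points. -/
def IsPolytope {d : ℕ} (P : Set (Eu d)) : Prop :=
  ∃ S : Finset (Finset (Eu d)), P = ⋃ s ∈ S, convexHull ℝ (s : Set (Eu d))

/-- A Lipschitz polyhedral domain: a bounded, connected, open set whose closure is a polytope and
which, near each point of its boundary, is the region strictly below the graph of a Lipschitz
function over the hyperplane orthogonal to some unit vector `e`. -/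
structure IsLipschitzPolyhedralDomain {d : ℕ} (Ω : Set (Eu d)) : Prop where
  isOpen : IsOpen Ω
  isConnected : IsConnected Ω
  isBounded : Bornology.IsBounded Ω
  polyhedral : IsPolytope (closure Ω)
  lipschitz : ∀ x ∈ frontier Ω, ∃ e : Eu d, ‖e‖ = 1 ∧ ∃ L, ∃ g : Eu d → ℝ, LipschitzWith L g ∧
    ∃ V ∈ 𝓝 x, ∀ y ∈ V, (y ∈ Ω ↔ inner ℝ e y < g (y - inner ℝ e y • e))

/-- A polytopal partition (primal grid) of `Ω`: finitely many closed polytopal elements, finitely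
many flat faces, and a point `center K` in each element `K`.

Each face `F` has a first neighbour `left F` and, when it is not on the boundary of `Ω`,
a second one `right F = some K`; `right F = none` for boundary faces. The unit vector `normal F`
points out of the first neighbour. -/
structure PolytopalMesh {d : ℕ} (Ω : Set (Eu d)) where
  numElem : ℕ
  numFace : ℕ
  elem : Fin numElem → Set (Eu d)
  center : Fin numElem → Eu d
  face : Fin numFace → Set (Eu d)
  left : Fin numFace → Fin numElem
  right : Fin numFace → Option (Fin numElem)
  normal : Fin numFace → Eu d
  offset : Fin numFace → ℝ
  elem_polytope : ∀ K, IsPolytope (elem K)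
  face_polytope : ∀ F, IsPolytope (face F)
  /-- The elements cover the closed domain and do not overlap. -/
  iUnion_elem : ⋃ K, elem K = closure Ω
  elem_disjoint : ∀ K K', K ≠ K' → Disjoint (interior (elem K)) (interior (elem K'))
  /-- The boundary of each element is the union of its faces. -/
  frontier_elem : ∀ K, frontier (elem K) = ⋃ F, ⋃ (_ : left F = K ∨ right F = some K), face F
  right_ne_left : ∀ F, right F ≠ some (left F)
  right_eq_none_iff : ∀ F, right F = none ↔ face F ⊆ frontier Ω
  /-- Distinct faces overlap at most in a set of zero `(d-1)`-dimensional measure. -/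
  face_overlap : ∀ F F', F ≠ F' → μHE[d - 1] (face F ∩ face F') = 0
  /-- Faces are flat. -/
  normal_norm : ∀ F, ‖normal F‖ = 1
  face_flat : ∀ F, ∀ x ∈ face F, inner ℝ (normal F) x = offset F
  /-- `normal F` points out of the first neighbour and into the second one. -/
  center_left : ∀ F, inner ℝ (normal F) (center (left F)) < offset F
  center_right : ∀ F K, right F = some K → offset F < inner ℝ (normal F) (center K)

/-- `𝕡_k`: real polynomials in `d` variables of total degree at most `k`. -/
noncomputable abbrev Poly (d k : ℕ) : Submodule ℝ (MvPolynomial (Fin d) ℝ) :=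
  MvPolynomial.restrictTotalDegree (Fin d) ℝ k

/-- The value of a polynomial at a point of `ℝ^d`. -/
noncomputable def pval {d : ℕ} (p : MvPolynomial (Fin d) ℝ) (x : Eu d) : ℝ :=
  MvPolynomial.eval (fun i => x i) p

/-- The value at a point of a vector of polynomials. -/
noncomputable def vval {d : ℕ} (q : Fin d → MvPolynomial (Fin d) ℝ) (x : Eu d) : Eu d :=
  WithLp.toLp 2 (fun i => pval (q i) x)

/-- The gradient of a polynomial. -/
noncomputable def grad {d : ℕ} (p : MvPolynomial (Fin d) ℝ) : Fin d → MvPolynomial (Fin d) ℝ :=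
  fun i => MvPolynomial.pderiv i p

theorem continuous_pval {d : ℕ} (p : MvPolynomial (Fin d) ℝ) : Continuous (pval p) := by
  unfold pval
  have h : Continuous fun x : Eu d => (fun i => x i : Fin d → ℝ) := by fun_prop
  exact (MvPolynomial.continuous_eval p).comp h

theorem isCompact_of_isPolytope {d : ℕ} {P : Set (Eu d)} (h : IsPolytope P) : IsCompact P := by
  obtain ⟨S, rfl⟩ := h
  exact S.isCompact_biUnion fun s _ => s.finite_toSet.isCompact_convexHull ℝ

/-- A bounded piece of a hyperplane has finite `(d-1)`-dimensional measure. -/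
theorem flat_measure_lt_top {d : ℕ} {P : Set (Eu d)} {n : Eu d} {c : ℝ} (hP : IsCompact P)
    (hn : ‖n‖ = 1) (hflat : ∀ x ∈ P, inner ℝ n x = c) : μHE[d - 1] P < ⊤ := by
  have hn0 : n ≠ 0 := by
    rintro rfl
    simp at hn
  have hrank : Module.finrank ℝ (ℝ ∙ n)ᗮ = d - 1 := by
    have h := Submodule.finrank_add_finrank_orthogonal (ℝ ∙ n : Submodule ℝ (Eu d))
    rw [finrank_span_singleton hn0, finrank_euclideanSpace_fin] at h
    omega
  let g : (ℝ ∙ n)ᗮ → Eu d := fun v => c • n + (v : Eu d)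
  have hg : Isometry g := by
    refine Isometry.of_dist_eq fun v w => ?_
    simp [g, Subtype.dist_eq]
  have hPg : P ⊆ Set.range g := by
    intro x hx
    refine ⟨⟨x - c • n, ?_⟩, by simp [g]⟩
    rw [Submodule.mem_orthogonal_singleton_iff_inner_right, inner_sub_right, hflat x hx,
      inner_smul_right, real_inner_self_eq_norm_sq, hn]
    simp
  have hpre : IsCompact (g ⁻¹' P) :=
    hg.isClosedEmbedding.isCompact_preimage hP
  rw [← Set.inter_eq_left.mpr hPg, ← hg.euclideanHausdorffMeasure_preimage, ← hrank]
  exact hpre.measure_lt_top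

/-- Existence of the `L²(μ)`-projection onto polynomials of degree at most `k`. -/
theorem exists_l2Projection {d : ℕ} (μ : Measure (Eu d)) (k : ℕ)
    (hμ : ∀ p : MvPolynomial (Fin d) ℝ, Integrable (pval p) μ) (p : MvPolynomial (Fin d) ℝ) :
    ∃ q ∈ Poly d k, ∀ w ∈ Poly d k, ∫ x, (pval p x - pval q x) * pval w x ∂μ = 0 := by
  have hint (q w : MvPolynomial (Fin d) ℝ) : Integrable (fun x => pval q x * pval w x) μ := by
    have h := hμ (q * w)
    have he : pval (q * w) = fun x => pval q x * pval w x := by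
      funext x
      simp [pval]
    rwa [he] at h
  let B : MvPolynomial (Fin d) ℝ →ₗ[ℝ] Module.Dual ℝ (Poly d k) :=
    LinearMap.mk₂ ℝ (fun q (w : Poly d k) => ∫ x, pval q x * pval (w : MvPolynomial (Fin d) ℝ) x ∂μ)
      (fun q q' w => by
        rw [← integral_add (hint _ _) (hint _ _)]
        simp [pval, add_mul])
      (fun a q w => by
        rw [smul_eq_mul, ← integral_const_mul]
        simp [pval, mul_assoc])
      (fun q w w' => by
        rw [← integral_add (hint _ _) (hint _ _)]
        simp [pval, mul_add])
      (fun a q w => by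
        rw [smul_eq_mul, ← integral_const_mul]
        simp [pval, mul_left_comm])
  have hB (q : MvPolynomial (Fin d) ℝ) (w : Poly d k) :
      B q w = ∫ x, pval q x * pval (w : MvPolynomial (Fin d) ℝ) x ∂μ := rfl
  let A : Poly d k →ₗ[ℝ] Module.Dual ℝ (Poly d k) := B ∘ₗ (Poly d k).subtype
  have hmem : B p ∈ LinearMap.range A := by
    have hkey : B p ∈ (LinearMap.range A).dualCoannihilator.dualAnnihilator := by
      rw [Submodule.mem_dualAnnihilator]
      intro w hw
      rw [Submodule.mem_dualCoannihilator] at hw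
      have h0 := hw (A w) ⟨w, rfl⟩
      change ∫ x, pval (w : MvPolynomial (Fin d) ℝ) x * pval (w : MvPolynomial (Fin d) ℝ) x ∂μ = 0
        at h0
      rw [integral_eq_zero_iff_of_nonneg (fun x => mul_self_nonneg _) (hint _ _)] at h0
      rw [hB]
      refine integral_eq_zero_of_ae ?_
      filter_upwards [h0] with x hx
      have : pval (w : MvPolynomial (Fin d) ℝ) x = 0 := by simpa using hx
      simp [this]
    rwa [Subspace.dualCoannihilator_dualAnnihilator_eq] at hkey
  obtain ⟨q, hq⟩ := hmem
  refine ⟨q, q.2, fun w hw => ?_⟩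
  have h := congrArg (fun φ => φ ⟨w, hw⟩) hq
  change B q ⟨w, hw⟩ = B p ⟨w, hw⟩ at h
  rw [hB, hB] at h
  simp_rw [sub_mul]
  rw [integral_sub (hint _ _) (hint _ _), h, sub_self]

namespace PolytopalMesh

variable {d : ℕ} {Ω : Set (Eu d)} (M : PolytopalMesh Ω)

/-- Shape regularity with parameters `γ` and `η`.

Every element is star-shaped with respect to a ball about `center K` of radius at least
`diam K / γ`; every face is star-shaped with respect to a `(d-1)`-dimensional ball, lying in its
hyperplane, of radius at least `diam F / γ`; and `diam K ≤ η * diam F` for each face `F` of `K`. -/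
structure ShapeRegular (γ η : ℝ) : Prop where
  elem_star : ∀ K, ∃ ρ : ℝ, 0 < ρ ∧ Metric.diam (M.elem K) ≤ γ * ρ ∧
    ∀ y ∈ Metric.closedBall (M.center K) ρ, y ∈ M.elem K ∧ StarConvex ℝ y (M.elem K)
  face_star : ∀ F, ∃ z ∈ M.face F, ∃ ρ : ℝ, 0 < ρ ∧ Metric.diam (M.face F) ≤ γ * ρ ∧
    ∀ y ∈ Metric.closedBall z ρ, inner ℝ (M.normal F) y = M.offset F →
      y ∈ M.face F ∧ StarConvex ℝ y (M.face F)
  diam_le : ∀ K F, M.left F = K ∨ M.right F = some K →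
    Metric.diam (M.elem K) ≤ η * Metric.diam (M.face F)

/-- Index set of the sub-mesh: pairs of an element and one of its faces. -/
abbrev SubElem : Type :=
  {T : Fin M.numElem × Fin M.numFace // M.left T.2 = T.1 ∨ M.right T.2 = some T.1}

/-- The sub-element of `K` with base `F`: the pyramid (cone) with apex `center K` and base `F`. -/
def sub (T : M.SubElem) : Set (Eu d) := convexJoin ℝ {M.center T.1.1} (M.face T.1.2)

/-- The sub-element at the face `F` in its first neighbour. -/
def leftSub (F : Fin M.numFace) : M.SubElem := ⟨(M.left F, F), Or.inl rfl⟩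

/-- The sub-element at the interior face `F` in its second neighbour. -/
def rightSub (F : Fin M.numFace) (K : Fin M.numElem) (h : M.right F = some K) : M.SubElem :=
  ⟨(K, F), Or.inr h⟩

/-- The space `U_h = ∏_K 𝕡_{k+1}(K)`. As elements have nonempty interior, a polynomial function on
an element is the same thing as a polynomial. -/
abbrev U (k : ℕ) : Type := Fin M.numElem → Poly d (k + 1)

/-- Vector fields that are polynomial of degree at most `k` on each sub-element. -/
abbrev SigmaDisc (k : ℕ) : Type := M.SubElem → Fin d → Poly d k

/-- The value at `x` of the polynomial vector field that `σ` has on the sub-element `T`. -/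
noncomputable def sval {k : ℕ} (σ : M.SigmaDisc k) (T : M.SubElem) (x : Eu d) : Eu d :=
  vval (fun i => (σ T i : MvPolynomial (Fin d) ℝ)) x

/-- The space `Σ_h`: piecewise polynomial vector fields on the sub-mesh whose normal component is
continuous across the interior faces of the primal grid. -/
def Sigma (k : ℕ) : Submodule ℝ (M.SigmaDisc k) where
  carrier := {σ | ∀ F K, ∀ h : M.right F = some K, ∀ x ∈ M.face F,
    inner ℝ (M.sval σ (M.leftSub F) x) (M.normal F) =
      inner ℝ (M.sval σ (M.rightSub F K h) x) (M.normal F)}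
  zero_mem' := by
    intro F K h x _
    simp [sval, vval, pval, PiLp.inner_apply]
  add_mem' := by
    intro σ τ hσ hτ F K h x hx
    have h1 := hσ F K h x hx
    have h2 := hτ F K h x hx
    simp only [sval, vval, pval, PiLp.inner_apply] at h1 h2 ⊢
    simp [mul_add, Finset.sum_add_distrib] at h1 h2 ⊢
    rw [h1, h2]
  smul_mem' := by
    intro c σ hσ F K h x hx
    have h1 := hσ F K h x hx
    simp only [sval, vval, pval, PiLp.inner_apply] at h1 ⊢
    simp [mul_left_comm _ c, ← Finset.mul_sum] at h1 ⊢
    exact Or.inl h1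

/-- The normal trace `σ · n` on a face (the two one-sided traces agree for `σ ∈ Σ_h`). -/
noncomputable def ntrace {k : ℕ} (σ : M.Sigma k) (F : Fin M.numFace) (x : Eu d) : ℝ :=
  inner ℝ (M.sval σ.1 (M.leftSub F) x) (M.normal F)

/-- The jump `[u]_F`: value from the first neighbour minus value from the second one on interior
faces, the value from the only neighbour on boundary faces. -/
noncomputable def jump {k : ℕ} (u : M.U k) (F : Fin M.numFace) : MvPolynomial (Fin d) ℝ :=
  (u (M.left F) : MvPolynomial (Fin d) ℝ) -
    (M.right F).elim 0 (fun K => (u K : MvPolynomial (Fin d) ℝ))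

/-- Surface measure on a face. -/
noncomputable def surf (F : Fin M.numFace) : Measure (Eu d) := μHE[d - 1].restrict (M.face F)

theorem integrable_pval_surf (F : Fin M.numFace) (p : MvPolynomial (Fin d) ℝ) :
    Integrable (pval p) (M.surf F) := by
  have hc := isCompact_of_isPolytope (M.face_polytope F)
  have hfin := flat_measure_lt_top hc (M.normal_norm F) (M.face_flat F)
  obtain ⟨c, hcb⟩ := hc.exists_bound_of_continuousOn (continuous_pval p).continuousOn
  refine Measure.integrableOn_of_bounded (M := c) hfin.ne
    (continuous_pval p).aestronglyMeasurable ?_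
  filter_upwards [ae_restrict_mem hc.measurableSet] with x hx using hcb x hx

/-- `Q_b` on the face `F`: the `L²(F)`-orthogonal projection onto `𝕡_k(F)`, given by a polynomial
of degree at most `k` representing it; its values on `F` are uniquely determined a.e. -/
noncomputable def Qb (k : ℕ) (F : Fin M.numFace) (p : MvPolynomial (Fin d) ℝ) :
    MvPolynomial (Fin d) ℝ :=
  (exists_l2Projection (M.surf F) k (M.integrable_pval_surf F) p).choose

theorem Qb_spec (k : ℕ) (F : Fin M.numFace) (p : MvPolynomial (Fin d) ℝ) :
    M.Qb k F p ∈ Poly d k ∧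
      ∀ w ∈ Poly d k, ∫ x, (pval p x - pval (M.Qb k F p) x) * pval w x ∂(M.surf F) = 0 :=
  (exists_l2Projection (M.surf F) k (M.integrable_pval_surf F) p).choose_spec

/-- `a_h(σ, τ) = (σ, τ)`, the `L²(Ω)` inner product. -/
noncomputable def ah {k : ℕ} (σ τ : M.Sigma k) : ℝ :=
  ∑ T : M.SubElem, ∫ x in M.sub T, inner ℝ (M.sval σ.1 T x) (M.sval τ.1 T x)

/-- `b_h(σ, u) = - ∑_K (σ, ∇u)_K + ∑_F ⟨σ · n, Q_b [u]⟩_F`, the volume integrals being split over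
the sub-elements of each `K`. -/
noncomputable def bh {k : ℕ} (σ : M.Sigma k) (u : M.U k) : ℝ :=
  -(∑ T : M.SubElem, ∫ x in M.sub T,
      inner ℝ (M.sval σ.1 T x) (vval (grad (u T.1.1 : MvPolynomial (Fin d) ℝ)) x)) +
    ∑ F, ∫ x, M.ntrace σ F x * pval (M.Qb k F (M.jump u F)) x ∂(M.surf F)

/-- `(f, v)`, the `L²(Ω)` inner product of `f` with a piecewise polynomial. -/
noncomputable def load {k : ℕ} (f : Lp ℝ 2 (volume.restrict Ω)) (v : M.U k) : ℝ :=
  ∑ K, ∫ x in Ω ∩ M.elem K, f x * pval (v K : MvPolynomial (Fin d) ℝ) x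

/-- The norm `‖u‖_{1,h}`, with `h_F = diam F`. -/
noncomputable def normU {k : ℕ} (u : M.U k) : ℝ :=
  √((∑ K, ∫ x in M.elem K, ‖vval (grad (u K : MvPolynomial (Fin d) ℝ)) x‖ ^ 2) +
    ∑ F, (Metric.diam (M.face F))⁻¹ * ∫ x, pval (M.Qb k F (M.jump u F)) x ^ 2 ∂(M.surf F))

/-- The norm `‖σ‖_{0,h}`, with `h_F = diam F`. -/
noncomputable def normSigma {k : ℕ} (σ : M.Sigma k) : ℝ :=
  √((∑ T : M.SubElem, ∫ x in M.sub T, ‖M.sval σ.1 T x‖ ^ 2) +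
    ∑ F, Metric.diam (M.face F) * ∫ x, M.ntrace σ F x ^ 2 ∂(M.surf F))

/-- `(σ_h, u_h)` solves the discrete saddle-point problem with right-hand side `f`. -/
def IsSolution {k : ℕ} (f : Lp ℝ 2 (volume.restrict Ω)) (s : M.Sigma k × M.U k) : Prop :=
  (∀ τ : M.Sigma k, M.ah s.1 τ + M.bh τ s.2 = 0) ∧ ∀ v : M.U k, M.bh s.1 v = -M.load f v

end PolytopalMesh

end SDG

/-! The estimate is Brezzi's argument with mesh-independent constants. Testing both equations with
the solution itself gives `a_h(σ_h, σ_h) = (f, u_h)`. Two facts close the estimate: the inf-sup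
condition `exists_infSup_const`, which together with the first equation bounds `‖u_h‖_{1,h}²` by a
multiple of `a_h(σ_h, σ_h)`, and the discrete Poincaré inequality `exists_poincare_const`, which
bounds the `L²`-norm of `u_h` by `‖u_h‖_{1,h}`. The face part of `‖σ_h‖_{0,h}` costs only an inverse
trace inequality. With `f = 0` the bounds force the zero solution, and since the problem is a square
linear system, uniqueness gives existence.

Inf-sup: `Σ_h` constrains only normal components across primal faces. On the pyramids over `F` one
may therefore prescribe the normal component as an extension of `h_F⁻¹ Q_b[u]` and the tangential
one as `-α` times the tangential gradient. The normal part produces the jump terms of the norm. The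
tangential parts suffice for the whole gradient (`exists_tangent_const`), because every element has
two faces in uniformly transversal hyperplanes and a polynomial on an element is controlled by its
restriction to any one of the pyramids. A large `α` absorbs the cross term between normal component
and normal derivative.

Poincaré: the divergence theorem for `u² x` on each element leaves volume terms and face terms. On a
flat face `x · n` is constant, so adjacent elements combine to `(x · n) [u] (u_1 + u_2)`; the sum is
handled by inverse traces, and the full jump by the projected jump plus gradients
(`exists_jump_const`). The divergence theorem itself is the fundamental theorem of calculus along
the rays of a cone: an element is tiled by the cones over its faces from any apex near its centre,
and the radial field has no flux through their lateral sides.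

Uniformity comes from norm equivalence for polynomials on a unit ball, transported by scaling, and
from a ball of radius comparable to `h_K` inside each pyramid. -/

namespace SDG

/-! ### Polynomial calculus and norm equivalence on balls -/

section Polynomial

variable {d : ℕ}

theorem pval_add (p q : MvPolynomial (Fin d) ℝ) (x : Eu d) :
    pval (p + q) x = pval p x + pval q x := by simp [pval]

theorem pval_sub (p q : MvPolynomial (Fin d) ℝ) (x : Eu d) :
    pval (p - q) x = pval p x - pval q x := by simp [pval]

theorem pval_mul (p q : MvPolynomial (Fin d) ℝ) (x : Eu d) :
    pval (p * q) x = pval p x * pval q x := by simp [pval]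

theorem pval_smul (c : ℝ) (p : MvPolynomial (Fin d) ℝ) (x : Eu d) :
    pval (c • p) x = c * pval p x := by simp [pval, MvPolynomial.smul_eval]

theorem pval_C (c : ℝ) (x : Eu d) : pval (MvPolynomial.C c) x = c := by simp [pval]

theorem pval_X (i : Fin d) (x : Eu d) : pval (MvPolynomial.X i) x = x i := by simp [pval]

theorem pval_zero (x : Eu d) : pval 0 x = 0 := by simp [pval]

theorem pval_sum {ι : Type*} (s : Finset ι) (p : ι → MvPolynomial (Fin d) ℝ) (x : Eu d) :
    pval (∑ i ∈ s, p i) x = ∑ i ∈ s, pval (p i) x := by simp [pval]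

theorem vval_apply (q : Fin d → MvPolynomial (Fin d) ℝ) (x : Eu d) (i : Fin d) :
    vval q x i = pval (q i) x := rfl

theorem inner_vval (q : Fin d → MvPolynomial (Fin d) ℝ) (x v : Eu d) :
    inner ℝ (vval q x) v = ∑ i, pval (q i) x * v i := by
  simp [PiLp.inner_apply, vval_apply, mul_comm]

theorem norm_vval_sq (q : Fin d → MvPolynomial (Fin d) ℝ) (x : Eu d) :
    ‖vval q x‖ ^ 2 = ∑ i, pval (q i) x ^ 2 := by
  simp [EuclideanSpace.norm_sq_eq, vval_apply]

theorem continuous_vval (q : Fin d → MvPolynomial (Fin d) ℝ) : Continuous (vval q) := by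
  unfold vval
  have h : Continuous fun x : Eu d => (fun i => pval (q i) x : Fin d → ℝ) :=
    continuous_pi fun i => continuous_pval _
  exact (PiLp.continuous_toLp 2 _).comp h

/-- Substituting polynomials of degree at most one does not increase the degree. -/
theorem bind₁_mem_Poly {m : ℕ} {p : MvPolynomial (Fin d) ℝ} (hp : p ∈ Poly d m)
    (f : Fin d → MvPolynomial (Fin d) ℝ) (hf : ∀ i, (f i).totalDegree ≤ 1) :
    MvPolynomial.bind₁ f p ∈ Poly d m := by
  rw [MvPolynomial.mem_restrictTotalDegree] at hp ⊢
  rw [MvPolynomial.bind₁, MvPolynomial.aeval_def, MvPolynomial.eval₂_eq]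
  refine MvPolynomial.totalDegree_finsetSum_le fun s hs => ?_
  refine (MvPolynomial.totalDegree_mul _ _).trans ?_
  have h1 : (algebraMap ℝ (MvPolynomial (Fin d) ℝ) (p.coeff s)).totalDegree = 0 :=
    MvPolynomial.totalDegree_C _
  rw [h1, zero_add]
  refine (MvPolynomial.totalDegree_finsetProd _ _).trans ?_
  have h2 : ∀ i ∈ s.support, (f i ^ s i).totalDegree ≤ s i := fun i _ =>
    (MvPolynomial.totalDegree_pow _ _).trans (by nlinarith [hf i, Nat.zero_le (s i)])
  exact (Finset.sum_le_sum h2).trans ((MvPolynomial.le_totalDegree hs).trans hp)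

theorem pval_bind₁ (f : Fin d → MvPolynomial (Fin d) ℝ) (p : MvPolynomial (Fin d) ℝ) (x : Eu d) :
    pval (MvPolynomial.bind₁ f p) x = pval p (vval f x) := by
  simp only [pval, vval]
  rw [← MvPolynomial.coe_aeval_eq_eval, ← MvPolynomial.coe_aeval_eq_eval]
  change (MvPolynomial.aeval _) ((MvPolynomial.bind₁ f) p) = _
  rw [MvPolynomial.aeval_bind₁]
  rfl

/-- A polynomial composed with an affine map. -/
theorem exists_comp_affine {m : ℕ} {p : MvPolynomial (Fin d) ℝ} (hp : p ∈ Poly d m)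
    (A : Eu d →L[ℝ] Eu d) (b : Eu d) :
    ∃ q ∈ Poly d m, ∀ x, pval q x = pval p (A x + b) := by
  let f : Fin d → MvPolynomial (Fin d) ℝ := fun i =>
    ∑ j, MvPolynomial.C (A (EuclideanSpace.single j 1) i) * MvPolynomial.X j + MvPolynomial.C (b i)
  refine ⟨MvPolynomial.bind₁ f p, bind₁_mem_Poly hp f fun i => ?_, fun x => ?_⟩
  · refine (MvPolynomial.totalDegree_add _ _).trans (max_le ?_ (by simp))
    refine MvPolynomial.totalDegree_finsetSum_le fun j _ => ?_
    refine (MvPolynomial.totalDegree_mul _ _).trans ?_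
    simp
  · rw [pval_bind₁]
    congr 1
    ext i
    have hx : x = ∑ j, x j • (EuclideanSpace.single j (1 : ℝ) : Eu d) := by
      ext l
      simp [Finset.sum_apply, Pi.single_apply]
    conv_rhs => rw [hx]
    simp only [map_sum, map_smul, vval_apply, f, pval_add, pval_sum, pval_mul, pval_C, pval_X]
    simp [mul_comm]

theorem grad_mem_Poly {m : ℕ} {p : MvPolynomial (Fin d) ℝ} (hp : p ∈ Poly d (m + 1)) (i : Fin d) :
    grad p i ∈ Poly d m := by
  rw [MvPolynomial.mem_restrictTotalDegree] at hp ⊢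
  refine Finset.sup_le fun s hs => ?_
  rw [MvPolynomial.mem_support_iff, grad, MvPolynomial.coeff_pderiv] at hs
  have h := MvPolynomial.le_totalDegree (MvPolynomial.mem_support_iff.2 (left_ne_zero_of_mul hs))
  rw [Finsupp.sum_add_index' (by simp) (by simp), Finsupp.sum_single_index rfl] at h
  exact Nat.add_le_add_iff_right.1 (h.trans hp)

/-- Links the formal gradient to calculus; the mean value inequality and the divergence theorem on
cones both reduce to differentiation along lines. The proof is induction on the polynomial with the
product rule. -/
theorem hasDerivAt_pval_line (p : MvPolynomial (Fin d) ℝ) (a v : Eu d) (t : ℝ) :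
    HasDerivAt (fun t : ℝ => pval p (a + t • v)) (inner ℝ (vval (grad p) (a + t • v)) v) t := by
  simp only [inner_vval]
  induction p using MvPolynomial.induction_on with
  | C c =>
    simpa [pval_C, grad, pval_zero] using hasDerivAt_const t c
  | add p q hp hq =>
    simp only [grad, map_add, pval_add, add_mul, Finset.sum_add_distrib] at hp hq ⊢
    exact hp.add hq
  | mul_X p j hp =>
    have hX : HasDerivAt (fun t : ℝ => a j + t * v j) (v j) t := by
      simpa using ((hasDerivAt_id t).mul_const (v j)).const_add (a j)
    have h := hp.mul hX
    have he : (fun t : ℝ => pval (p * MvPolynomial.X j) (a + t • v)) =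
        (fun t : ℝ => pval p (a + t • v)) * fun t : ℝ => a j + t * v j := by
      funext t
      simp [pval_mul, pval_X]
    rw [he]
    refine h.congr_deriv (Eq.symm ?_)
    simp only [grad, Derivation.leibniz, MvPolynomial.pderiv_X, pval_add, smul_eq_mul, pval_mul,
      pval_X, add_mul, Finset.sum_add_distrib]
    rw [add_comm]
    congr 1
    · rw [Finset.sum_mul]
      refine Finset.sum_congr rfl fun i _ => ?_
      simp
      ring
    · rw [Finset.sum_eq_single j]
      · simp [pval]
      · intro i _ hij
        simp [hij.symm, pval_zero]
      · simp

/-- Mean value inequality for polynomials. -/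
theorem abs_pval_sub_le {p : MvPolynomial (Fin d) ℝ} {x z : Eu d} {G : ℝ}
    (hG : ∀ y ∈ segment ℝ z x, ‖vval (grad p) y‖ ≤ G) :
    |pval p x - pval p z| ≤ G * ‖x - z‖ := by
  have h := norm_image_sub_le_of_norm_deriv_le_segment_01'
    (f := fun t : ℝ => pval p (z + t • (x - z))) (C := G * ‖x - z‖)
    (fun t _ => (hasDerivAt_pval_line p z (x - z) t).hasDerivWithinAt) fun t ht => by
      refine (norm_inner_le_norm _ _).trans ?_
      refine mul_le_mul_of_nonneg_right (hG _ ?_) (norm_nonneg _)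
      rw [segment_eq_image']
      exact ⟨t, ⟨ht.1, ht.2.le⟩, rfl⟩
  simpa using h

/-- A Euclidean ball contains a box, that is, a product of infinite sets, on which a nonzero
polynomial cannot vanish. -/
theorem eq_zero_of_pval_eq_zero_on_ball {p : MvPolynomial (Fin d) ℝ} {y : Eu d} {r : ℝ}
    (hr : 0 < r) (h : ∀ x ∈ Metric.ball y r, pval p x = 0) : p = 0 := by
  have hc : Continuous (WithLp.toLp 2 : (Fin d → ℝ) → Eu d) := PiLp.continuous_toLp 2 _
  have hn : (WithLp.toLp 2 : (Fin d → ℝ) → Eu d) ⁻¹' Metric.ball y r ∈ 𝓝 (fun i => y i) := by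
    refine hc.continuousAt.preimage_mem_nhds (Metric.ball_mem_nhds _ hr)
  obtain ⟨ε, hε, hb⟩ := Metric.mem_nhds_iff.1 hn
  rw [ball_pi _ hε] at hb
  refine MvPolynomial.funext_set (fun i => Metric.ball (y i) ε) (fun i => ?_) fun x hx => ?_
  · rw [Real.ball_eq_Ioo]
    exact Set.Ioo_infinite (by linarith)
  · have := h _ (hb hx)
    simpa [pval] using this

theorem continuous_pval_sq (p : MvPolynomial (Fin d) ℝ) : Continuous fun x => pval p x ^ 2 :=
  (continuous_pval p).pow 2

/-- Polynomials of bounded degree form a finite-dimensional space that embeds into `L²` of the unit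
ball. The restriction to the larger ball with the sup norm is thus a linear map on the
finite-dimensional image of this embedding, hence bounded. -/
theorem exists_unit_ball_const (d m : ℕ) (Γ : ℝ) : ∃ C : ℝ, 0 < C ∧ ∀ p ∈ Poly d m,
    ∀ x : Eu d, ‖x‖ ≤ Γ → pval p x ^ 2 ≤ C * ∫ z in Metric.closedBall (0 : Eu d) 1, pval p z ^ 2 := by
  let μ : Measure (Eu d) := volume.restrict (Metric.closedBall (0 : Eu d) 1)
  have : IsFiniteMeasure μ := ⟨by
    simpa [μ] using (isCompact_closedBall (0 : Eu d) 1).measure_lt_top⟩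
  have hmem (p : MvPolynomial (Fin d) ℝ) : MemLp (pval p) 2 μ := by
    obtain ⟨c, hc⟩ := (isCompact_closedBall (0 : Eu d) 1).exists_bound_of_continuousOn
      (continuous_pval p).continuousOn
    refine MemLp.of_bound (continuous_pval p).aestronglyMeasurable c ?_
    filter_upwards [ae_restrict_mem Metric.isClosed_closedBall.measurableSet] with x hx using hc x hx
  let B : Poly d m →ₗ[ℝ] Lp ℝ 2 μ :=
    { toFun := fun p => (hmem p).toLp _
      map_add' := fun p q => by
        rw [← MemLp.toLp_add]
        congr 1
        funext x
        simp [pval]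
      map_smul' := fun c p => by
        rw [RingHom.id_apply, ← MemLp.toLp_const_smul]
        congr 1
        funext x
        simp [pval, MvPolynomial.smul_eval] }
  have hB (p : Poly d m) : ‖B p‖ ^ 2 = ∫ z in Metric.closedBall (0 : Eu d) 1, pval p.1 z ^ 2 := by
    rw [← real_inner_self_eq_norm_sq, L2.inner_def]
    refine integral_congr_ae ?_
    filter_upwards [(hmem p).coeFn_toLp] with x hx
    change inner ℝ (((hmem p).toLp _ : Lp ℝ 2 μ) x) (((hmem p).toLp _ : Lp ℝ 2 μ) x) = _
    rw [hx]
    simp [sq]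
  have hinj : Function.Injective B := by
    rw [injective_iff_map_eq_zero]
    intro p hp
    have h0 : ∫ z in Metric.closedBall (0 : Eu d) 1, pval p.1 z ^ 2 = 0 := by rw [← hB, hp]; simp
    have hae : (fun z => pval p.1 z ^ 2) =ᵐ[volume.restrict (Metric.ball (0 : Eu d) 1)] 0 := by
      rw [setIntegral_eq_zero_iff_of_nonneg_ae (Filter.Eventually.of_forall fun x => sq_nonneg _)
        ((continuous_pval_sq p.1).continuousOn.integrableOn_compact
          (isCompact_closedBall _ _))] at h0
      exact ae_restrict_of_ae_restrict_of_subset Metric.ball_subset_closedBall h0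
    have hz := Measure.eqOn_open_of_ae_eq hae Metric.isOpen_ball
      (continuous_pval_sq p.1).continuousOn continuousOn_const
    refine Subtype.ext (eq_zero_of_pval_eq_zero_on_ball (y := 0) one_pos fun x hx => ?_)
    have := hz hx
    simpa using this
  let K : Set (Eu d) := Metric.closedBall 0 Γ
  have : CompactSpace K := isCompact_iff_compactSpace.1 (isCompact_closedBall _ _)
  let A : Poly d m →ₗ[ℝ] C(K, ℝ) :=
    { toFun := fun p => ⟨fun x => pval p.1 x.1, (continuous_pval p.1).comp continuous_subtype_val⟩
      map_add' := fun p q => by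
        ext x
        simp [pval]
      map_smul' := fun c p => by
        ext x
        simp [pval, MvPolynomial.smul_eval] }
  let e := LinearEquiv.ofInjective B hinj
  let T : LinearMap.range B →L[ℝ] C(K, ℝ) := LinearMap.toContinuousLinearMap (A ∘ₗ e.symm.toLinearMap)
  refine ⟨‖T‖ ^ 2 + 1, by positivity, fun p hp x hx => ?_⟩
  have h1 : T (e ⟨p, hp⟩) = A ⟨p, hp⟩ := by simp [T]
  have h2 : ‖A ⟨p, hp⟩‖ ≤ ‖T‖ * ‖B ⟨p, hp⟩‖ := by
    rw [← h1]
    exact T.le_opNorm _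
  have h3 : |pval p x| ≤ ‖A ⟨p, hp⟩‖ :=
    (A ⟨p, hp⟩).norm_coe_le_norm ⟨x, by simpa [K] using hx⟩
  rw [← hB ⟨p, hp⟩, ← sq_abs]
  have h4 := pow_le_pow_left₀ (abs_nonneg _) (h3.trans h2) 2
  rw [mul_pow] at h4
  nlinarith [sq_nonneg ‖B ⟨p, hp⟩‖]

/-- On polynomials of bounded degree, the values on a ball are controlled by the `L²`-norm over a
smaller concentric ball, uniformly in the position and the size of the balls. -/
theorem exists_ball_const (d m : ℕ) (Γ : ℝ) : ∃ C : ℝ, 0 < C ∧ ∀ p ∈ Poly d m,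
    ∀ (y : Eu d) (r : ℝ), 0 < r → ∀ x, ‖x - y‖ ≤ Γ * r →
      pval p x ^ 2 ≤ C * (r ^ d)⁻¹ * ∫ z in Metric.closedBall y r, pval p z ^ 2 := by
  obtain ⟨C, hC, h⟩ := exists_unit_ball_const d m Γ
  refine ⟨C, hC, fun p hp y r hr x hx => ?_⟩
  -- The map `z ↦ r z + y` carries the unit ball to the given one; its Jacobian is the source of `(r
  -- ^ d)⁻¹`.
  obtain ⟨q, hq, hqp⟩ := exists_comp_affine hp (r • ContinuousLinearMap.id ℝ (Eu d)) y
  have h1 := h q hq (r⁻¹ • (x - y)) (by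
    rw [norm_smul, norm_inv, Real.norm_of_nonneg hr.le, inv_mul_le_iff₀ hr]
    linarith)
  simp only [hqp] at h1
  have h2 : (r • ContinuousLinearMap.id ℝ (Eu d)) (r⁻¹ • (x - y)) + y = x := by
    simp [smul_smul, hr.ne']
  rw [h2] at h1
  refine h1.trans_eq ?_
  rw [mul_assoc]
  congr 1
  have h3 := Measure.setIntegral_comp_smul_of_pos (volume : Measure (Eu d))
    (fun z => pval p (z + y) ^ 2) (Metric.closedBall 0 1) hr
  rw [finrank_euclideanSpace_fin, smul_closedBall _ _ zero_le_one, smul_zero, mul_one,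
    Real.norm_of_nonneg hr.le, smul_eq_mul] at h3
  have h4 := (measurePreserving_add_right (volume : Measure (Eu d)) y).setIntegral_preimage_emb
    (measurableEmbedding_addRight y) (fun z => pval p z ^ 2) (Metric.closedBall y r)
  have h5 : (fun z => z + y) ⁻¹' Metric.closedBall y r = Metric.closedBall (0 : Eu d) r := by
    ext z
    simp
  rw [h5] at h4
  rw [← h4, ← h3]
  rfl

end Polynomial

/-! ### Integration over cones -/

section Cone

variable {d : ℕ}

/-- The coarea formula for the height `⟨n, ·⟩`, whose Jacobian is `1` because `n` is a unit vector.
-/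
theorem volume_eq_lintegral_slices {n : Eu d} (hn : ‖n‖ = 1) {S : Set (Eu d)}
    (hS : MeasurableSet S) :
    volume S = ∫⁻ s : ℝ, μHE[d - 1] (S ∩ {y | inner ℝ n y = s}) := by
  have hn0 : n ≠ 0 := by
    rintro rfl
    simp at hn
  have h := EuclideanGeometry.euclideanHausdorffMeasure_eq_lintegral (V := Eu d) (0 : Eu d) hn0 hS
  rw [finrank_euclideanSpace_fin, EuclideanSpace.euclideanHausdorffMeasure_eq_volume,
    ← ofReal_norm, hn, ENNReal.ofReal_one, one_mul] at h
  rw [h]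
  refine lintegral_congr fun s => ?_
  congr 2
  ext y
  simp only [vadd_eq_add, add_zero, SetLike.mem_coe, AffineSubspace.mem_mk', vsub_eq_sub,
    Submodule.mem_orthogonal_singleton_iff_inner_right, inner_sub_right, inner_smul_right,
    real_inner_self_eq_norm_sq, hn, Set.mem_ofPred_eq]
  constructor <;> intro h' <;> linarith

theorem volume_hyperplane {n : Eu d} (hn : ‖n‖ = 1) (c : ℝ) :
    volume {y : Eu d | inner ℝ n y = c} = 0 := by
  have hm : MeasurableSet {y : Eu d | inner ℝ n y = c} :=
    (isClosed_eq (by fun_prop) continuous_const).measurableSet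
  rw [volume_eq_lintegral_slices hn hm]
  have hae : ∀ᵐ s : ℝ, s ≠ c := by simp [ae_iff]
  rw [← lintegral_zero (μ := (volume : Measure ℝ))]
  refine lintegral_congr_ae ?_
  filter_upwards [hae] with s hs
  have : ({y : Eu d | inner ℝ n y = c} ∩ {y | inner ℝ n y = s}) = ∅ := by
    ext y
    simp only [Set.mem_inter_iff, Set.mem_ofPred_eq, Set.mem_empty_iff_false, iff_false]
    rintro ⟨h1, h2⟩
    exact hs (h2.symm.trans h1)
  simp [this]

/-- The parametrization of the cone with apex `a` over a subset of the hyperplane at height `c`,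
by the height `s` and the point of the base; `α` is the height of the apex. -/
noncomputable def coneMap (a : Eu d) (α c : ℝ) (q : ℝ × Eu d) : Eu d := a + ((q.1 - α) / (c - α)) • (q.2 - a)

theorem continuous_coneMap (a : Eu d) (α c : ℝ) : Continuous (coneMap a α c) := by
  unfold coneMap
  fun_prop

/-- The measure on the parameter domain which `coneMap` transports to the volume. -/
noncomputable def coneMeasure (α c : ℝ) (F : Set (Eu d)) : Measure (ℝ × Eu d) :=
  ((volume.restrict (Set.Ioo α c)).withDensity
    (fun s => ENNReal.ofReal (((s - α) / (c - α)) ^ (d - 1)))).prod (μHE[d - 1].restrict F)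

theorem mem_convexJoin_singleton {a x : Eu d} {F : Set (Eu d)} :
    x ∈ convexJoin ℝ {a} F ↔ ∃ y ∈ F, ∃ t ∈ Set.Icc (0 : ℝ) 1, x = a + t • (y - a) := by
  simp only [mem_convexJoin, Set.mem_singleton_iff, exists_eq_left, segment_eq_image', Set.mem_image]
  constructor
  · rintro ⟨y, hy, t, ht, rfl⟩
    exact ⟨y, hy, t, ht, rfl⟩
  · rintro ⟨y, hy, t, ht, rfl⟩
    exact ⟨y, hy, t, ht, rfl⟩

theorem isCompact_cone {a : Eu d} {F : Set (Eu d)} (hF : IsCompact F) :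
    IsCompact (convexJoin ℝ {a} F) := by
  have : convexJoin ℝ {a} F = (fun q : ℝ × Eu d => a + q.1 • (q.2 - a)) '' (Set.Icc 0 1 ×ˢ F) := by
    ext x
    rw [mem_convexJoin_singleton]
    constructor
    · rintro ⟨y, hy, t, ht, rfl⟩
      exact ⟨(t, y), ⟨ht, hy⟩, rfl⟩
    · rintro ⟨⟨t, y⟩, ⟨ht, hy⟩, rfl⟩
      exact ⟨y, hy, t, ht, rfl⟩
  rw [this]
  exact (isCompact_Icc.prod hF).image (by fun_prop)

/-- At an intermediate height a point of the cone has a determined ratio along its ray, so the slice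
is a homothetic copy of the base and its `(d-1)`-dimensional measure scales by a power of the ratio.
The set `S` is carried along so that measures, and not only sizes, can be compared. -/
theorem cone_slice {n a : Eu d} {α c s : ℝ} {F S : Set (Eu d)} (ha : inner ℝ n a = α)
    (hF : ∀ x ∈ F, inner ℝ n x = c) (hs : s ∈ Set.Ioo α c) :
    S ∩ convexJoin ℝ {a} F ∩ {y | inner ℝ n y = s} =
      AffineMap.homothety a ((s - α) / (c - α)) '' (F ∩ {y | coneMap a α c (s, y) ∈ S}) := by
  have hc : 0 < c - α := by linarith [hs.1, hs.2]
  have hhom (y : Eu d) : AffineMap.homothety a ((s - α) / (c - α)) y = coneMap a α c (s, y) := by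
    simp [AffineMap.homothety_apply, coneMap, add_comm]
  have hin (y : Eu d) (hy : y ∈ F) (t : ℝ) : inner ℝ n (a + t • (y - a)) = α + t * (c - α) := by
    rw [inner_add_right, inner_smul_right, inner_sub_right, hF y hy, ha]
  ext x
  simp only [Set.mem_inter_iff, mem_convexJoin_singleton, Set.mem_ofPred_eq, Set.mem_image, hhom]
  constructor
  · rintro ⟨⟨hxS, y, hy, t, ht, rfl⟩, hxs⟩
    rw [hin y hy] at hxs
    have ht' : t = (s - α) / (c - α) := by
      rw [eq_div_iff hc.ne']
      linarith
    subst ht'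
    exact ⟨y, ⟨hy, hxS⟩, rfl⟩
  · rintro ⟨y, ⟨hy, hyS⟩, rfl⟩
    refine ⟨⟨hyS, y, hy, (s - α) / (c - α), ⟨?_, ?_⟩, rfl⟩, ?_⟩
    · exact div_nonneg (by linarith [hs.1]) hc.le
    · rw [div_le_one hc]
      linarith [hs.2]
    · rw [coneMap, hin y hy]
      field_simp
      ring

/-- Slicing by height: `cone_slice` and the scaling of `μHE[d - 1]` give exactly the density built
into `coneMeasure`. -/
theorem restrict_cone {n a : Eu d} {α c : ℝ} {F : Set (Eu d)} (hn : ‖n‖ = 1)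
    (ha : inner ℝ n a = α) (hFc : IsCompact F) (hF : ∀ x ∈ F, inner ℝ n x = c) (hac : α < c) :
    volume.restrict (convexJoin ℝ {a} F) = (coneMeasure α c F).map (coneMap a α c) := by
  have hc : 0 < c - α := by linarith
  have hT := (isCompact_cone (a := a) hFc).measurableSet
  have : IsFiniteMeasure (μHE[d - 1].restrict F) :=
    ⟨by simpa using flat_measure_lt_top hFc hn hF⟩
  have hm := (continuous_coneMap a α c).measurable
  ext S hS
  rw [Measure.restrict_apply hS, volume_eq_lintegral_slices hn (hS.inter hT),
    Measure.map_apply hm hS, coneMeasure, Measure.prod_apply (hm hS),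
    lintegral_withDensity_eq_lintegral_mul₀ (by fun_prop)
      (measurable_measure_prodMk_left (hm hS)).aemeasurable,
    ← lintegral_indicator measurableSet_Ioo]
  refine lintegral_congr_ae ?_
  -- The heights of apex and base lie outside the open interval although the slices there can be
  -- nonempty; they form a null set.
  have hae : ∀ᵐ s : ℝ, s ≠ c ∧ s ≠ α := by
    refine Filter.Eventually.and ?_ ?_ <;> simp [ae_iff]
  filter_upwards [hae] with s hs
  by_cases hsI : s ∈ Set.Ioo α c
  · have hτ : 0 < (s - α) / (c - α) := div_pos (by linarith [hsI.1]) hc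
    have hms : MeasurableSet {y | coneMap a α c (s, y) ∈ S} :=
      ((continuous_coneMap a α c).comp (Continuous.prodMk_right s)).measurable hS
    rw [Set.indicator_of_mem hsI, cone_slice ha hF hsI,
      euclideanHausdorffMeasure_homothety_image _ _ hτ.ne', Pi.mul_apply]
    have h1 : Prod.mk s ⁻¹' (coneMap a α c ⁻¹' S) = {y | coneMap a α c (s, y) ∈ S} := rfl
    rw [h1, Measure.restrict_apply hms, Set.inter_comm F, ENNReal.smul_def, smul_eq_mul]
    congr 1
    rw [ENNReal.ofReal_pow hτ.le, ENNReal.coe_pow]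
    congr 1
    rw [← Real.enorm_of_nonneg hτ.le]
    rfl
  · rw [Set.indicator_of_notMem hsI]
    have : S ∩ convexJoin ℝ {a} F ∩ {y | inner ℝ n y = s} = ∅ := by
      ext x
      simp only [Set.mem_inter_iff, mem_convexJoin_singleton, Set.mem_ofPred_eq,
        Set.mem_empty_iff_false, iff_false]
      rintro ⟨⟨hxS, y, hy, t, ht, rfl⟩, hxs⟩
      rw [inner_add_right, inner_smul_right, inner_sub_right, hF y hy, ha] at hxs
      refine hsI ⟨lt_of_le_of_ne ?_ hs.2.symm, lt_of_le_of_ne ?_ hs.1⟩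
      · nlinarith [ht.1]
      · nlinarith [ht.2]
    rw [this, measure_empty]

theorem volume_cone_eq_zero {n a : Eu d} {α c : ℝ} {F : Set (Eu d)} (hn : ‖n‖ = 1)
    (ha : inner ℝ n a = α) (hFc : IsCompact F) (hF : ∀ x ∈ F, inner ℝ n x = c) (hac : α < c)
    (h0 : μHE[d - 1] F = 0) : volume (convexJoin ℝ {a} F) = 0 := by
  rw [← Measure.restrict_apply_univ, restrict_cone hn ha hFc hF hac, coneMeasure,
    Measure.restrict_eq_zero.2 h0, Measure.prod_zero]
  simp

/-- The volume integral over a cone as an iterated integral. -/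
theorem integral_cone {n a : Eu d} {α c : ℝ} {F : Set (Eu d)} (hn : ‖n‖ = 1)
    (ha : inner ℝ n a = α) (hFc : IsCompact F) (hF : ∀ x ∈ F, inner ℝ n x = c) (hac : α < c)
    {φ : Eu d → ℝ} (hφ : Continuous φ) :
    ∫ x in convexJoin ℝ {a} F, φ x =
      ∫ y in F, (∫ s in α..c, ((s - α) / (c - α)) ^ (d - 1) * φ (coneMap a α c (s, y))) ∂μHE[d - 1] := by
  have : IsFiniteMeasure (μHE[d - 1].restrict F) :=
    ⟨by simpa using flat_measure_lt_top hFc hn hF⟩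
  have hm := (continuous_coneMap a α c).measurable
  have hint : IntegrableOn φ (convexJoin ℝ {a} F) :=
    hφ.continuousOn.integrableOn_compact (isCompact_cone hFc)
  rw [IntegrableOn, restrict_cone hn ha hFc hF hac,
    integrable_map_measure hφ.aestronglyMeasurable hm.aemeasurable] at hint
  rw [restrict_cone hn ha hFc hF hac, integral_map hm.aemeasurable hφ.aestronglyMeasurable]
  have h1 := integral_prod_symm _ hint
  rw [coneMeasure] at *
  simp only [Function.comp_apply] at h1
  rw [h1]
  refine integral_congr_ae (Filter.Eventually.of_forall fun y => ?_)
  dsimp only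
  rw [integral_withDensity_eq_integral_toReal_smul₀ (by fun_prop) (by simp),
    intervalIntegral.integral_of_le hac.le, integral_Ioc_eq_integral_Ioo]
  refine setIntegral_congr_fun measurableSet_Ioo fun s hs => ?_
  rw [ENNReal.toReal_ofReal, smul_eq_mul]
  exact pow_nonneg (div_nonneg (by linarith [hs.1]) (by linarith)) _

theorem continuous_radial (p : MvPolynomial (Fin d) ℝ) (a : Eu d) :
    Continuous fun x => d * pval p x + inner ℝ (vval (grad p) x) (x - a) :=
  (continuous_const.mul (continuous_pval p)).add
    ((continuous_vval _).inner (continuous_id.sub continuous_const))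

/-- The divergence theorem on a cone for a polynomial multiple of the radial field. -/
theorem integral_cone_radial (hd : 1 ≤ d) {n a : Eu d} {α c : ℝ} {F : Set (Eu d)} (hn : ‖n‖ = 1)
    (ha : inner ℝ n a = α) (hFc : IsCompact F) (hF : ∀ x ∈ F, inner ℝ n x = c) (hac : α < c)
    (p : MvPolynomial (Fin d) ℝ) :
    ∫ x in convexJoin ℝ {a} F, (d * pval p x + inner ℝ (vval (grad p) x) (x - a)) =
      (c - α) * ∫ y in F, pval p y ∂μHE[d - 1] := by
  rw [integral_cone hn ha hFc hF hac (continuous_radial p a), ← integral_const_mul]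
  refine integral_congr_ae (Filter.Eventually.of_forall fun y => ?_)
  have hc : c - α ≠ 0 := by linarith
  dsimp only
  -- The integrand along a ray is an exact derivative. The primitive vanishes at the apex, since `d
  -- ≥ 1`, and equals `(c - α) p(y)` at the base.
  have hder (s : ℝ) : HasDerivAt
      (fun s => (c - α) * (((s - α) / (c - α)) ^ d * pval p (coneMap a α c (s, y))))
      (((s - α) / (c - α)) ^ (d - 1) * (d * pval p (coneMap a α c (s, y)) +
        inner ℝ (vval (grad p) (coneMap a α c (s, y))) (coneMap a α c (s, y) - a))) s := by
    have h1 : HasDerivAt (fun s : ℝ => (s - α) / (c - α)) (1 / (c - α)) s :=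
      ((hasDerivAt_id s).sub_const α).div_const _
    have h2 := (hasDerivAt_pval_line p a (y - a) ((s - α) / (c - α))).comp s h1
    have h3 := ((h1.pow d).mul h2).const_mul (c - α)
    refine h3.congr_deriv ?_
    obtain ⟨e, rfl⟩ : ∃ e, d = e + 1 := ⟨d - 1, by omega⟩
    simp only [coneMap, Function.comp_apply, add_sub_cancel_left, inner_smul_right,
      Nat.add_sub_cancel, pow_succ, Pi.pow_apply]
    field_simp
  rw [intervalIntegral.integral_eq_sub_of_hasDerivAt (fun s _ => hder s)]
  · simp [coneMap, hc]
    exact Or.inl (by omega)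
  · refine Continuous.intervalIntegrable ?_ _ _
    have h4 : Continuous fun s : ℝ => coneMap a α c (s, y) :=
      (continuous_coneMap a α c).comp (Continuous.prodMk_left y)
    exact (by fun_prop : Continuous fun s : ℝ => ((s - α) / (c - α)) ^ (d - 1)).mul
      ((continuous_radial p a).comp h4)

end Cone

/-! ### Bodies star-shaped with respect to a ball -/

section Star

variable {d : ℕ} {K : Set (Eu d)} {x₀ a : Eu d} {ρ : ℝ}

/-- The homothety with centre `x` and nonzero ratio `1 - t` sends the open ball to an open set.
Star-shapedness about each point of the ball keeps this set in `K`, and the image of `a` is the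
point in question. -/
theorem mem_interior_of_star (hstar : ∀ y ∈ Metric.closedBall x₀ ρ, y ∈ K ∧ StarConvex ℝ y K)
    (ha : a ∈ Metric.ball x₀ ρ) {x : Eu d} (hx : x ∈ K) {t : ℝ} (ht0 : 0 ≤ t) (ht1 : t < 1) :
    a + t • (x - a) ∈ interior K := by
  have ht : 1 - t ≠ 0 := by linarith
  have ho : IsOpen (AffineMap.homothety x (1 - t) '' Metric.ball x₀ ρ) :=
    AffineMap.homothety_isOpenMap x (1 - t) ht _ Metric.isOpen_ball
  refine interior_maximal ?_ ho ⟨a, ha, ?_⟩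
  · rintro _ ⟨y, hy, rfl⟩
    have h := (hstar y (Metric.ball_subset_closedBall hy)).2 hx (by linarith : (0 : ℝ) ≤ 1 - t) ht0
      (by ring)
    convert h using 1
    simp only [AffineMap.homothety_apply, vsub_eq_sub, vadd_eq_add, smul_sub, sub_smul, one_smul]
    abel
  · simp only [AffineMap.homothety_apply, vsub_eq_sub, vadd_eq_add, smul_sub, sub_smul, one_smul]
    abel

/-- The last point of a bounded body on a ray is on its frontier. -/
theorem exists_mem_frontier_ray (hK : IsCompact K) (ha : a ∈ K) {w : Eu d} (hw : w ≠ 0) :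
    ∃ t : ℝ, 0 ≤ t ∧ a + t • w ∈ frontier K ∧ ∀ s : ℝ, 0 ≤ s → a + s • w ∈ K → s ≤ t := by
  have hwn : 0 < ‖w‖ := norm_pos_iff.2 hw
  have hcont : Continuous fun s : ℝ => a + s • w := by fun_prop
  let A : Set ℝ := Set.Ici 0 ∩ (fun s : ℝ => a + s • w) ⁻¹' K
  obtain ⟨R, hR⟩ := hK.isBounded.exists_norm_le
  have hA : IsCompact A := by
    refine Metric.isCompact_of_isClosed_isBounded (isClosed_Ici.inter (hK.isClosed.preimage hcont)) ?_
    refine (Metric.isBounded_Icc 0 ((R + ‖a‖) / ‖w‖)).subset fun s hs => ⟨hs.1, ?_⟩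
    rw [le_div_iff₀ hwn]
    have h1 : ‖s • w‖ ≤ R + ‖a‖ := by
      have : s • w = (a + s • w) - a := by abel
      rw [this]
      exact (norm_sub_le _ _).trans (add_le_add_left (hR _ hs.2) _)
    rwa [norm_smul, Real.norm_of_nonneg hs.1] at h1
  obtain ⟨t, htA, ht⟩ := hA.exists_isMaxOn ⟨0, by simpa [A] using ha⟩ continuousOn_id
  refine ⟨t, htA.1, ?_, fun s hs0 hs => ht (a := s) ⟨hs0, hs⟩⟩
  rw [frontier, hK.isClosed.closure_eq]
  refine ⟨htA.2, fun hint => ?_⟩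
  have hn : (fun s : ℝ => a + s • w) ⁻¹' interior K ∈ 𝓝 t :=
    hcont.continuousAt.preimage_mem_nhds (isOpen_interior.mem_nhds hint)
  obtain ⟨ε, hε, hb⟩ := Metric.mem_nhds_iff.1 hn
  have h2 : t + ε / 2 ∈ Metric.ball t ε := by
    rw [Metric.mem_ball, Real.dist_eq, add_sub_cancel_left, abs_of_pos (by linarith)]
    linarith
  have h3 : t + ε / 2 ≤ t := ht (a := t + ε / 2)
    ⟨by have : (0 : ℝ) ≤ t := htA.1
        change (0 : ℝ) ≤ t + ε / 2
        linarith, (interior_subset : interior K ⊆ K) (hb h2)⟩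
  linarith

/-- The hyperplane of a flat piece of the frontier does not meet the ball with respect to which a
body is star-shaped. -/
theorem inner_lt_of_star (hstar : ∀ y ∈ Metric.closedBall x₀ ρ, y ∈ K ∧ StarConvex ℝ y K)
    {n z : Eu d} {c r : ℝ} (hr : 0 < r) (hz : z ∈ frontier K) (hzc : inner ℝ n z = c)
    (hdisc : ∀ y ∈ Metric.closedBall z r, inner ℝ n y = c → y ∈ K)
    (hx₀ : inner ℝ n x₀ < c) (ha : a ∈ Metric.ball x₀ ρ) : inner ℝ n a < c := by
  by_contra! hcon
  have hρ : 0 < ρ := Metric.pos_of_mem_ball ha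
  -- If `a` reached the hyperplane, the segment from `x₀` to `a` would cross it at some point `b`
  -- still in the ball.
  obtain ⟨b, hb, hbc⟩ : ∃ b ∈ Metric.ball x₀ ρ, inner ℝ n b = c := by
    have hpos : 0 < inner ℝ n a - inner ℝ n x₀ := by linarith
    refine ⟨x₀ + ((c - inner ℝ n x₀) / (inner ℝ n a - inner ℝ n x₀)) • (a - x₀), ?_, ?_⟩
    · refine (convex_ball x₀ ρ).add_smul_sub_mem (Metric.mem_ball_self hρ) ha ⟨?_, ?_⟩
      · exact div_nonneg (by linarith) hpos.le
      · rw [div_le_one hpos]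
        linarith
    · rw [inner_add_right, inner_smul_right, inner_sub_right]
      field_simp
      ring
  -- Pushing `z` away from `b` inside the hyperplane by this factor stays in the disc, hence in `K`.
  -- Then `z` lies strictly between `b` and a point of `K` (or is `b`), so it is interior, against
  -- `z ∈ frontier K`. The summand `1` covers `z = b`.
  let ε : ℝ := r / (1 + ‖z - b‖)
  have hb1 : 0 < 1 + ‖z - b‖ := by positivity
  have hε : 0 < ε := div_pos hr hb1
  have hz' : z + ε • (z - b) ∈ K := by
    refine hdisc _ ?_ ?_
    · rw [mem_closedBall_iff_norm, add_sub_cancel_left, norm_smul, Real.norm_of_nonneg hε.le,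
        div_mul_eq_mul_div, div_le_iff₀ hb1]
      nlinarith [norm_nonneg (z - b)]
    · rw [inner_add_right, inner_smul_right, inner_sub_right, hzc, hbc]
      ring
  have hi := mem_interior_of_star hstar hb hz' (t := 1 / (1 + ε)) (by positivity)
    (by rw [div_lt_one (by linarith)]; linarith)
  have he : b + (1 / (1 + ε)) • (z + ε • (z - b) - b) = z := by
    have h1 : z + ε • (z - b) - b = (1 + ε) • (z - b) := by
      rw [add_smul, one_smul]
      abel
    rw [h1, smul_smul, one_div_mul_cancel (by linarith), one_smul]
    abel
  rw [he] at hi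
  exact hz.2 hi

/-- Apply `inner_lt_of_star` to points of the open ball approaching `x₀ + ρ n`. This bounds the
heights of the pyramids from below by the radius `ρ`. -/
theorem inner_add_le_of_star (hstar : ∀ y ∈ Metric.closedBall x₀ ρ, y ∈ K ∧ StarConvex ℝ y K)
    {n z : Eu d} {c r : ℝ} (hn : ‖n‖ = 1) (hρ : 0 < ρ) (hr : 0 < r) (hz : z ∈ frontier K)
    (hzc : inner ℝ n z = c) (hdisc : ∀ y ∈ Metric.closedBall z r, inner ℝ n y = c → y ∈ K)
    (hx₀ : inner ℝ n x₀ < c) : inner ℝ n x₀ + ρ ≤ c := by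
  refine le_of_forall_pos_lt_add fun ε hε => ?_
  have h := inner_lt_of_star hstar hr hz hzc hdisc hx₀ (a := x₀ + (max (ρ - ε) 0) • n) (by
    rw [mem_ball_iff_norm, add_sub_cancel_left, norm_smul, hn, mul_one,
      Real.norm_of_nonneg (le_max_right _ _)]
    exact max_lt (by linarith) hρ)
  rw [inner_add_right, inner_smul_right, real_inner_self_eq_norm_sq, hn] at h
  linarith [le_max_left (ρ - ε) 0]

/-- A ray from `a` meets the frontier only once, since the nearer of two frontier points would be
interior by `mem_interior_of_star`. A common point other than the apex thus lies over a common base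
point, and negligible overlap of faces becomes negligible overlap of cones. -/
theorem cone_inter_cone_subset
    (hstar : ∀ y ∈ Metric.closedBall x₀ ρ, y ∈ K ∧ StarConvex ℝ y K)
    (ha : a ∈ Metric.ball x₀ ρ) {F F' : Set (Eu d)} (hF : F ⊆ frontier K) (hF' : F' ⊆ frontier K)
    (hK : IsClosed K) :
    convexJoin ℝ {a} F ∩ convexJoin ℝ {a} F' ⊆ insert a (convexJoin ℝ {a} (F ∩ F')) := by
  have key : ∀ y ∈ frontier K, ∀ y' ∈ frontier K, ∀ t t' : ℝ, 0 ≤ t → t < t' →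
      a + t • (y - a) ≠ a + t' • (y' - a) := by
    intro y hy y' hy' t t' ht htt' he
    have ht' : 0 < t' := ht.trans_lt htt'
    have hyK : y ∈ K := hK.frontier_subset hy
    have h := mem_interior_of_star hstar ha hyK (t := t / t') (by positivity)
      ((div_lt_one ht').2 htt')
    have h1 : a + (t / t') • (y - a) = y' := by
      have h2 : t • (y - a) = t' • (y' - a) := add_left_cancel he
      rw [div_eq_inv_mul, mul_smul, h2, smul_smul, inv_mul_cancel₀ ht'.ne', one_smul]
      abel
    rw [h1] at h
    exact hy'.2 h
  rintro x ⟨hx, hx'⟩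
  obtain ⟨y, hy, t, ht, hxt⟩ := mem_convexJoin_singleton.1 hx
  obtain ⟨y', hy', t', ht', hxt'⟩ := mem_convexJoin_singleton.1 hx'
  rcases lt_trichotomy t t' with h | h | h
  · exact absurd (hxt.symm.trans hxt') (key y (hF hy) y' (hF' hy') t t' ht.1 h)
  · subst h
    rcases ht.1.eq_or_lt with h0 | h0
    · left
      rw [hxt, ← h0]
      simp
    · have h2 : t • (y - a) = t • (y' - a) := add_left_cancel (hxt.symm.trans hxt')
      have h3 : y = y' := sub_left_injective (smul_right_injective _ h0.ne' h2)
      subst h3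
      exact Or.inr (mem_convexJoin_singleton.2 ⟨y, ⟨hy, hy'⟩, t, ht, hxt⟩)
  · exact absurd (hxt'.symm.trans hxt) (key y' (hF' hy') y (hF hy) t' t ht'.1 h)

theorem exists_mem_frontier_cone (hd : 1 ≤ d) (hK : IsCompact K) (ha : a ∈ K) {x : Eu d}
    (hx : x ∈ K) : ∃ y ∈ frontier K, ∃ t ∈ Set.Icc (0 : ℝ) 1, x = a + t • (y - a) := by
  -- At the apex itself no ray is distinguished: any frontier point serves, with `t = 0`.
  by_cases hxa : x = a
  · have : Nontrivial (Eu d) := by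
      have : Nonempty (Fin d) := ⟨⟨0, hd⟩⟩
      infer_instance
    obtain ⟨w, hw⟩ := exists_ne (0 : Eu d)
    obtain ⟨t, -, ht, -⟩ := exists_mem_frontier_ray hK ha hw
    exact ⟨_, ht, 0, by simp, by simp [hxa]⟩
  · obtain ⟨t, ht0, ht, hmax⟩ := exists_mem_frontier_ray hK ha (sub_ne_zero.2 hxa)
    have h1 : 1 ≤ t := hmax 1 zero_le_one (by simpa using hx)
    refine ⟨_, ht, t⁻¹, ⟨by positivity, inv_le_one_of_one_le₀ h1⟩, ?_⟩
    rw [add_sub_cancel_left, smul_smul, inv_mul_cancel₀ (by linarith), one_smul]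
    abel

theorem cone_subset_of_star {F : Set (Eu d)} (ha : StarConvex ℝ a K) (hF : F ⊆ K) :
    convexJoin ℝ {a} F ⊆ K := by
  intro x hx
  obtain ⟨y, hy, t, ht, rfl⟩ := mem_convexJoin_singleton.1 hx
  exact ha.add_smul_sub_mem (hF hy) ht.1 ht.2

end Star

/-! ### Tiling of elements by cones and the divergence theorem on elements -/

namespace PolytopalMesh

variable {d : ℕ} {Ω : Set (Eu d)} (M : PolytopalMesh Ω)

theorem isCompact_elem (K : Fin M.numElem) : IsCompact (M.elem K) :=
  isCompact_of_isPolytope (M.elem_polytope K)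

theorem isCompact_face (F : Fin M.numFace) : IsCompact (M.face F) :=
  isCompact_of_isPolytope (M.face_polytope F)

theorem face_subset_frontier (T : M.SubElem) : M.face T.1.2 ⊆ frontier (M.elem T.1.1) := by
  rw [M.frontier_elem]
  exact Set.subset_iUnion₂ (s := fun F (_ : M.left F = T.1.1 ∨ M.right F = some T.1.1) => M.face F)
    T.1.2 T.2

theorem face_subset_elem (T : M.SubElem) : M.face T.1.2 ⊆ M.elem T.1.1 :=
  (M.face_subset_frontier T).trans (M.isCompact_elem _).isClosed.frontier_subset

/-- The sign of the fixed normal of the face `F` as an outer normal of the element `K`. -/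
def sgn (K : Fin M.numElem) (F : Fin M.numFace) : ℝ := if M.left F = K then 1 else -1

/-- The outer normal of an element at one of its faces. -/
def outer (T : M.SubElem) : Eu d := M.sgn T.1.1 T.1.2 • M.normal T.1.2

def outerOffset (T : M.SubElem) : ℝ := M.sgn T.1.1 T.1.2 * M.offset T.1.2

theorem sgn_eq (K : Fin M.numElem) (F : Fin M.numFace) : M.sgn K F = 1 ∨ M.sgn K F = -1 := by
  unfold sgn
  split_ifs <;> simp

theorem sgn_ne_zero (K : Fin M.numElem) (F : Fin M.numFace) : M.sgn K F ≠ 0 := by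
  rcases M.sgn_eq K F with h | h <;> simp [h]

theorem norm_outer (T : M.SubElem) : ‖M.outer T‖ = 1 := by
  rw [outer, norm_smul, M.normal_norm]
  rcases M.sgn_eq T.1.1 T.1.2 with h | h <;> simp [h]

theorem inner_outer (T : M.SubElem) (x : Eu d) :
    inner ℝ (M.outer T) x = M.sgn T.1.1 T.1.2 * inner ℝ (M.normal T.1.2) x := by
  rw [outer, real_inner_smul_left]

theorem inner_outer_eq_iff (T : M.SubElem) (x : Eu d) :
    inner ℝ (M.outer T) x = M.outerOffset T ↔ inner ℝ (M.normal T.1.2) x = M.offset T.1.2 := by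
  rw [inner_outer, outerOffset, mul_right_inj' (M.sgn_ne_zero _ _)]

theorem outer_flat (T : M.SubElem) : ∀ x ∈ M.face T.1.2, inner ℝ (M.outer T) x = M.outerOffset T :=
  fun x hx => (M.inner_outer_eq_iff T x).2 (M.face_flat _ x hx)

theorem inner_outer_center_lt (T : M.SubElem) :
    inner ℝ (M.outer T) (M.center T.1.1) < M.outerOffset T := by
  rw [inner_outer, outerOffset, sgn]
  split_ifs with h
  · have := M.center_left T.1.2
    rw [h] at this
    linarith
  · have := M.center_right T.1.2 T.1.1 (T.2.resolve_left h)
    linarith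

variable {M} {γ η : ℝ}

theorem ShapeRegular.inner_outer_lt (hM : M.ShapeRegular γ η) (T : M.SubElem) {ρ : ℝ}
    (hstar : ∀ y ∈ Metric.closedBall (M.center T.1.1) ρ,
      y ∈ M.elem T.1.1 ∧ StarConvex ℝ y (M.elem T.1.1)) {a : Eu d}
    (ha : a ∈ Metric.ball (M.center T.1.1) ρ) : inner ℝ (M.outer T) a < M.outerOffset T := by
  obtain ⟨z, hz, r, hr, -, hdisc⟩ := hM.face_star T.1.2
  exact inner_lt_of_star hstar hr (M.face_subset_frontier T hz) (M.outer_flat T z hz)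
    (fun y hy hyc => M.face_subset_elem T (hdisc y hy ((M.inner_outer_eq_iff T y).1 hyc)).1)
    (M.inner_outer_center_lt T) ha

theorem ShapeRegular.inner_outer_add_le (hM : M.ShapeRegular γ η) (T : M.SubElem) {ρ : ℝ}
    (hρ : 0 < ρ) (hstar : ∀ y ∈ Metric.closedBall (M.center T.1.1) ρ,
      y ∈ M.elem T.1.1 ∧ StarConvex ℝ y (M.elem T.1.1)) :
    inner ℝ (M.outer T) (M.center T.1.1) + ρ ≤ M.outerOffset T := by
  obtain ⟨z, hz, r, hr, -, hdisc⟩ := hM.face_star T.1.2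
  exact inner_add_le_of_star hstar (M.norm_outer T) hρ hr (M.face_subset_frontier T hz)
    (M.outer_flat T z hz)
    (fun y hy hyc => M.face_subset_elem T (hdisc y hy ((M.inner_outer_eq_iff T y).1 hyc)).1)
    (M.inner_outer_center_lt T)

/-- The sub-elements of the element `K`. -/
abbrev SubElemOf (M : PolytopalMesh Ω) (K : Fin M.numElem) : Type := {T : M.SubElem // T.1.1 = K}

theorem iUnion_cone_eq (hd : 1 ≤ d) (K : Fin M.numElem) {a : Eu d} (ha : a ∈ M.elem K)
    (hstar : StarConvex ℝ a (M.elem K)) :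
    ⋃ T : M.SubElemOf K, convexJoin ℝ {a} (M.face T.1.1.2) = M.elem K := by
  refine Set.Subset.antisymm (Set.iUnion_subset fun T => ?_) fun x hx => ?_
  · obtain ⟨T, rfl⟩ := T
    exact cone_subset_of_star hstar (M.face_subset_elem T)
  · obtain ⟨y, hy, t, ht, hxt⟩ := exists_mem_frontier_cone hd (M.isCompact_elem K) ha hx
    rw [M.frontier_elem] at hy
    obtain ⟨F, hF, hyF⟩ := Set.mem_iUnion₂.1 hy
    exact Set.mem_iUnion.2 ⟨⟨⟨(K, F), hF⟩, rfl⟩, mem_convexJoin_singleton.2 ⟨y, hyF, t, ht, hxt⟩⟩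

/-- An element is tiled by the cones over its faces, from any apex in the ball with respect to
which it is star-shaped. -/
theorem ShapeRegular.integral_elem_eq_sum (hM : M.ShapeRegular γ η) (hd : 2 ≤ d)
    (K : Fin M.numElem) {ρ : ℝ} (hstar : ∀ y ∈ Metric.closedBall (M.center K) ρ,
      y ∈ M.elem K ∧ StarConvex ℝ y (M.elem K)) {a : Eu d}
    (ha : a ∈ Metric.ball (M.center K) ρ) {φ : Eu d → ℝ} (hφ : Continuous φ) :
    ∫ x in M.elem K, φ x = ∑ T : M.SubElemOf K, ∫ x in convexJoin ℝ {a} (M.face T.1.1.2), φ x := by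
  have ha' := hstar a (Metric.ball_subset_closedBall ha)
  have hne : Nonempty (Fin d) := ⟨⟨0, by omega⟩⟩
  rw [← iUnion_cone_eq (by omega) K ha'.1 ha'.2, integral_iUnion_ae
    (fun T => (isCompact_cone (M.isCompact_face _)).measurableSet.nullMeasurableSet) ?_ ?_,
    tsum_fintype]
  · rintro ⟨T, rfl⟩ ⟨T', hT'⟩ hTT'
    have hFF' : T.1.2 ≠ T'.1.2 := by
      intro h
      refine hTT' (Subtype.ext (Subtype.ext (Prod.ext hT'.symm h)))
    have hF' := M.face_subset_frontier T'
    rw [hT'] at hF'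
    refine measure_mono_null (cone_inter_cone_subset hstar ha (M.face_subset_frontier T)
      hF' (M.isCompact_elem _).isClosed) ?_
    rw [← Set.union_singleton, measure_union_null_iff]
    refine ⟨?_, measure_singleton a⟩
    exact volume_cone_eq_zero (M.norm_outer T) rfl
      ((M.isCompact_face _).inter (M.isCompact_face _))
      (fun x hx => M.outer_flat T x hx.1) (hM.inner_outer_lt T hstar ha)
      (M.face_overlap _ _ hFF')
  · rw [iUnion_cone_eq (by omega) K ha'.1 ha'.2]
    exact hφ.continuousOn.integrableOn_compact (M.isCompact_elem K)

/-- The divergence theorem on an element, for a polynomial multiple of the field `x - b`. -/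
theorem ShapeRegular.integral_elem_radial (hM : M.ShapeRegular γ η) (hd : 2 ≤ d)
    (K : Fin M.numElem) (p : MvPolynomial (Fin d) ℝ) (b : Eu d) :
    ∫ x in M.elem K, (d * pval p x + inner ℝ (vval (grad p) x) (x - b)) =
      ∑ T : M.SubElemOf K, (M.outerOffset T - inner ℝ (M.outer T) b) *
        ∫ y in M.face T.1.1.2, pval p y ∂μHE[d - 1] := by
  obtain ⟨ρ, hρ, -, hstar⟩ := hM.elem_star K
  have hball : ∀ a ∈ Metric.ball (M.center K) ρ,
      ∫ x in M.elem K, (d * pval p x + inner ℝ (vval (grad p) x) (x - a)) =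
      ∑ T : M.SubElemOf K, (M.outerOffset T - inner ℝ (M.outer T) a) *
        ∫ y in M.face T.1.1.2, pval p y ∂μHE[d - 1] := by
    intro a ha
    rw [hM.integral_elem_eq_sum hd K hstar ha (continuous_radial p a)]
    refine Finset.sum_congr rfl fun T _ => ?_
    obtain ⟨T, rfl⟩ := T
    exact integral_cone_radial (by omega) (M.norm_outer T) rfl (M.isCompact_face _)
      (M.outer_flat T) (hM.inner_outer_lt T hstar ha) p
  have hi (c : Eu d) : IntegrableOn (fun x => d * pval p x + inner ℝ (vval (grad p) x) (x - c))
      (M.elem K) := (continuous_radial p c).continuousOn.integrableOn_compact (M.isCompact_elem K)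
  let x₀ := M.center K
  -- Both sides are affine in the base point. With this `s` the point `a = (1 - s) x₀ + s b` is in
  -- the ball, so the identities at `x₀` and at `a`, both from tilings by cones, yield the one at an
  -- arbitrary `b`.
  let s : ℝ := ρ / (2 * (1 + ‖b - x₀‖))
  have h1 : 0 < 1 + ‖b - x₀‖ := by positivity
  have hs : 0 < s := by positivity
  let a : Eu d := x₀ + s • (b - x₀)
  have ha : a ∈ Metric.ball x₀ ρ := by
    rw [mem_ball_iff_norm, add_sub_cancel_left, norm_smul, Real.norm_of_nonneg hs.le,
      div_mul_eq_mul_div, div_lt_iff₀ (by positivity)]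
    nlinarith [norm_nonneg (b - x₀)]
  have e1 := hball x₀ (Metric.mem_ball_self hρ)
  have e2 := hball a ha
  have e3 : ∫ x in M.elem K, (d * pval p x + inner ℝ (vval (grad p) x) (x - a)) =
      (1 - s) * (∫ x in M.elem K, (d * pval p x + inner ℝ (vval (grad p) x) (x - x₀))) +
      s * ∫ x in M.elem K, (d * pval p x + inner ℝ (vval (grad p) x) (x - b)) := by
    rw [← integral_const_mul, ← integral_const_mul,
      ← integral_add ((hi x₀).const_mul _) ((hi b).const_mul _)]
    refine integral_congr_ae (Filter.Eventually.of_forall fun x => ?_)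
    simp only [a, inner_sub_right, inner_add_right, inner_smul_right]
    ring
  have e4 : ∑ T : M.SubElemOf K, (M.outerOffset T - inner ℝ (M.outer T) a) *
        ∫ y in M.face T.1.1.2, pval p y ∂μHE[d - 1] =
      (1 - s) * (∑ T : M.SubElemOf K, (M.outerOffset T - inner ℝ (M.outer T) x₀) *
        ∫ y in M.face T.1.1.2, pval p y ∂μHE[d - 1]) +
      s * ∑ T : M.SubElemOf K, (M.outerOffset T - inner ℝ (M.outer T) b) *
        ∫ y in M.face T.1.1.2, pval p y ∂μHE[d - 1] := by
    rw [Finset.mul_sum, Finset.mul_sum, ← Finset.sum_add_distrib]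
    refine Finset.sum_congr rfl fun T _ => ?_
    simp only [a, inner_sub_right, inner_add_right, inner_smul_right]
    ring
  rw [e3, e4, e1] at e2
  exact mul_left_cancel₀ hs.ne' (add_left_cancel e2)

theorem ShapeRegular.integral_elem_eq_sum_sub (hM : M.ShapeRegular γ η) (hd : 2 ≤ d)
    (K : Fin M.numElem) {φ : Eu d → ℝ} (hφ : Continuous φ) :
    ∫ x in M.elem K, φ x = ∑ T : M.SubElemOf K, ∫ x in M.sub T, φ x := by
  obtain ⟨ρ, hρ, -, hstar⟩ := hM.elem_star K
  rw [hM.integral_elem_eq_sum hd K hstar (Metric.mem_ball_self hρ) hφ]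
  refine Finset.sum_congr rfl fun T _ => ?_
  obtain ⟨T, rfl⟩ := T
  rfl

theorem sum_subElemOf (M : PolytopalMesh Ω) (g : M.SubElem → ℝ) :
    ∑ K, ∑ T : M.SubElemOf K, g T = ∑ T, g T := by
  rw [← Fintype.sum_sigma' (fun K (T : M.SubElemOf K) => g T.1)]
  exact Fintype.sum_equiv (Equiv.sigmaFiberEquiv fun T : M.SubElem => T.1.1) _ _ fun _ => rfl

theorem ShapeRegular.sum_integral_elem (hM : M.ShapeRegular γ η) (hd : 2 ≤ d)
    {φ : Fin M.numElem → Eu d → ℝ} (hφ : ∀ K, Continuous (φ K)) :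
    ∑ K, ∫ x in M.elem K, φ K x = ∑ T : M.SubElem, ∫ x in M.sub T, φ T.1.1 x := by
  rw [← M.sum_subElemOf]
  refine Finset.sum_congr rfl fun K _ => ?_
  rw [hM.integral_elem_eq_sum_sub hd K (hφ K)]
  refine Finset.sum_congr rfl fun T _ => ?_
  rw [T.2]

/-- Every face carries one pyramid in its first neighbour and at most one more in its second;
`right_ne_left` excludes double counting. This turns elementwise sums into facewise ones, where
jumps appear. -/
theorem sum_subElem_eq_sum_face (M : PolytopalMesh Ω) (G : Fin M.numElem → Fin M.numFace → ℝ) :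
    ∑ T : M.SubElem, G T.1.1 T.1.2 =
      ∑ F, (G (M.left F) F + (M.right F).elim 0 fun K => G K F) := by
  have h1 : ∑ T : M.SubElem, G T.1.1 T.1.2 = ∑ p : Fin M.numElem × Fin M.numFace,
      if M.left p.2 = p.1 ∨ M.right p.2 = some p.1 then G p.1 p.2 else 0 := by
    rw [← Finset.sum_filter]
    exact (Finset.sum_subtype (Finset.univ.filter fun p : Fin M.numElem × Fin M.numFace =>
      M.left p.2 = p.1 ∨ M.right p.2 = some p.1) (by simp) (fun p => G p.1 p.2)).symm
  rw [h1, Fintype.sum_prod_type_right]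
  refine Finset.sum_congr rfl fun F _ => ?_
  have h2 : ∀ K, (if M.left F = K ∨ M.right F = some K then G K F else 0) =
      (if M.left F = K then G K F else 0) + if M.right F = some K then G K F else 0 := by
    intro K
    by_cases h : M.left F = K
    · have := M.right_ne_left F
      subst h
      simp [this]
    · simp [h]
  simp only [h2, Finset.sum_add_distrib, Finset.sum_ite_eq, Finset.mem_univ, if_true]
  congr 1
  rcases M.right F with _ | K
  · simp
  · simp

end PolytopalMesh

/-! ### Balls in pyramids, tangential components, slabs of balls -/

section Geometry

variable {d : ℕ}

/-- A pyramid whose base contains a disc contains a ball of comparable size. -/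
theorem closedBall_subset_cone {n a z : Eu d} {c r s h : ℝ} {F : Set (Eu d)} (hn : ‖n‖ = 1)
    (hac : inner ℝ n a < c) (hz : inner ℝ n z = c)
    (hdisc : ∀ y ∈ Metric.closedBall z r, inner ℝ n y = c → y ∈ F) (hza : ‖z - a‖ ≤ h)
    (hs : 4 * s ≤ c - inner ℝ n a) (hsr : 4 * s * (h / (c - inner ℝ n a) + 1) ≤ r) :
    Metric.closedBall (a + (1 / 2 : ℝ) • (z - a)) s ⊆ convexJoin ℝ {a} F := by
  intro x hx
  set H := c - inner ℝ n a with hH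
  have hH0 : 0 < H := by linarith
  obtain ⟨e, rfl⟩ : ∃ e, x = a + (1 / 2 : ℝ) • (z - a) + e := ⟨x - (a + (1 / 2 : ℝ) • (z - a)), (add_sub_cancel _ _).symm⟩
  rw [mem_closedBall_iff_norm, add_sub_cancel_left] at hx
  have hs0 : 0 ≤ s := (norm_nonneg e).trans hx
  have hne : |inner ℝ n e| ≤ s := by
    refine (abs_real_inner_le_norm n e).trans ?_
    rwa [hn, one_mul]
  have hne' := abs_le.1 hne
  -- Relative height of `x` above the apex; the ray through `x` meets the base plane at `a + t⁻¹ (x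
  -- - a)`. From `4 s ≤ H` follows `1 / 4 ≤ t ≤ 1`, so the deviation from `z` there is at most `4 s
  -- (h / H + 1) ≤ r`.
  set t : ℝ := 1 / 2 + inner ℝ n e / H with ht
  have htH : t * H = H / 2 + inner ℝ n e := by
    rw [ht]
    field_simp
  have ht1 : 1 / 4 ≤ t := by
    by_contra! hcon
    nlinarith
  have ht2 : t ≤ 1 := by
    by_contra! hcon
    nlinarith
  have ht0 : 0 < t := by linarith
  refine mem_convexJoin_singleton.2 ⟨a + t⁻¹ • ((1 / 2 : ℝ) • (z - a) + e), ?_, t, ⟨ht0.le, ht2⟩, ?_⟩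
  · refine hdisc _ ?_ ?_
    · have he : a + t⁻¹ • ((1 / 2 : ℝ) • (z - a) + e) - z =
          t⁻¹ • ((1 / 2 - t) • (z - a) + e) := by
        have : z - a = t⁻¹ • t • (z - a) := by
          rw [smul_smul, inv_mul_cancel₀ ht0.ne', one_smul]
        rw [sub_smul, sub_add_eq_add_sub, smul_sub t⁻¹ (_ + e), ← this]
        abel
      have h1 : ‖(1 / 2 - t) • (z - a) + e‖ ≤ s * (h / H + 1) := by
        have h2 : |1 / 2 - t| ≤ s / H := by
          rw [ht, sub_add_cancel_left, abs_neg, abs_div, abs_of_pos hH0]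
          gcongr
        refine (norm_add_le _ _).trans ?_
        rw [norm_smul, Real.norm_eq_abs]
        have h3 : |1 / 2 - t| * ‖z - a‖ ≤ s / H * h := by gcongr
        calc _ ≤ s / H * h + s := add_le_add h3 hx
          _ = s * (h / H + 1) := by ring
      have h4 : 0 ≤ s * (h / H + 1) := (norm_nonneg _).trans h1
      rw [mem_closedBall_iff_norm, he, norm_smul, norm_inv, Real.norm_of_nonneg ht0.le]
      calc t⁻¹ * ‖(1 / 2 - t) • (z - a) + e‖ ≤ 4 * (s * (h / H + 1)) := by
            refine mul_le_mul ?_ h1 (norm_nonneg _) (by norm_num)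
            rw [inv_le_comm₀ ht0 (by norm_num)]
            linarith
        _ ≤ r := by linarith
    · rw [inner_add_right, inner_smul_right, inner_add_right, inner_smul_right, inner_sub_right, hz]
      have : t⁻¹ * (1 / 2 * H + inner ℝ n e) = H := by
        rw [inv_mul_eq_iff_eq_mul₀ ht0.ne', htH]
        ring
      linarith
  · rw [add_sub_cancel_left, smul_smul, mul_inv_cancel₀ ht0.ne', one_smul]
    abel

/-- The component of `v` tangential to the hyperplane with unit normal `n`. -/
noncomputable def tangent (n v : Eu d) : Eu d := v - inner ℝ n v • n

theorem norm_tangent_sq {n : Eu d} (hn : ‖n‖ = 1) (v : Eu d) :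
    ‖tangent n v‖ ^ 2 = ‖v‖ ^ 2 - inner ℝ n v ^ 2 := by
  rw [tangent, norm_sub_sq_real, norm_smul, inner_smul_right, hn, real_inner_comm,
    Real.norm_eq_abs, mul_one, sq_abs]
  ring

theorem inner_tangent {n : Eu d} (hn : ‖n‖ = 1) (v : Eu d) : inner ℝ (tangent n v) n = 0 := by
  rw [tangent, inner_sub_left, real_inner_smul_left, real_inner_self_eq_norm_sq, hn,
    real_inner_comm]
  ring

theorem inner_tangent_self {n : Eu d} (hn : ‖n‖ = 1) (v : Eu d) :
    inner ℝ (tangent n v) v = ‖tangent n v‖ ^ 2 := by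
  rw [norm_tangent_sq hn, tangent, inner_sub_left, real_inner_smul_left,
    real_inner_self_eq_norm_sq]
  ring

theorem norm_tangent_le {n : Eu d} (hn : ‖n‖ = 1) (v : Eu d) : ‖tangent n v‖ ^ 2 ≤ ‖v‖ ^ 2 := by
  rw [norm_tangent_sq hn]
  linarith [sq_nonneg (inner ℝ n v)]

/-- A vector is controlled by its components tangential to two transversal hyperplanes. -/
theorem norm_sq_le_tangent {n₁ n₂ w : Eu d} (h1 : ‖n₁‖ = 1) (h2 : ‖n₂‖ = 1) (hw : ‖w‖ = 1)
    (hw1 : inner ℝ n₁ w = 0) {γ : ℝ} (hγ : 0 < γ) (hw2 : 1 ≤ γ ^ 2 * inner ℝ n₂ w ^ 2) (v : Eu d) :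
    ‖v‖ ^ 2 ≤ (1 + 2 * γ ^ 2) * (‖tangent n₁ v‖ ^ 2 + ‖tangent n₂ v‖ ^ 2) := by
  set a := inner ℝ n₁ v with ha
  -- It remains to bound the normal component `a n₁` of `v`. Its part tangential to the second
  -- hyperplane is bounded by the two given tangential parts, and is not small compared with `a`:
  -- Bessel's inequality for the orthonormal pair `n₁, w` gives `1 - ⟨n₂, n₁⟩² ≥ ⟨n₂, w⟩² ≥ γ⁻²`.
  have hv : tangent n₂ (a • n₁) = tangent n₂ v - tangent n₂ (tangent n₁ v) := by
    simp only [tangent, inner_sub_right, inner_smul_right, ← ha, sub_smul]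
    abel
  have hb : inner ℝ n₂ n₁ ^ 2 + inner ℝ n₂ w ^ 2 ≤ 1 := by
    have h := norm_tangent_le hw (tangent n₁ n₂)
    have h3 := norm_tangent_sq hw (tangent n₁ n₂)
    have h4 : inner ℝ w (tangent n₁ n₂) = inner ℝ n₂ w := by
      rw [tangent, inner_sub_right, inner_smul_right, real_inner_comm n₁ w, hw1,
        real_inner_comm]
      ring
    rw [h4, norm_tangent_sq h1, h2, real_inner_comm] at h3
    nlinarith [sq_nonneg ‖tangent w (tangent n₁ n₂)‖]
  have h5 : ‖tangent n₂ (a • n₁)‖ ^ 2 = a ^ 2 * (1 - inner ℝ n₂ n₁ ^ 2) := by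
    rw [norm_tangent_sq h2, norm_smul, inner_smul_right, h1, Real.norm_eq_abs, mul_one, sq_abs]
    ring
  have h6 : ‖tangent n₂ v - tangent n₂ (tangent n₁ v)‖ ^ 2 ≤
      2 * (‖tangent n₂ v‖ ^ 2 + ‖tangent n₁ v‖ ^ 2) := by
    have h7 := norm_tangent_le h2 (tangent n₁ v)
    have h8 := norm_sub_le (tangent n₂ v) (tangent n₂ (tangent n₁ v))
    have h9 := pow_le_pow_left₀ (norm_nonneg _) h8 2
    nlinarith [sq_nonneg (‖tangent n₂ v‖ - ‖tangent n₂ (tangent n₁ v)‖)]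
  rw [← hv, h5] at h6
  have h10 := norm_tangent_sq h1 v
  have h11 : a ^ 2 ≤ γ ^ 2 * (a ^ 2 * (1 - inner ℝ n₂ n₁ ^ 2)) := by
    have : γ ^ 2 * inner ℝ n₂ w ^ 2 ≤ γ ^ 2 * (1 - inner ℝ n₂ n₁ ^ 2) := by
      gcongr
      linarith
    nlinarith [sq_nonneg a]
  have h12 : γ ^ 2 * (a ^ 2 * (1 - inner ℝ n₂ n₁ ^ 2)) ≤
      γ ^ 2 * (2 * (‖tangent n₂ v‖ ^ 2 + ‖tangent n₁ v‖ ^ 2)) := by gcongr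
  nlinarith [sq_nonneg ‖tangent n₂ v‖]

/-- The tangential part of a polynomial vector field. -/
noncomputable def polyTangent (n : Eu d) (q : Fin d → MvPolynomial (Fin d) ℝ) :
    Fin d → MvPolynomial (Fin d) ℝ := fun i => q i - n i • ∑ j, n j • q j

theorem vval_polyTangent (n : Eu d) (q : Fin d → MvPolynomial (Fin d) ℝ) (x : Eu d) :
    vval (polyTangent n q) x = tangent n (vval q x) := by
  ext i
  have h : inner ℝ n (vval q x) = ∑ j, n j * pval (q j) x := by
    rw [real_inner_comm, inner_vval]
    exact Finset.sum_congr rfl fun j _ => mul_comm _ _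
  simp only [vval_apply, polyTangent, pval_sub, pval_smul, pval_sum, tangent, PiLp.sub_apply,
    PiLp.smul_apply, smul_eq_mul, h]
  rw [mul_comm]

theorem polyTangent_mem {m : ℕ} (n : Eu d) {q : Fin d → MvPolynomial (Fin d) ℝ}
    (hq : ∀ i, q i ∈ Poly d m) (i : Fin d) : polyTangent n q i ∈ Poly d m :=
  Submodule.sub_mem _ (hq i) (Submodule.smul_mem _ _
    (Submodule.sum_mem _ fun j _ => Submodule.smul_mem _ _ (hq j)))

/-- The integral over a ball of a function which is constant in the direction `n` is controlled by
its integral over the cross-section through the centre. -/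
theorem integral_closedBall_le_of_const {n z : Eu d} {c r : ℝ} (hn : ‖n‖ = 1)
    (hz : inner ℝ n z = c) (hr : 0 ≤ r) {g : Eu d → ℝ} (hg : Continuous g) (hg0 : ∀ x, 0 ≤ g x)
    (hgn : ∀ x, ∀ s : ℝ, g (x + s • n) = g x) :
    ∫ x in Metric.closedBall z r, g x ≤
      2 * r * ∫ x in Metric.closedBall z r ∩ {y | inner ℝ n y = c}, g x ∂μHE[d - 1] := by
  set D : Set (Eu d) := Metric.closedBall z r ∩ {y | inner ℝ n y = c} with hD
  have hDc : IsCompact D := (isCompact_closedBall z r).inter_right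
    (isClosed_eq (by fun_prop) continuous_const)
  have hfin : μHE[d - 1] D < ⊤ := flat_measure_lt_top hDc hn fun x hx => hx.2
  have : IsFiniteMeasure (μHE[d - 1].restrict D) := ⟨by simpa using hfin⟩
  -- The ball is contained in the cylinder of height `2 r` over its central cross-section `D`, which
  -- `m` parametrizes; along the cylinder `g` depends only on the point of `D`.
  let m : ℝ × Eu d → Eu d := fun q => q.2 + (q.1 - c) • n
  have hmc : Continuous m := by fun_prop
  let μ : Measure (ℝ × Eu d) :=
    (volume.restrict (Set.Icc (c - r) (c + r))).prod (μHE[d - 1].restrict D)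
  have hle : volume.restrict (Metric.closedBall z r) ≤ μ.map m := by
    refine Measure.le_iff.2 fun S hS => ?_
    rw [Measure.restrict_apply hS,
      volume_eq_lintegral_slices hn (hS.inter Metric.isClosed_closedBall.measurableSet),
      Measure.map_apply hmc.measurable hS, Measure.prod_apply (hmc.measurable hS),
      ← lintegral_indicator measurableSet_Icc]
    refine lintegral_mono fun s => ?_
    by_cases hs : s ∈ Set.Icc (c - r) (c + r)
    · rw [Set.indicator_of_mem hs, Measure.restrict_apply (by
        exact (hmc.comp (Continuous.prodMk_right s)).measurable hS)]
      have hiso : Isometry fun y : Eu d => y + (s - c) • n := isometry_add_right _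
      rw [← hiso.euclideanHausdorffMeasure_image (Prod.mk s ⁻¹' (m ⁻¹' S) ∩ D)]
      refine measure_mono ?_
      intro x hx
      obtain ⟨⟨hxS, hxb⟩, hxs⟩ := hx
      refine ⟨x - (s - c) • n, ⟨?_, ?_, ?_⟩, sub_add_cancel _ _⟩
      · simpa [m] using hxS
      · rw [mem_closedBall_iff_norm] at hxb ⊢
        have h1 : inner ℝ n (x - z) = s - c := by
          rw [inner_sub_right, hz]
          congr 1
        have h2 : x - (s - c) • n - z = tangent n (x - z) := by
          rw [tangent, h1]
          abel
        rw [h2]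
        exact (pow_le_pow_iff_left₀ (norm_nonneg _) (norm_nonneg _) two_ne_zero).1
          (norm_tangent_le hn _) |>.trans hxb
      · change inner ℝ n (x - (s - c) • n) = c
        rw [inner_sub_right, inner_smul_right, real_inner_self_eq_norm_sq, hn]
        have : inner ℝ n x = s := hxs
        linarith
    · rw [Set.indicator_of_notMem hs]
      have : S ∩ Metric.closedBall z r ∩ {y | inner ℝ n y = s} = ∅ := by
        ext x
        simp only [Set.mem_inter_iff, Set.mem_ofPred_eq, Set.mem_empty_iff_false, iff_false]
        rintro ⟨⟨-, hxb⟩, hxs⟩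
        rw [mem_closedBall_iff_norm] at hxb
        have h1 := abs_real_inner_le_norm n (x - z)
        rw [hn, one_mul] at h1
        replace h1 := h1.trans hxb
        rw [inner_sub_right, hz, hxs, abs_le] at h1
        exact hs ⟨by linarith, by linarith⟩
      rw [this, measure_empty]
  have hgm (q : ℝ × Eu d) : g (m q) = g q.2 := hgn _ _
  have hint : Integrable g (μ.map m) := by
    rw [integrable_map_measure hg.aestronglyMeasurable hmc.measurable.aemeasurable]
    have h1 : g ∘ m = fun q => g q.2 := funext hgm
    rw [h1]
    have h2 : IntegrableOn g D μHE[d - 1] := by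
      obtain ⟨B, hB⟩ := hDc.exists_bound_of_continuousOn hg.continuousOn
      refine Measure.integrableOn_of_bounded (M := B) hfin.ne hg.aestronglyMeasurable ?_
      filter_upwards [ae_restrict_mem hDc.measurableSet] with x hx using hB x hx
    exact h2.comp_snd _
  refine (integral_mono_measure hle (Filter.Eventually.of_forall hg0) hint).trans_eq ?_
  rw [integral_map hmc.measurable.aemeasurable hg.aestronglyMeasurable]
  simp only [hgm]
  rw [integral_fun_snd (fun y => g y)]
  have h3 : (volume.restrict (Set.Icc (c - r) (c + r))).real Set.univ = 2 * r := by
    rw [measureReal_restrict_apply_univ, Real.volume_real_Icc_of_le (by linarith)]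
    ring
  rw [h3, smul_eq_mul]

end Geometry

/-! ### Uniform polynomial inequalities on shape-regular meshes -/

namespace PolytopalMesh

variable {d : ℕ} {Ω : Set (Eu d)} {M : PolytopalMesh Ω} {γ η : ℝ}

/-- Allows both parameters to be raised to at least `1`, as most of the following bounds assume. -/
theorem ShapeRegular.mono (hM : M.ShapeRegular γ η) {γ' η' : ℝ} (hγ : γ ≤ γ') (hη : η ≤ η') :
    M.ShapeRegular γ' η' where
  elem_star K := by
    obtain ⟨ρ, hρ, h, hs⟩ := hM.elem_star K
    exact ⟨ρ, hρ, h.trans (mul_le_mul_of_nonneg_right hγ hρ.le), hs⟩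
  face_star F := by
    obtain ⟨z, hz, ρ, hρ, h, hs⟩ := hM.face_star F
    exact ⟨z, hz, ρ, hρ, h.trans (mul_le_mul_of_nonneg_right hγ hρ.le), hs⟩
  diam_le K F hF := (hM.diam_le K F hF).trans (mul_le_mul_of_nonneg_right hη Metric.diam_nonneg)

theorem norm_sub_le_diam (M : PolytopalMesh Ω) (K : Fin M.numElem) {x y : Eu d}
    (hx : x ∈ M.elem K) (hy : y ∈ M.elem K) : ‖x - y‖ ≤ Metric.diam (M.elem K) := by
  rw [← dist_eq_norm]
  exact Metric.dist_le_diam_of_mem (M.isCompact_elem K).isBounded hx hy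

theorem ShapeRegular.center_mem (hM : M.ShapeRegular γ η) (K : Fin M.numElem) :
    M.center K ∈ M.elem K := by
  obtain ⟨ρ, hρ, -, hs⟩ := hM.elem_star K
  exact (hs _ (Metric.mem_closedBall_self hρ.le)).1

theorem ShapeRegular.starConvex (hM : M.ShapeRegular γ η) (K : Fin M.numElem) :
    StarConvex ℝ (M.center K) (M.elem K) := by
  obtain ⟨ρ, hρ, -, hs⟩ := hM.elem_star K
  exact (hs _ (Metric.mem_closedBall_self hρ.le)).2

theorem ShapeRegular.sub_subset (hM : M.ShapeRegular γ η) (T : M.SubElem) :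
    M.sub T ⊆ M.elem T.1.1 :=
  cone_subset_of_star (hM.starConvex _) (M.face_subset_elem T)

theorem isCompact_sub (M : PolytopalMesh Ω) (T : M.SubElem) : IsCompact (M.sub T) :=
  isCompact_cone (M.isCompact_face _)

theorem ShapeRegular.diam_elem_pos (hM : M.ShapeRegular γ η) (T : M.SubElem) :
    0 < Metric.diam (M.elem T.1.1) := by
  obtain ⟨ρ, hρ, -, hs⟩ := hM.elem_star T.1.1
  have h := M.norm_sub_le_diam T.1.1 (x := M.center T.1.1 + ρ • M.outer T) (hs _ (by
    rw [mem_closedBall_iff_norm, add_sub_cancel_left, norm_smul, M.norm_outer,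
      Real.norm_of_nonneg hρ.le, mul_one])).1 (hM.center_mem T.1.1)
  rw [add_sub_cancel_left, norm_smul, M.norm_outer, Real.norm_of_nonneg hρ.le, mul_one] at h
  linarith

theorem diam_face_le (M : PolytopalMesh Ω) (T : M.SubElem) :
    Metric.diam (M.face T.1.2) ≤ Metric.diam (M.elem T.1.1) :=
  Metric.diam_mono (M.face_subset_elem T) (M.isCompact_elem _).isBounded

theorem ShapeRegular.diam_face_pos (hM : M.ShapeRegular γ η) (hη : 1 ≤ η) (F : Fin M.numFace) :
    0 < Metric.diam (M.face F) := by
  have h1 := hM.diam_elem_pos (M.leftSub F)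
  have h2 := hM.diam_le _ F (M.leftSub F).2
  by_contra! hcon
  have h3 : (0 : ℝ) < Metric.diam (M.elem (M.left F)) := h1
  have h4 : Metric.diam (M.elem (M.left F)) ≤ η * Metric.diam (M.face F) := h2
  nlinarith

theorem ShapeRegular.exists_disc (hM : M.ShapeRegular γ η) (hγ : 1 ≤ γ) (F : Fin M.numFace) :
    ∃ z ∈ M.face F, StarConvex ℝ z (M.face F) ∧
      ∀ y ∈ Metric.closedBall z (Metric.diam (M.face F) / γ),
        inner ℝ (M.normal F) y = M.offset F → y ∈ M.face F := by
  obtain ⟨z, hz, r, hr, hd, hdisc⟩ := hM.face_star F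
  refine ⟨z, hz, (hdisc z (Metric.mem_closedBall_self hr.le) (M.face_flat F z hz)).2,
    fun y hy hyc => (hdisc y (Metric.closedBall_subset_closedBall ?_ hy) hyc).1⟩
  rw [div_le_iff₀ (by linarith)]
  linarith

/-- Nondegeneracy of the pyramids: the ball about the centre stays on one side of the hyperplane of
each face, so the height is at least its radius. -/
theorem ShapeRegular.diam_div_le (hM : M.ShapeRegular γ η) (hγ : 1 ≤ γ) (T : M.SubElem) :
    Metric.diam (M.elem T.1.1) / γ ≤ M.outerOffset T - inner ℝ (M.outer T) (M.center T.1.1) := by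
  obtain ⟨ρ, hρ, hd, hs⟩ := hM.elem_star T.1.1
  have h := hM.inner_outer_add_le T hρ hs
  have : Metric.diam (M.elem T.1.1) / γ ≤ ρ := by
    rw [div_le_iff₀ (by linarith)]
    linarith
  linarith

/-- The height is at least `h_K / γ` and the base contains a disc of radius `h_F / γ ≥ h_K / (η γ)`.
The factor is chosen so that both conditions of `closedBall_subset_cone` hold, with `h / H ≤ γ`. -/
theorem ShapeRegular.exists_closedBall_subset_sub (hM : M.ShapeRegular γ η) (hγ : 1 ≤ γ)
    (hη : 1 ≤ η) (T : M.SubElem) : ∃ y,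
      Metric.closedBall y ((4 * γ * (γ + 1) * η)⁻¹ * Metric.diam (M.elem T.1.1)) ⊆ M.sub T := by
  obtain ⟨z, hz, -, hdisc⟩ := hM.exists_disc hγ T.1.2
  set h := Metric.diam (M.elem T.1.1) with hh
  have hh0 : 0 < h := hM.diam_elem_pos T
  have hH := hM.diam_div_le hγ T
  have hη' : h ≤ η * Metric.diam (M.face T.1.2) := hM.diam_le _ _ T.2
  set H := M.outerOffset T - inner ℝ (M.outer T) (M.center T.1.1) with hHdef
  have hγ0 : 0 < γ := by linarith
  have hη0 : 0 < η := by linarith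
  have hH0 : 0 < H := lt_of_lt_of_le (by positivity) hH
  have hhH : h / H ≤ γ := by
    rw [div_le_iff₀ hH0]
    rw [div_le_iff₀ hγ0] at hH
    linarith
  refine ⟨_, closedBall_subset_cone (h := h) (M.norm_outer T) (by linarith)
    (M.outer_flat T z hz) (r := Metric.diam (M.face T.1.2) / γ)
    (fun y hy hyc => hdisc y hy ((M.inner_outer_eq_iff T y).1 hyc))
    (M.norm_sub_le_diam _ (M.face_subset_elem T hz) (hM.center_mem _)) ?_ ?_⟩
  · refine le_trans ?_ hH
    rw [le_div_iff₀ hγ0]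
    have h1 : 4 * ((4 * γ * (γ + 1) * η)⁻¹ * h) * γ = ((γ + 1) * η)⁻¹ * h := by
      field_simp
    rw [h1]
    exact mul_le_of_le_one_left hh0.le (inv_le_one_of_one_le₀ (by nlinarith))
  · rw [← hHdef, le_div_iff₀ hγ0]
    have h1 : 4 * ((4 * γ * (γ + 1) * η)⁻¹ * h) * (h / H + 1) * γ =
        h * (h / H + 1) / ((γ + 1) * η) := by
      field_simp
    rw [h1, div_le_iff₀ (by positivity)]
    have h2 : h * (h / H + 1) ≤ h * (γ + 1) := by gcongr
    nlinarith

theorem setIntegral_mono_subset {μ : Measure (Eu d)} {A B : Set (Eu d)} {g : Eu d → ℝ}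
    (hg : ∀ x, 0 ≤ g x) (hi : IntegrableOn g B μ) (hAB : A ⊆ B) :
    ∫ x in A, g x ∂μ ≤ ∫ x in B, g x ∂μ :=
  setIntegral_mono_set hi (Filter.Eventually.of_forall hg) (Filter.Eventually.of_forall hAB)

/-- A polynomial on an element is controlled by its `L²`-norm on any sub-element. -/
theorem exists_sup_const (d m : ℕ) {γ η : ℝ} (hγ : 1 ≤ γ) (hη : 1 ≤ η) :
    ∃ C : ℝ, 0 < C ∧ ∀ {Ω : Set (Eu d)} {M : PolytopalMesh Ω}, M.ShapeRegular γ η →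
      ∀ T : M.SubElem, ∀ p ∈ Poly d m, ∀ x ∈ M.elem T.1.1,
        pval p x ^ 2 ≤ C * (Metric.diam (M.elem T.1.1) ^ d)⁻¹ * ∫ z in M.sub T, pval p z ^ 2 := by
  set δ := (4 * γ * (γ + 1) * η)⁻¹ with hδ
  have hδ0 : 0 < δ := by positivity
  -- The ball of radius `δ h_K` inside the pyramid, enlarged by `δ⁻¹` about its centre, covers the
  -- whole element.
  obtain ⟨C, hC, hball⟩ := exists_ball_const d m δ⁻¹
  refine ⟨C * (δ ^ d)⁻¹, by positivity, fun {Ω M} hM T p hp x hx => ?_⟩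
  obtain ⟨y, hy⟩ := hM.exists_closedBall_subset_sub hγ hη T
  rw [← hδ] at hy
  have hh := hM.diam_elem_pos T
  have hr : 0 < δ * Metric.diam (M.elem T.1.1) := by positivity
  have hyK : y ∈ M.elem T.1.1 := hM.sub_subset T (hy (Metric.mem_closedBall_self hr.le))
  have h1 := hball p hp y _ hr x (by
    rw [inv_mul_cancel_left₀ hδ0.ne']
    exact M.norm_sub_le_diam _ hx hyK)
  refine h1.trans ?_
  rw [mul_pow, mul_inv, ← mul_assoc C]
  refine mul_le_mul_of_nonneg_left ?_ (by positivity)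
  exact setIntegral_mono_subset (μ := volume) (fun x => sq_nonneg _)
    ((continuous_pval_sq p).continuousOn.integrableOn_compact (M.isCompact_sub T)) hy

theorem continuous_norm_vval_sq (q : Fin d → MvPolynomial (Fin d) ℝ) :
    Continuous fun x => ‖vval q x‖ ^ 2 := (continuous_vval q).norm.pow 2

theorem integral_norm_vval_sq {A : Set (Eu d)} (hA : IsCompact A)
    (q : Fin d → MvPolynomial (Fin d) ℝ) :
    ∫ x in A, ‖vval q x‖ ^ 2 = ∑ i, ∫ x in A, pval (q i) x ^ 2 := by
  simp only [norm_vval_sq]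
  exact integral_finsetSum _ fun i _ =>
    (continuous_pval_sq _).continuousOn.integrableOn_compact hA

theorem exists_sup_const_vval (d m : ℕ) {γ η : ℝ} (hγ : 1 ≤ γ) (hη : 1 ≤ η) :
    ∃ C : ℝ, 0 < C ∧ ∀ {Ω : Set (Eu d)} {M : PolytopalMesh Ω}, M.ShapeRegular γ η →
      ∀ T : M.SubElem, ∀ q : Fin d → MvPolynomial (Fin d) ℝ, (∀ i, q i ∈ Poly d m) →
        ∀ x ∈ M.elem T.1.1, ‖vval q x‖ ^ 2 ≤
          C * (Metric.diam (M.elem T.1.1) ^ d)⁻¹ * ∫ z in M.sub T, ‖vval q z‖ ^ 2 := by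
  obtain ⟨C, hC, h⟩ := exists_sup_const d m hγ hη
  refine ⟨C, hC, fun {Ω M} hM T q hq x hx => ?_⟩
  rw [integral_norm_vval_sq (M.isCompact_sub T), norm_vval_sq, Finset.mul_sum]
  exact Finset.sum_le_sum fun i _ => h hM T _ (hq i) x hx

/-- The volume of the unit ball. -/
noncomputable def unitVol (d : ℕ) : ℝ := volume.real (Metric.ball (0 : Eu d) 1)

theorem unitVol_nonneg (d : ℕ) : 0 ≤ unitVol d := measureReal_nonneg

theorem ShapeRegular.volume_elem_le (hM : M.ShapeRegular γ η) (K : Fin M.numElem) :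
    volume.real (M.elem K) ≤ Metric.diam (M.elem K) ^ d * unitVol d := by
  have h := Measure.addHaar_real_closedBall (volume : Measure (Eu d)) (M.center K)
    (Metric.diam_nonneg (s := M.elem K))
  rw [finrank_euclideanSpace_fin] at h
  rw [unitVol, ← h]
  refine measureReal_mono (fun x hx => ?_) (isCompact_closedBall _ _).measure_lt_top.ne
  rw [mem_closedBall_iff_norm]
  exact M.norm_sub_le_diam K hx (hM.center_mem K)

theorem ShapeRegular.integral_le_of_le (hM : M.ShapeRegular γ η) {K : Fin M.numElem}
    {A : Set (Eu d)} (hA : IsCompact A) (hAK : A ⊆ M.elem K) {g : Eu d → ℝ} (hg : Continuous g)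
    {B : ℝ} (hB0 : 0 ≤ B) (hB : ∀ x ∈ M.elem K, g x ≤ B) :
    ∫ x in A, g x ≤ Metric.diam (M.elem K) ^ d * unitVol d * B := by
  have h1 : ∫ x in A, g x ≤ ∫ x in A, B :=
    setIntegral_mono_on (hg.continuousOn.integrableOn_compact hA)
      (continuousOn_const.integrableOn_compact hA) hA.measurableSet fun x hx => hB x (hAK hx)
  refine h1.trans ?_
  rw [setIntegral_const, smul_eq_mul]
  refine mul_le_mul_of_nonneg_right ((measureReal_mono hAK ?_).trans (hM.volume_elem_le K)) hB0
  exact (M.isCompact_elem K).measure_lt_top.ne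

theorem surf_integrable (M : PolytopalMesh Ω) (F : Fin M.numFace) {g : Eu d → ℝ}
    (hg : Continuous g) : Integrable g (M.surf F) := by
  have hc := M.isCompact_face F
  obtain ⟨c, hcb⟩ := hc.exists_bound_of_continuousOn hg.continuousOn
  refine Measure.integrableOn_of_bounded (M := c)
    (flat_measure_lt_top hc (M.normal_norm F) (M.face_flat F)).ne hg.aestronglyMeasurable ?_
  filter_upwards [ae_restrict_mem hc.measurableSet] with x hx using hcb x hx

/-- The divergence theorem with `p = 1` says that height times base area is `d` times the volume of
the pyramid; the height is at least `h_K / γ`. -/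
theorem ShapeRegular.area_le (hM : M.ShapeRegular γ η) (hd : 1 ≤ d) (hγ : 1 ≤ γ) (T : M.SubElem) :
    (∫ _, (1 : ℝ) ∂M.surf T.1.2) * Metric.diam (M.elem T.1.1) ≤
      γ * d * unitVol d * Metric.diam (M.elem T.1.1) ^ d := by
  have hH := hM.diam_div_le hγ T
  have hlt := M.inner_outer_center_lt T
  have h := integral_cone_radial hd (M.norm_outer T) rfl (M.isCompact_face _) (M.outer_flat T)
    hlt (MvPolynomial.C 1)
  have hg : vval (grad (MvPolynomial.C 1 : MvPolynomial (Fin d) ℝ)) = 0 := by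
    funext x
    ext i
    simp [vval_apply, grad, pval_zero]
  simp only [pval_C, hg, Pi.zero_apply, inner_zero_left, add_zero, mul_one] at h
  have h2 : ∫ x in M.sub T, (d : ℝ) ≤ Metric.diam (M.elem T.1.1) ^ d * unitVol d * d :=
    hM.integral_le_of_le (M.isCompact_sub T) (hM.sub_subset T) continuous_const
      (Nat.cast_nonneg d) fun x _ => le_rfl
  have h3 : (∫ x in convexJoin ℝ {M.center T.1.1} (M.face T.1.2), (d : ℝ)) =
    ∫ x in M.sub T, (d : ℝ) := rfl
  have h4 : ∫ y in M.face T.1.2, (1 : ℝ) ∂μHE[d - 1] = ∫ _, (1 : ℝ) ∂M.surf T.1.2 := rfl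
  rw [h3, h4] at h
  have h5 : 0 ≤ ∫ _, (1 : ℝ) ∂M.surf T.1.2 := integral_nonneg fun _ => zero_le_one
  rw [div_le_iff₀ (by linarith)] at hH
  nlinarith [mul_le_mul_of_nonneg_left hH h5]

theorem ShapeRegular.surf_integral_mul_le (hM : M.ShapeRegular γ η) (hd : 1 ≤ d) (hγ : 1 ≤ γ)
    (T : M.SubElem) {g : Eu d → ℝ} (hg : Continuous g) {B : ℝ} (hB0 : 0 ≤ B)
    (hB : ∀ x ∈ M.face T.1.2, g x ≤ B) :
    (∫ x, g x ∂M.surf T.1.2) * Metric.diam (M.elem T.1.1) ≤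
      γ * d * unitVol d * Metric.diam (M.elem T.1.1) ^ d * B := by
  have h1 : ∫ x, g x ∂M.surf T.1.2 ≤ ∫ x, B * 1 ∂M.surf T.1.2 := by
    refine integral_mono_ae (M.surf_integrable _ hg) (M.surf_integrable _ continuous_const) ?_
    filter_upwards [ae_restrict_mem (M.isCompact_face _).measurableSet] with x hx
    simpa using hB x hx
  rw [integral_const_mul] at h1
  have h2 := mul_le_mul_of_nonneg_right h1 (hM.diam_elem_pos T).le
  have h3 := mul_le_mul_of_nonneg_left (hM.area_le hd hγ T) hB0
  linarith

/-- Inverse trace inequality. -/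
theorem exists_inverse_trace_const (hd : 1 ≤ d) (m : ℕ) (hγ : 1 ≤ γ) (hη : 1 ≤ η) :
    ∃ C : ℝ, 0 < C ∧ ∀ {Ω : Set (Eu d)} {M : PolytopalMesh Ω}, M.ShapeRegular γ η →
      ∀ T : M.SubElem, ∀ p ∈ Poly d m,
        Metric.diam (M.elem T.1.1) * ∫ x, pval p x ^ 2 ∂M.surf T.1.2 ≤
          C * ∫ x in M.sub T, pval p x ^ 2 := by
  obtain ⟨C, hC, hsup⟩ := exists_sup_const d m hγ hη
  have hγ0 : 0 < γ := by linarith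
  refine ⟨γ * d * unitVol d * C + 1, by have := unitVol_nonneg d; positivity,
    fun {Ω M} hM T p hp => ?_⟩
  have hI : 0 ≤ ∫ x in M.sub T, pval p x ^ 2 := integral_nonneg fun _ => sq_nonneg _
  have hh := hM.diam_elem_pos T
  have h := hM.surf_integral_mul_le hd hγ T (continuous_pval_sq p) (by positivity)
    fun x hx => hsup hM T p hp x (M.face_subset_elem T hx)
  rw [mul_comm]
  refine h.trans ?_
  have : γ * d * unitVol d * Metric.diam (M.elem T.1.1) ^ d *
      (C * (Metric.diam (M.elem T.1.1) ^ d)⁻¹ * ∫ x in M.sub T, pval p x ^ 2) =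
      γ * d * unitVol d * C * ∫ x in M.sub T, pval p x ^ 2 := by
    field_simp
  rw [this, add_mul, one_mul]
  linarith

/-- On a face, a polynomial is close to a constant if its gradient is small. -/
theorem exists_trace_poincare_const (hd : 1 ≤ d) (k : ℕ) (hγ : 1 ≤ γ) (hη : 1 ≤ η) :
    ∃ C : ℝ, 0 < C ∧ ∀ {Ω : Set (Eu d)} {M : PolytopalMesh Ω}, M.ShapeRegular γ η →
      ∀ T : M.SubElem, ∀ p ∈ Poly d (k + 1), ∃ c : ℝ,
        ∫ x, (pval p x - c) ^ 2 ∂M.surf T.1.2 ≤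
          C * Metric.diam (M.elem T.1.1) * ∫ x in M.sub T, ‖vval (grad p) x‖ ^ 2 := by
  obtain ⟨C, hC, hsup⟩ := exists_sup_const_vval d k hγ hη
  have hγ0 : 0 < γ := by linarith
  refine ⟨γ * d * unitVol d * C + 1, by have := unitVol_nonneg d; positivity,
    fun {Ω M} hM T p hp => ?_⟩
  obtain ⟨z, hz, hstar, -⟩ := hM.exists_disc hγ T.1.2
  -- The constant is the value at a star centre of the face: segments from `z` stay in the face,
  -- hence in the element, where the gradient is bounded by its norm on the pyramid.
  refine ⟨pval p z, ?_⟩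
  set h := Metric.diam (M.elem T.1.1) with hh
  have hh0 : 0 < h := hM.diam_elem_pos T
  set I := ∫ x in M.sub T, ‖vval (grad p) x‖ ^ 2 with hI
  have hI0 : 0 ≤ I := integral_nonneg fun _ => sq_nonneg _
  have hbound : ∀ x ∈ M.face T.1.2, (pval p x - pval p z) ^ 2 ≤ C * (h ^ d)⁻¹ * I * h ^ 2 := by
    intro x hx
    have h1 := abs_pval_sub_le (p := p) (x := x) (z := z) (G := √(C * (h ^ d)⁻¹ * I))
      fun y hy => Real.le_sqrt_of_sq_le (hsup hM T _ (grad_mem_Poly hp) y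
        (M.face_subset_elem T (hstar.segment_subset hx hy)))
    have h2 : ‖x - z‖ ≤ h :=
      M.norm_sub_le_diam _ (M.face_subset_elem T hx) (M.face_subset_elem T hz)
    have h3 : |pval p x - pval p z| ≤ √(C * (h ^ d)⁻¹ * I) * h := h1.trans (by gcongr)
    rw [← sq_abs]
    refine (pow_le_pow_left₀ (abs_nonneg _) h3 2).trans_eq ?_
    rw [mul_pow, Real.sq_sqrt (by positivity)]
  have h1 := hM.surf_integral_mul_le hd hγ T
    (((continuous_pval p).sub continuous_const).pow 2) (by positivity) hbound
  rw [← hh] at h1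
  have h2 : γ * d * unitVol d * h ^ d * (C * (h ^ d)⁻¹ * I * h ^ 2) =
      γ * d * unitVol d * C * h * I * h := by
    field_simp
  rw [h2] at h1
  refine (le_of_mul_le_mul_right h1 hh0).trans ?_
  have : 0 ≤ h * I := by positivity
  nlinarith

/-- In each direction there is a face whose normal is not almost orthogonal to it. -/
theorem ShapeRegular.exists_face_in_direction (hM : M.ShapeRegular γ η) (hγ : 1 ≤ γ)
    (K : Fin M.numElem) {w : Eu d} (hw : ‖w‖ = 1) : ∃ T : M.SubElem, T.1.1 = K ∧
      1 ≤ γ ^ 2 * inner ℝ (M.normal T.1.2) w ^ 2 := by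
  have hcK := hM.center_mem K
  have hcomp := M.isCompact_elem K
  have hw0 : w ≠ 0 := by
    rintro rfl
    simp at hw
  -- Follow `w` from the centre until it leaves the element through a face. The height of that face
  -- is `t ⟨n, w⟩ ≥ h_K / γ`, whereas `t ≤ h_K`.
  obtain ⟨t, ht0, ht, -⟩ := exists_mem_frontier_ray hcomp hcK hw0
  have htK := hcomp.isClosed.frontier_subset ht
  rw [M.frontier_elem] at ht
  obtain ⟨F, hF, hyF⟩ := Set.mem_iUnion₂.1 ht
  refine ⟨⟨(K, F), hF⟩, rfl, ?_⟩
  let T : M.SubElem := ⟨(K, F), hF⟩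
  have h1 := hM.diam_div_le hγ T
  have h2 : inner ℝ (M.outer T) (M.center K + t • w) = M.outerOffset T := M.outer_flat T _ hyF
  rw [inner_add_right, inner_smul_right] at h2
  have h3 : t ≤ Metric.diam (M.elem K) := by
    have := M.norm_sub_le_diam K htK hcK
    rwa [add_sub_cancel_left, norm_smul, hw, mul_one, Real.norm_of_nonneg ht0] at this
  have h4 : Metric.diam (M.elem K) / γ ≤ t * inner ℝ (M.outer T) w := by
    have : T.1.1 = K := rfl
    rw [this] at h1
    linarith
  have h5 : 0 < Metric.diam (M.elem K) := hM.diam_elem_pos T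
  have hγ0 : 0 < γ := by linarith
  rw [div_le_iff₀ hγ0] at h4
  have h6 : 1 ≤ γ * inner ℝ (M.outer T) w := by
    by_contra! hcon
    by_cases hn : 0 ≤ γ * inner ℝ (M.outer T) w
    · nlinarith
    · nlinarith
  have h7 : inner ℝ (M.normal F) w ^ 2 = inner ℝ (M.outer T) w ^ 2 := by
    rw [M.inner_outer]
    rcases M.sgn_eq T.1.1 T.1.2 with h | h <;> rw [h] <;> simp [T]
  change 1 ≤ γ ^ 2 * inner ℝ (M.normal F) w ^ 2
  rw [h7]
  nlinarith

/-- Every element has two faces in transversal hyperplanes. -/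
theorem ShapeRegular.exists_transversal (hM : M.ShapeRegular γ η) (hd : 2 ≤ d) (hγ : 1 ≤ γ)
    (K : Fin M.numElem) : ∃ T₁ T₂ : M.SubElem, T₁.1.1 = K ∧ T₂.1.1 = K ∧ ∀ v : Eu d,
      ‖v‖ ^ 2 ≤ (1 + 2 * γ ^ 2) *
        (‖tangent (M.normal T₁.1.2) v‖ ^ 2 + ‖tangent (M.normal T₂.1.2) v‖ ^ 2) := by
  have : Nontrivial (Eu d) := by
    have : Nonempty (Fin d) := ⟨⟨0, by omega⟩⟩
    infer_instance
  obtain ⟨w₀, hw₀⟩ := exists_norm_eq (Eu d) zero_le_one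
  obtain ⟨T₁, hT₁, -⟩ := hM.exists_face_in_direction hγ K hw₀
  -- The second face is sought in a direction parallel to the first one; such a direction exists
  -- because `d ≥ 2`.
  obtain ⟨w, hw, hw1⟩ : ∃ w : Eu d, ‖w‖ = 1 ∧ inner ℝ (M.normal T₁.1.2) w = 0 := by
    have hn0 : M.normal T₁.1.2 ≠ 0 := by
      intro h
      have := M.normal_norm T₁.1.2
      rw [h] at this
      simp at this
    have hr := Submodule.finrank_add_finrank_orthogonal (ℝ ∙ M.normal T₁.1.2 : Submodule ℝ (Eu d))
    rw [finrank_span_singleton hn0, finrank_euclideanSpace_fin] at hr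
    have : Nontrivial (ℝ ∙ M.normal T₁.1.2 : Submodule ℝ (Eu d))ᗮ :=
      Module.nontrivial_of_finrank_pos (R := ℝ) (by omega)
    obtain ⟨w, hw⟩ := exists_norm_eq ((ℝ ∙ M.normal T₁.1.2 : Submodule ℝ (Eu d))ᗮ) zero_le_one
    exact ⟨w, hw, Submodule.mem_orthogonal_singleton_iff_inner_right.1 w.2⟩
  obtain ⟨T₂, hT₂, hw2⟩ := hM.exists_face_in_direction hγ K hw
  exact ⟨T₁, T₂, hT₁, hT₂, norm_sq_le_tangent (M.normal_norm _) (M.normal_norm _) hw hw1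
    (by linarith) hw2⟩

/-- The gradient on an element is controlled by its components tangential to the faces, each of
them only on the sub-element at that face. -/
theorem exists_tangent_const (hd : 2 ≤ d) (k : ℕ) (hγ : 1 ≤ γ) (hη : 1 ≤ η) :
    ∃ C : ℝ, 0 < C ∧ ∀ {Ω : Set (Eu d)} {M : PolytopalMesh Ω}, M.ShapeRegular γ η →
      ∀ K : Fin M.numElem, ∀ q : Fin d → MvPolynomial (Fin d) ℝ, (∀ i, q i ∈ Poly d k) →
        ∫ x in M.elem K, ‖vval q x‖ ^ 2 ≤
          C * ∑ T : M.SubElemOf K, ∫ x in M.sub T, ‖tangent (M.normal T.1.1.2) (vval q x)‖ ^ 2 := by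
  obtain ⟨C, hC, hsup⟩ := exists_sup_const_vval d k hγ hη
  have hω := unitVol_nonneg d
  refine ⟨unitVol d * (1 + 2 * γ ^ 2) * C * 2 + 1, by positivity, fun {Ω M} hM K q hq => ?_⟩
  have hcomp := M.isCompact_elem K
  obtain ⟨T₁, T₂, hT₁, hT₂, htr⟩ := hM.exists_transversal hd hγ K
  set h := Metric.diam (M.elem K) with hh
  have hh0 : 0 < h := by
    have := hM.diam_elem_pos T₁
    rwa [hT₁] at this
  set S := ∑ T : M.SubElemOf K, ∫ x in M.sub T, ‖tangent (M.normal T.1.1.2) (vval q x)‖ ^ 2 with hS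
  have hS0 : 0 ≤ S := Finset.sum_nonneg fun T _ => integral_nonneg fun _ => sq_nonneg _
  have hsingle (T : M.SubElemOf K) :
      ∫ x in M.sub T, ‖tangent (M.normal T.1.1.2) (vval q x)‖ ^ 2 ≤ S :=
    Finset.single_le_sum (f := fun T : M.SubElemOf K =>
      ∫ x in M.sub T, ‖tangent (M.normal T.1.1.2) (vval q x)‖ ^ 2)
      (fun T _ => integral_nonneg fun _ => sq_nonneg _) (Finset.mem_univ T)
  -- For a fixed normal the tangential part is again a polynomial field, so its norm on one pyramid
  -- controls it on the entire element.
  have hpart : ∀ T : M.SubElem, T.1.1 = K → ∀ x ∈ M.elem K,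
      ‖tangent (M.normal T.1.2) (vval q x)‖ ^ 2 ≤ C * (h ^ d)⁻¹ * S := by
    intro T hT x hx
    have h1 := hsup hM T _ (polyTangent_mem (M.normal T.1.2) hq) x (by rwa [hT])
    simp only [vval_polyTangent] at h1
    rw [hT] at h1
    exact h1.trans (mul_le_mul_of_nonneg_left (hsingle ⟨T, hT⟩) (by positivity))
  have hγ0 : 0 < γ := by linarith
  have hbound : ∀ x ∈ M.elem K, ‖vval q x‖ ^ 2 ≤
      (1 + 2 * γ ^ 2) * (C * (h ^ d)⁻¹ * S + C * (h ^ d)⁻¹ * S) := by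
    intro x hx
    refine (htr _).trans (mul_le_mul_of_nonneg_left ?_ (by positivity))
    exact add_le_add (hpart T₁ hT₁ x hx) (hpart T₂ hT₂ x hx)
  have hfin := hM.integral_le_of_le hcomp subset_rfl (continuous_norm_vval_sq q)
    (by positivity) hbound
  refine hfin.trans ?_
  rw [← hh]
  have : h ^ d * unitVol d * ((1 + 2 * γ ^ 2) * (C * (h ^ d)⁻¹ * S + C * (h ^ d)⁻¹ * S)) =
      unitVol d * (1 + 2 * γ ^ 2) * C * 2 * S := by
    field_simp
    ring
  rw [this, add_mul, one_mul]
  linarith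

/-- Extension of a polynomial from a face to the adjacent sub-elements. -/
theorem exists_extension_const (d k : ℕ) (hγ : 1 ≤ γ) (hη : 1 ≤ η) :
    ∃ C : ℝ, 0 < C ∧ ∀ {Ω : Set (Eu d)} {M : PolytopalMesh Ω}, M.ShapeRegular γ η →
      ∀ F : Fin M.numFace, ∀ p ∈ Poly d k, ∃ q ∈ Poly d k, (∀ x ∈ M.face F, pval q x = pval p x) ∧
        ∀ T : M.SubElem, T.1.2 = F → ∫ x in M.sub T, pval q x ^ 2 ≤
          C * Metric.diam (M.face F) * ∫ x, pval p x ^ 2 ∂M.surf F := by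
  -- An adjacent element has diameter at most `η h_F`, that is `η γ` times the disc radius `h_F /
  -- γ`.
  obtain ⟨C, hC, hball⟩ := exists_ball_const d k (η * γ)
  have hω := unitVol_nonneg d
  have hγ0 : 0 < γ := by linarith
  have hη0 : 0 < η := by linarith
  refine ⟨unitVol d * (η * γ) ^ d * C * 2 + 1, by positivity, fun {Ω M} hM F p hp => ?_⟩
  let n := M.normal F
  have hn : ‖n‖ = 1 := M.normal_norm F
  let c := M.offset F
  -- Composition with the orthogonal projection onto the hyperplane of `F`: the degree does not
  -- grow, the result is constant along `n`, and one polynomial serves both sides of the face.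
  obtain ⟨q, hq, hqp⟩ := exists_comp_affine hp
    (ContinuousLinearMap.id ℝ (Eu d) - (innerSL ℝ n).smulRight n) (c • n)
  have hqp' (x : Eu d) : pval q x = pval p (tangent n x + c • n) := by
    rw [hqp]
    rfl
  have hface : ∀ x, inner ℝ n x = c → pval q x = pval p x := by
    intro x hx
    rw [hqp', tangent, hx, sub_add_cancel]
  have hconst : ∀ x, ∀ s : ℝ, pval q (x + s • n) ^ 2 = pval q x ^ 2 := by
    intro x s
    rw [hqp', hqp']
    congr 3
    simp only [tangent, inner_add_right, inner_smul_right, real_inner_self_eq_norm_sq, hn]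
    rw [add_smul]
    simp
  refine ⟨q, hq, fun x hx => hface x (M.face_flat F x hx), ?_⟩
  rintro T rfl
  set hF := Metric.diam (M.face T.1.2) with hhF
  have hF0 : 0 < hF := hM.diam_face_pos hη T.1.2
  have hle : Metric.diam (M.elem T.1.1) ≤ η * hF := hM.diam_le _ _ T.2
  obtain ⟨z, hz, -, hdisc⟩ := hM.exists_disc hγ T.1.2
  rw [← hhF] at hdisc
  set r := hF / γ with hr
  have hr0 : 0 < r := by positivity
  have hrF : r ≤ hF := div_le_self hF0.le hγ
  have hhr : Metric.diam (M.elem T.1.1) ≤ η * γ * r := by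
    rw [hr]
    field_simp
    exact hle
  set I := ∫ x, pval p x ^ 2 ∂M.surf T.1.2 with hI
  have hI0 : 0 ≤ I := integral_nonneg fun _ => sq_nonneg _
  have hI2 : ∫ x in Metric.closedBall z r, pval q x ^ 2 ≤ 2 * r * I := by
    refine (integral_closedBall_le_of_const hn (M.face_flat _ z hz) hr0.le (continuous_pval_sq q)
      (fun x => sq_nonneg _) hconst).trans ?_
    refine mul_le_mul_of_nonneg_left ?_ (by positivity)
    have h1 : I = ∫ x in M.face T.1.2, pval q x ^ 2 ∂μHE[d - 1] := by
      refine setIntegral_congr_fun (M.isCompact_face _).measurableSet fun x hx => ?_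
      simp only [hface x (M.face_flat _ x hx)]
    rw [h1]
    exact setIntegral_mono_subset (fun _ => sq_nonneg _)
      (M.surf_integrable _ (continuous_pval_sq q)) fun y hy => hdisc y hy.1 hy.2
  have hsup : ∀ x ∈ M.elem T.1.1, pval q x ^ 2 ≤ C * (r ^ d)⁻¹ * (2 * r * I) := by
    intro x hx
    refine (hball q hq z r hr0 x
      ((M.norm_sub_le_diam _ hx (M.face_subset_elem T hz)).trans hhr)).trans ?_
    gcongr
  refine (hM.integral_le_of_le (M.isCompact_sub T) (hM.sub_subset T) (continuous_pval_sq q)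
    (by positivity) hsup).trans ?_
  have h2 : Metric.diam (M.elem T.1.1) ^ d ≤ (η * γ * r) ^ d :=
    pow_le_pow_left₀ Metric.diam_nonneg hhr d
  calc _ ≤ (η * γ * r) ^ d * unitVol d * (C * (r ^ d)⁻¹ * (2 * r * I)) := by gcongr
    _ = unitVol d * (η * γ) ^ d * C * 2 * (r * I) := by
      rw [mul_pow]
      field_simp
    _ ≤ unitVol d * (η * γ) ^ d * C * 2 * (hF * I) := by gcongr
    _ ≤ _ := by
      have : 0 ≤ hF * I := by positivity
      nlinarith

end PolytopalMesh

/-! ### Jumps and the discrete Poincaré inequality -/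

theorem pval_mul_self {d : ℕ} (p : MvPolynomial (Fin d) ℝ) (x : Eu d) :
    pval (p * p) x = pval p x ^ 2 := by
  rw [pval_mul, sq]

theorem inner_grad_mul_self {d : ℕ} (p : MvPolynomial (Fin d) ℝ) (x v : Eu d) :
    inner ℝ (vval (grad (p * p)) x) v = 2 * pval p x * inner ℝ (vval (grad p) x) v := by
  rw [inner_vval, inner_vval, Finset.mul_sum]
  refine Finset.sum_congr rfl fun i _ => ?_
  simp only [grad, Derivation.leibniz, smul_eq_mul, pval_add, pval_mul]
  ring

namespace PolytopalMesh

variable {d : ℕ} {Ω : Set (Eu d)} {M : PolytopalMesh Ω} {γ η : ℝ} {k : ℕ}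

noncomputable def gradSq (u : M.U k) : ℝ :=
  ∑ K, ∫ x in M.elem K, ‖vval (grad (u K : MvPolynomial (Fin d) ℝ)) x‖ ^ 2

noncomputable def jumpSq (u : M.U k) : ℝ :=
  ∑ F, (Metric.diam (M.face F))⁻¹ * ∫ x, pval (M.Qb k F (M.jump u F)) x ^ 2 ∂(M.surf F)

noncomputable def massSq (u : M.U k) : ℝ :=
  ∑ K, ∫ x in M.elem K, pval (u K : MvPolynomial (Fin d) ℝ) x ^ 2

theorem gradSq_nonneg (u : M.U k) : 0 ≤ gradSq u :=
  Finset.sum_nonneg fun _ _ => integral_nonneg fun _ => sq_nonneg _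

theorem jumpSq_nonneg (u : M.U k) : 0 ≤ jumpSq u :=
  Finset.sum_nonneg fun _ _ => mul_nonneg (inv_nonneg.2 Metric.diam_nonneg)
    (integral_nonneg fun _ => sq_nonneg _)

theorem massSq_nonneg (u : M.U k) : 0 ≤ massSq u :=
  Finset.sum_nonneg fun _ _ => integral_nonneg fun _ => sq_nonneg _

theorem normU_sq (u : M.U k) : M.normU u ^ 2 = gradSq u + jumpSq u :=
  Real.sq_sqrt (add_nonneg (gradSq_nonneg u) (jumpSq_nonneg u))

theorem sgn_left (M : PolytopalMesh Ω) (F : Fin M.numFace) : M.sgn (M.left F) F = 1 := by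
  simp [sgn]

theorem sgn_right (M : PolytopalMesh Ω) {F : Fin M.numFace} {K : Fin M.numElem}
    (h : M.right F = some K) : M.sgn K F = -1 := by
  have : M.left F ≠ K := fun h' => M.right_ne_left F (by rw [h, h'])
  simp [sgn, this]

/-- The pyramid over the face `F` with apex in the element `K`. -/
def pyramid (M : PolytopalMesh Ω) (K : Fin M.numElem) (F : Fin M.numFace) : Set (Eu d) :=
  convexJoin ℝ {M.center K} (M.face F)

/-- Sum of a quantity over the elements adjacent to a face. -/
def adjSum (M : PolytopalMesh Ω) (G : Fin M.numElem → Fin M.numFace → ℝ) (F : Fin M.numFace) : ℝ :=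
  G (M.left F) F + (M.right F).elim 0 fun K => G K F

theorem sum_adjSum (M : PolytopalMesh Ω) (G : Fin M.numElem → Fin M.numFace → ℝ) :
    ∑ F, M.adjSum G F = ∑ T : M.SubElem, G T.1.1 T.1.2 := (M.sum_subElem_eq_sum_face G).symm

theorem ShapeRegular.sum_adjSum_integral (hM : M.ShapeRegular γ η) (hd : 2 ≤ d)
    {φ : Fin M.numElem → Eu d → ℝ} (hφ : ∀ K, Continuous (φ K)) :
    ∑ F, M.adjSum (fun K F => ∫ x in M.pyramid K F, φ K x) F = ∑ K, ∫ x in M.elem K, φ K x := by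
  rw [sum_adjSum, hM.sum_integral_elem hd hφ]
  rfl

/-- Best approximation: constants lie in `𝕡_k` even for `k = 0`, and by orthogonality the cross term
vanishes when the square is expanded around the projection. -/
theorem integral_sub_Qb_sq_le (M : PolytopalMesh Ω) (k : ℕ) (F : Fin M.numFace)
    (p : MvPolynomial (Fin d) ℝ) (c : ℝ) :
    ∫ x, (pval p x - pval (M.Qb k F p) x) ^ 2 ∂M.surf F ≤ ∫ x, (pval p x - c) ^ 2 ∂M.surf F := by
  obtain ⟨hQ, horth⟩ := M.Qb_spec k F p
  set Q := M.Qb k F p with hQdef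
  have h0 := horth (Q - MvPolynomial.C c) (Submodule.sub_mem _ hQ (by
    rw [MvPolynomial.mem_restrictTotalDegree]
    simp))
  have hcp := continuous_pval p
  have hcQ := continuous_pval Q
  have hcw := continuous_pval (Q - MvPolynomial.C c)
  have h1 : ∫ x, (pval p x - c) ^ 2 ∂M.surf F = ∫ x, (pval p x - pval Q x) ^ 2 ∂M.surf F +
      (2 * ∫ x, (pval p x - pval Q x) * pval (Q - MvPolynomial.C c) x ∂M.surf F +
        ∫ x, pval (Q - MvPolynomial.C c) x ^ 2 ∂M.surf F) := by
    rw [← integral_const_mul, ← integral_add, ← integral_add]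
    · refine integral_congr_ae (Filter.Eventually.of_forall fun x => ?_)
      simp only [pval_sub, pval_C]
      ring
    all_goals exact M.surf_integrable F (by fun_prop)
  rw [h1, h0]
  have : 0 ≤ ∫ x, pval (Q - MvPolynomial.C c) x ^ 2 ∂M.surf F := integral_nonneg fun _ => sq_nonneg _
  linarith

theorem surf_integral_add_sq_le (M : PolytopalMesh Ω) (F : Fin M.numFace) {f g : Eu d → ℝ}
    (hf : Continuous f) (hg : Continuous g) {e : Eu d → ℝ} (he : Continuous e)
    (h : ∀ x, |e x| ≤ |f x| + |g x|) :
    ∫ x, e x ^ 2 ∂M.surf F ≤ 2 * ∫ x, f x ^ 2 ∂M.surf F + 2 * ∫ x, g x ^ 2 ∂M.surf F := by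
  rw [← integral_const_mul, ← integral_const_mul, ← integral_add
    (M.surf_integrable F (by fun_prop)) (M.surf_integrable F (by fun_prop))]
  refine integral_mono (M.surf_integrable F (by fun_prop)) (M.surf_integrable F (by fun_prop))
    fun x => ?_
  have h1 := pow_le_pow_left₀ (abs_nonneg _) (h x) 2
  rw [sq_abs] at h1
  have h2 := sq_abs (f x)
  have h3 := sq_abs (g x)
  dsimp only
  nlinarith [sq_nonneg (|f x| - |g x|)]

/-- The jumps are controlled by the projected jumps and the gradient. -/
theorem exists_jump_const (hd : 2 ≤ d) (k : ℕ) (hγ : 1 ≤ γ) (hη : 1 ≤ η) :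
    ∃ C : ℝ, 0 < C ∧ ∀ {Ω : Set (Eu d)} {M : PolytopalMesh Ω}, M.ShapeRegular γ η →
      ∀ u : M.U k, ∑ F, (Metric.diam (M.face F))⁻¹ * ∫ x, pval (M.jump u F) x ^ 2 ∂M.surf F ≤
        C * gradSq u + 2 * jumpSq u := by
  obtain ⟨C, hC, hpoin⟩ := exists_trace_poincare_const (by omega : 1 ≤ d) k hγ hη
  have hη0 : 0 < η := by linarith
  refine ⟨4 * C * η, by positivity, fun {Ω M} hM u => ?_⟩
  let G : Fin M.numElem → Fin M.numFace → ℝ := fun K F =>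
    ∫ x in M.pyramid K F, ‖vval (grad (u K : MvPolynomial (Fin d) ℝ)) x‖ ^ 2
  have hGnn (K F) : 0 ≤ G K F := integral_nonneg fun _ => sq_nonneg _
  have hG : ∑ F, M.adjSum G F = gradSq u :=
    hM.sum_adjSum_integral hd fun K => continuous_norm_vval_sq _
  have hstep (T : M.SubElem) : ∃ c : ℝ, ∫ x, (pval (u T.1.1 : MvPolynomial (Fin d) ℝ) x - c) ^ 2
      ∂M.surf T.1.2 ≤ C * η * Metric.diam (M.face T.1.2) * G T.1.1 T.1.2 := by
    obtain ⟨c, hc⟩ := hpoin hM T _ (u T.1.1).2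
    refine ⟨c, hc.trans ?_⟩
    have h1 := hM.diam_le _ _ T.2
    calc _ ≤ C * (η * Metric.diam (M.face T.1.2)) * G T.1.1 T.1.2 :=
          mul_le_mul_of_nonneg_right (mul_le_mul_of_nonneg_left h1 hC.le) (hGnn _ _)
      _ = _ := by ring
  -- On each side of `F` the function is close to a constant, so the jump is close to the difference
  -- of the constants, which competes with `Q_b` in the best approximation.
  have hface (F : Fin M.numFace) : ∫ x, (pval (M.jump u F) x - pval (M.Qb k F (M.jump u F)) x) ^ 2
      ∂M.surf F ≤ 2 * C * η * Metric.diam (M.face F) * M.adjSum G F := by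
    have hD : 0 ≤ Metric.diam (M.face F) := Metric.diam_nonneg
    obtain ⟨c, hc⟩ := hstep (M.leftSub F)
    change ∫ x, (pval (u (M.left F) : MvPolynomial (Fin d) ℝ) x - c) ^ 2 ∂M.surf F ≤
      C * η * Metric.diam (M.face F) * G (M.left F) F at hc
    rcases hR : M.right F with _ | K
    · refine (M.integral_sub_Qb_sq_le k F _ c).trans ?_
      have : 0 ≤ C * η * Metric.diam (M.face F) * G (M.left F) F :=
        mul_nonneg (by positivity) (hGnn _ _)
      simp only [jump, adjSum, hR, Option.elim_none, sub_zero, add_zero]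
      linarith
    · obtain ⟨c', hc'⟩ := hstep (M.rightSub F K hR)
      change ∫ x, (pval (u K : MvPolynomial (Fin d) ℝ) x - c') ^ 2 ∂M.surf F ≤
        C * η * Metric.diam (M.face F) * G K F at hc'
      refine (M.integral_sub_Qb_sq_le k F _ (c - c')).trans ?_
      have h1 := M.surf_integral_add_sq_le F
        (f := fun x => pval (u (M.left F) : MvPolynomial (Fin d) ℝ) x - c)
        (g := fun x => pval (u K : MvPolynomial (Fin d) ℝ) x - c')
        (e := fun x => pval (M.jump u F) x - (c - c'))
        ((continuous_pval _).sub continuous_const) ((continuous_pval _).sub continuous_const)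
        ((continuous_pval _).sub continuous_const) fun x => by
          simp only [jump, hR, Option.elim_some, pval_sub]
          refine (le_of_eq ?_).trans (abs_sub _ _)
          congr 1
          ring
      simp only [adjSum, hR, Option.elim_some]
      linarith
  have hF (F : Fin M.numFace) :
      (Metric.diam (M.face F))⁻¹ * ∫ x, pval (M.jump u F) x ^ 2 ∂M.surf F ≤
        4 * C * η * M.adjSum G F +
        2 * ((Metric.diam (M.face F))⁻¹ * ∫ x, pval (M.Qb k F (M.jump u F)) x ^ 2 ∂M.surf F) := by
    have hD : 0 < Metric.diam (M.face F) := hM.diam_face_pos hη F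
    have h1 := M.surf_integral_add_sq_le F
      (f := fun x => pval (M.jump u F) x - pval (M.Qb k F (M.jump u F)) x)
      (g := fun x => pval (M.Qb k F (M.jump u F)) x) (e := fun x => pval (M.jump u F) x)
      ((continuous_pval _).sub (continuous_pval _)) (continuous_pval _) (continuous_pval _)
      fun x => by
        refine (le_of_eq ?_).trans (abs_add_le _ _)
        congr 1
        ring
    have h2 := mul_le_mul_of_nonneg_left (h1.trans (add_le_add_left
      (mul_le_mul_of_nonneg_left (hface F) zero_le_two) _)) (inv_nonneg.2 hD.le)
    refine h2.trans_eq ?_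
    field_simp
    ring
  refine (Finset.sum_le_sum fun F _ => hF F).trans_eq ?_
  rw [Finset.sum_add_distrib, ← Finset.mul_sum, ← Finset.mul_sum, hG]
  rfl

/-- The divergence theorem for the square of a piecewise polynomial. -/
theorem ShapeRegular.mul_massSq_eq (hM : M.ShapeRegular γ η) (hd : 2 ≤ d) (u : M.U k) (b : Eu d) :
    d * massSq u = -(∑ K, ∫ x in M.elem K, 2 * pval (u K : MvPolynomial (Fin d) ℝ) x *
        inner ℝ (vval (grad (u K : MvPolynomial (Fin d) ℝ)) x) (x - b)) +
      ∑ F, (M.offset F - inner ℝ (M.normal F) b) *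
        ((∫ x, pval (u (M.left F) : MvPolynomial (Fin d) ℝ) x ^ 2 ∂M.surf F) -
          (M.right F).elim 0 fun K => ∫ x, pval (u K : MvPolynomial (Fin d) ℝ) x ^ 2 ∂M.surf F) := by
  have h1 (K : Fin M.numElem) : d * ∫ x in M.elem K, pval (u K : MvPolynomial (Fin d) ℝ) x ^ 2 =
      -(∫ x in M.elem K, 2 * pval (u K : MvPolynomial (Fin d) ℝ) x *
        inner ℝ (vval (grad (u K : MvPolynomial (Fin d) ℝ)) x) (x - b)) +
      ∑ T : M.SubElemOf K, (M.outerOffset T - inner ℝ (M.outer T) b) *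
        ∫ y, pval (u T.1.1.1 : MvPolynomial (Fin d) ℝ) y ^ 2 ∂M.surf T.1.1.2 := by
    have h2 := hM.integral_elem_radial hd K (u K * u K : MvPolynomial (Fin d) ℝ) b
    simp only [inner_grad_mul_self, pval_mul_self] at h2
    rw [integral_add, integral_const_mul] at h2
    · have h3 : ∑ T : M.SubElemOf K, (M.outerOffset T - inner ℝ (M.outer T) b) *
          ∫ y, pval (u T.1.1.1 : MvPolynomial (Fin d) ℝ) y ^ 2 ∂M.surf T.1.1.2 =
          ∑ T : M.SubElemOf K, (M.outerOffset T - inner ℝ (M.outer T) b) *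
          ∫ y in M.face T.1.1.2, pval (u K : MvPolynomial (Fin d) ℝ) y ^ 2 ∂μHE[d - 1] := by
        refine Finset.sum_congr rfl fun T _ => ?_
        rw [T.2, surf]
      linarith
    · exact (continuous_const.mul (continuous_pval_sq _)).continuousOn.integrableOn_compact
        (M.isCompact_elem K)
    · exact ((continuous_const.mul (continuous_pval _)).mul ((continuous_vval _).inner
        (continuous_id.sub continuous_const))).continuousOn.integrableOn_compact (M.isCompact_elem K)
  rw [massSq, Finset.mul_sum, Finset.sum_congr rfl fun K _ => h1 K, Finset.sum_add_distrib,
    Finset.sum_neg_distrib]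
  congr 1
  rw [M.sum_subElemOf fun T => (M.outerOffset T - inner ℝ (M.outer T) b) *
    ∫ y, pval (u T.1.1 : MvPolynomial (Fin d) ℝ) y ^ 2 ∂M.surf T.1.2]
  -- The two outer normals of an interior face are opposite and so are the offsets; the coefficients
  -- of both sides therefore differ only in sign.
  have h4 := M.sum_subElem_eq_sum_face fun K F =>
    (M.sgn K F * M.offset F - inner ℝ (M.sgn K F • M.normal F) b) *
      ∫ y, pval (u K : MvPolynomial (Fin d) ℝ) y ^ 2 ∂M.surf F
  refine h4.trans (Finset.sum_congr rfl fun F _ => ?_)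
  rw [M.sgn_left]
  rcases hR : M.right F with _ | K
  · simp
  · simp only [Option.elim_some, M.sgn_right hR, real_inner_smul_left]
    ring

/-- The discrete Poincaré inequality. -/
theorem exists_poincare_const (hd : 2 ≤ d) (k : ℕ) (hγ : 1 ≤ γ) (hη : 1 ≤ η)
    (hΩ : Bornology.IsBounded Ω) :
    ∃ C : ℝ, 0 < C ∧ ∀ {M : PolytopalMesh Ω}, M.ShapeRegular γ η →
      ∀ u : M.U k, massSq u ≤ C * (gradSq u + jumpSq u) := by
  obtain ⟨CJ, hCJ, hjump⟩ := exists_jump_const hd k hγ hη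
  obtain ⟨CI, hCI, hinv⟩ := exists_inverse_trace_const (by omega : 1 ≤ d) (k + 1) hγ hη
  obtain ⟨R₀, hR₀⟩ := hΩ.closure.exists_norm_le
  let R : ℝ := max R₀ 1
  have hR1 : 1 ≤ R := le_max_right _ _
  have hR : ∀ x ∈ closure Ω, ‖x‖ ≤ R := fun x hx => (hR₀ x hx).trans (le_max_left _ _)
  refine ⟨2 * R ^ 2 + R ^ 2 * CI * (CJ + 2), by positivity, fun {M} hM u => ?_⟩
  have hsub (K) : M.elem K ⊆ closure Ω := by
    rw [← M.iUnion_elem]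
    exact Set.subset_iUnion _ K
  let v : ∀ K, MvPolynomial (Fin d) ℝ := fun K => u K
  -- The field is `u² x`. Volume and face terms will each cost half of `massSq u`; since `d ≥ 2`, at
  -- least one full `massSq u` remains on the left.
  have hid := hM.mul_massSq_eq hd u 0
  simp only [sub_zero, inner_zero_right] at hid
  have hvol : -(∑ K, ∫ x in M.elem K, 2 * pval (v K) x * inner ℝ (vval (grad (v K)) x) x) ≤
      1 / 2 * massSq u + 2 * R ^ 2 * gradSq u := by
    rw [massSq, gradSq, Finset.mul_sum, Finset.mul_sum, ← Finset.sum_add_distrib,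
      ← Finset.sum_neg_distrib]
    refine Finset.sum_le_sum fun K _ => ?_
    have hc1 : Continuous fun x => 2 * pval (v K) x * inner ℝ (vval (grad (v K)) x) x :=
      (continuous_const.mul (continuous_pval _)).mul ((continuous_vval _).inner continuous_id)
    have hc2 : Continuous fun x => 1 / 2 * pval (v K) x ^ 2 :=
      continuous_const.mul (continuous_pval_sq _)
    have hc3 : Continuous fun x => 2 * R ^ 2 * ‖vval (grad (v K)) x‖ ^ 2 :=
      continuous_const.mul (continuous_norm_vval_sq _)
    rw [← integral_const_mul, ← integral_const_mul, ← integral_neg, ← integral_add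
      (hc2.continuousOn.integrableOn_compact (M.isCompact_elem K))
      (hc3.continuousOn.integrableOn_compact (M.isCompact_elem K))]
    refine setIntegral_mono_on (hc1.neg.continuousOn.integrableOn_compact (M.isCompact_elem K))
      ((hc2.add hc3).continuousOn.integrableOn_compact (M.isCompact_elem K))
      (M.isCompact_elem K).measurableSet fun x hx => ?_
    have h1 : |inner ℝ (vval (grad (v K)) x) x| ≤ ‖vval (grad (v K)) x‖ * R :=
      (abs_real_inner_le_norm _ _).trans
        (mul_le_mul_of_nonneg_left (hR x (hsub K hx)) (norm_nonneg _))
    have h2 := sq_le_sq' (abs_le.1 h1).1 (abs_le.1 h1).2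
    nlinarith [sq_nonneg (pval (v K) x + 2 * inner ℝ (vval (grad (v K)) x) x)]
  let G : Fin M.numElem → Fin M.numFace → ℝ := fun K F => ∫ x in M.pyramid K F, pval (v K) x ^ 2
  have hG : ∑ F, M.adjSum G F = massSq u :=
    hM.sum_adjSum_integral hd fun K => continuous_pval_sq _
  have hT (T : M.SubElem) : Metric.diam (M.face T.1.2) * ∫ x, pval (v T.1.1) x ^ 2 ∂M.surf T.1.2 ≤
      CI * G T.1.1 T.1.2 :=
    (mul_le_mul_of_nonneg_right (M.diam_face_le T)
      (integral_nonneg fun _ => sq_nonneg _)).trans (hinv hM T _ (u T.1.1).2)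
  have hface (F : Fin M.numFace) : M.offset F *
      ((∫ x, pval (v (M.left F)) x ^ 2 ∂M.surf F) -
        (M.right F).elim 0 fun K => ∫ x, pval (v K) x ^ 2 ∂M.surf F) ≤
      R ^ 2 * CI * ((Metric.diam (M.face F))⁻¹ * ∫ x, pval (M.jump u F) x ^ 2 ∂M.surf F) +
        1 / 2 * M.adjSum G F := by
    have hD : 0 < Metric.diam (M.face F) := hM.diam_face_pos hη F
    obtain ⟨z, hz, -⟩ := hM.exists_disc hγ F
    have hoff : |M.offset F| ≤ R := by
      rw [← M.face_flat F z hz]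
      refine (abs_real_inner_le_norm _ _).trans ?_
      rw [M.normal_norm, one_mul]
      exact hR z (hsub _ (M.face_subset_elem (M.leftSub F) hz))
    have hoff2 := sq_le_sq' (abs_le.1 hoff).1 (abs_le.1 hoff).2
    -- The difference of squares factors as `[u] w`. In Young's inequality the weight `(4 CI)⁻¹ h_F`
    -- on `w²` is such that the inverse trace bound returns exactly half of the adjacent mass.
    let w : MvPolynomial (Fin d) ℝ := v (M.left F) + (M.right F).elim 0 v
    have e1 : (∫ x, pval (v (M.left F)) x ^ 2 ∂M.surf F) -
        ((M.right F).elim 0 fun K => ∫ x, pval (v K) x ^ 2 ∂M.surf F) =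
        ∫ x, pval (M.jump u F) x * pval w x ∂M.surf F := by
      rcases hR : M.right F with _ | K
      · simp only [jump, hR, Option.elim_none, sub_zero, w, add_zero, sq]
        rfl
      · simp only [Option.elim_some]
        rw [← integral_sub (M.surf_integrable F (continuous_pval_sq _))
          (M.surf_integrable F (continuous_pval_sq _))]
        refine integral_congr_ae (Filter.Eventually.of_forall fun x => ?_)
        simp only [jump, hR, Option.elim_some, w, pval_add, pval_sub, v]
        ring
    have e2 : Metric.diam (M.face F) * ∫ x, pval w x ^ 2 ∂M.surf F ≤ 2 * CI * M.adjSum G F := by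
      have hl := hT (M.leftSub F)
      change Metric.diam (M.face F) * ∫ x, pval (v (M.left F)) x ^ 2 ∂M.surf F ≤
        CI * G (M.left F) F at hl
      have hnn : 0 ≤ CI * G (M.left F) F :=
        mul_nonneg hCI.le (integral_nonneg fun _ => sq_nonneg _)
      rcases hR : M.right F with _ | K
      · simp only [hR, Option.elim_none, w, add_zero, adjSum]
        linarith
      · have hr := hT (M.rightSub F K hR)
        change Metric.diam (M.face F) * ∫ x, pval (v K) x ^ 2 ∂M.surf F ≤ CI * G K F at hr
        have h1 := M.surf_integral_add_sq_le F (continuous_pval (v (M.left F)))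
          (continuous_pval (v K)) (continuous_pval w) fun x => by
            simp only [hR, Option.elim_some, w, pval_add]
            exact abs_add_le _ _
        have h2 := mul_le_mul_of_nonneg_left h1 hD.le
        simp only [hR, Option.elim_some, adjSum]
        linarith
    have e3 : M.offset F * ∫ x, pval (M.jump u F) x * pval w x ∂M.surf F ≤
        R ^ 2 * CI * ((Metric.diam (M.face F))⁻¹ * ∫ x, pval (M.jump u F) x ^ 2 ∂M.surf F) +
        (4 * CI)⁻¹ * (Metric.diam (M.face F) * ∫ x, pval w x ^ 2 ∂M.surf F) := by
      have hcj := continuous_pval (M.jump u F)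
      have hcw := continuous_pval w
      rw [← mul_assoc, ← mul_assoc (4 * CI)⁻¹, ← integral_const_mul, ← integral_const_mul,
        ← integral_const_mul, ← integral_add
          (M.surf_integrable F (by fun_prop)) (M.surf_integrable F (by fun_prop))]
      refine integral_mono (M.surf_integrable F (by fun_prop)) (M.surf_integrable F (by fun_prop))
        fun x => ?_
      set D := Metric.diam (M.face F)
      set α := pval (M.jump u F) x
      set β := pval w x
      have h1 : M.offset F * (α * β) ≤ M.offset F ^ 2 * CI * D⁻¹ * α ^ 2 + (4 * CI)⁻¹ * D * β ^ 2 := by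
        have h2 : M.offset F ^ 2 * CI * D⁻¹ * α ^ 2 + (4 * CI)⁻¹ * D * β ^ 2 -
            M.offset F * (α * β) = (CI * D)⁻¹ * (CI * M.offset F * α - D * β / 2) ^ 2 := by
          field_simp
          ring
        have h3 : 0 ≤ (CI * D)⁻¹ * (CI * M.offset F * α - D * β / 2) ^ 2 := by positivity
        linarith
      refine h1.trans ?_
      gcongr
    rw [e1]
    refine e3.trans ?_
    have h4 := mul_le_mul_of_nonneg_left e2 (by positivity : 0 ≤ (4 * CI)⁻¹)
    have h5 : (4 * CI)⁻¹ * (2 * CI * M.adjSum G F) = 1 / 2 * M.adjSum G F := by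
      field_simp
      ring
    linarith
  have hsum := Finset.sum_le_sum fun F (_ : F ∈ Finset.univ) => hface F
  rw [Finset.sum_add_distrib, ← Finset.mul_sum, ← Finset.mul_sum, hG] at hsum
  have hj := mul_le_mul_of_nonneg_left (hjump hM u) (by positivity : 0 ≤ R ^ 2 * CI)
  have hd' : (2 : ℝ) ≤ d := by exact_mod_cast hd
  have hm := massSq_nonneg u
  have hg := gradSq_nonneg u
  have hjn := jumpSq_nonneg u
  have key : massSq u ≤ 2 * R ^ 2 * gradSq u + R ^ 2 * CI * (CJ * gradSq u + 2 * jumpSq u) := by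
    nlinarith
  have x1 : 0 ≤ R ^ 2 * jumpSq u := by positivity
  have x2 : 0 ≤ R ^ 2 * CI * CJ * jumpSq u := by positivity
  have x3 : 0 ≤ R ^ 2 * CI * gradSq u := by positivity
  nlinarith

end PolytopalMesh

/-! ### The discrete forms and the norm on `Σ_h` -/

namespace PolytopalMesh

variable {d : ℕ} {Ω : Set (Eu d)} {M : PolytopalMesh Ω} {γ η : ℝ} {k : ℕ}

theorem continuous_sval (σ : M.SigmaDisc k) (T : M.SubElem) : Continuous (M.sval σ T) :=
  continuous_vval _

theorem integrableOn_sub (M : PolytopalMesh Ω) (T : M.SubElem) {g : Eu d → ℝ} (hg : Continuous g) :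
    IntegrableOn g (M.sub T) := hg.continuousOn.integrableOn_compact (M.isCompact_sub T)

theorem sval_add (σ τ : M.SigmaDisc k) (T : M.SubElem) (x : Eu d) :
    M.sval (σ + τ) T x = M.sval σ T x + M.sval τ T x := by
  ext i
  simp [sval, vval_apply, pval_add]

theorem sval_smul (c : ℝ) (σ : M.SigmaDisc k) (T : M.SubElem) (x : Eu d) :
    M.sval (c • σ) T x = c • M.sval σ T x := by
  ext i
  simp [sval, vval_apply, pval_smul]

/-- The normal trace on a face as a polynomial. -/
noncomputable def ntracePoly (σ : M.Sigma k) (F : Fin M.numFace) : MvPolynomial (Fin d) ℝ :=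
  ∑ i, M.normal F i • (σ.1 (M.leftSub F) i : MvPolynomial (Fin d) ℝ)

theorem ntracePoly_mem (σ : M.Sigma k) (F : Fin M.numFace) : ntracePoly σ F ∈ Poly d k :=
  Submodule.sum_mem _ fun i _ => Submodule.smul_mem _ _ (σ.1 (M.leftSub F) i).2

theorem pval_ntracePoly (σ : M.Sigma k) (F : Fin M.numFace) (x : Eu d) :
    pval (ntracePoly σ F) x = M.ntrace σ F x := by
  rw [ntracePoly, pval_sum, ntrace, sval, inner_vval]
  exact Finset.sum_congr rfl fun i _ => by rw [pval_smul, mul_comm]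

theorem continuous_ntrace (σ : M.Sigma k) (F : Fin M.numFace) : Continuous (M.ntrace σ F) :=
  (continuous_pval (ntracePoly σ F)).congr (pval_ntracePoly σ F)

theorem ah_self (σ : M.Sigma k) : M.ah σ σ = ∑ T : M.SubElem, ∫ x in M.sub T, ‖M.sval σ.1 T x‖ ^ 2 := by
  simp only [ah, real_inner_self_eq_norm_sq]

theorem ah_self_nonneg (σ : M.Sigma k) : 0 ≤ M.ah σ σ := by
  rw [ah_self]
  exact Finset.sum_nonneg fun _ _ => integral_nonneg fun _ => sq_nonneg _

theorem normSigma_sq (σ : M.Sigma k) : M.normSigma σ ^ 2 = M.ah σ σ +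
    ∑ F, Metric.diam (M.face F) * ∫ x, M.ntrace σ F x ^ 2 ∂(M.surf F) := by
  rw [normSigma, ← ah_self, Real.sq_sqrt]
  exact add_nonneg (ah_self_nonneg σ) (Finset.sum_nonneg fun _ _ =>
    mul_nonneg Metric.diam_nonneg (integral_nonneg fun _ => sq_nonneg _))

theorem leftSub_injective (M : PolytopalMesh Ω) : Function.Injective M.leftSub :=
  fun _ _ h => congrArg (fun T : M.SubElem => T.1.2) h

theorem sum_leftSub_le (M : PolytopalMesh Ω) {g : M.SubElem → ℝ} (hg : ∀ T, 0 ≤ g T) :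
    ∑ F, g (M.leftSub F) ≤ ∑ T, g T := by
  classical
  rw [← Finset.sum_image fun F _ F' _ h => M.leftSub_injective h]
  exact Finset.sum_le_univ_sum_of_nonneg hg

/-- On `Σ_h`, the norm `‖·‖_{0,h}` is controlled by the `L²`-norm. -/
theorem exists_normSigma_const (hd : 2 ≤ d) (k : ℕ) (hγ : 1 ≤ γ) (hη : 1 ≤ η) :
    ∃ C : ℝ, 0 < C ∧ ∀ {Ω : Set (Eu d)} {M : PolytopalMesh Ω}, M.ShapeRegular γ η →
      ∀ σ : M.Sigma k, M.normSigma σ ^ 2 ≤ C * M.ah σ σ := by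
  obtain ⟨C, hC, hinv⟩ := exists_inverse_trace_const (by omega : 1 ≤ d) k hγ hη
  refine ⟨1 + C, by positivity, fun {Ω M} hM σ => ?_⟩
  rw [normSigma_sq, add_mul, one_mul]
  refine add_le_add_right ?_ _
  rw [ah_self, Finset.mul_sum]
  -- The normal trace is read off from the first neighbour, and distinct faces use distinct
  -- pyramids, so nothing is counted twice.
  refine le_trans (Finset.sum_le_sum fun F _ => ?_) (M.sum_leftSub_le
    (g := fun T => C * ∫ x in M.sub T, ‖M.sval σ.1 T x‖ ^ 2) fun T =>
      mul_nonneg hC.le (integral_nonneg fun _ => sq_nonneg _))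
  have h1 := hinv hM (M.leftSub F) _ (ntracePoly_mem σ F)
  simp only [pval_ntracePoly] at h1
  refine (mul_le_mul_of_nonneg_right (M.diam_face_le (M.leftSub F))
    (integral_nonneg fun _ => sq_nonneg _)).trans (h1.trans ?_)
  refine mul_le_mul_of_nonneg_left ?_ hC.le
  refine integral_mono (M.integrableOn_sub _ ((continuous_ntrace σ F).pow 2))
    (M.integrableOn_sub _ ((continuous_sval σ.1 _).norm.pow 2)) fun x => ?_
  have h2 := abs_real_inner_le_norm (M.sval σ.1 (M.leftSub F) x) (M.normal F)
  rw [M.normal_norm, mul_one] at h2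
  exact sq_le_sq' (abs_le.1 h2).1 (abs_le.1 h2).2

/-- On a face `σ · n` is a polynomial of degree at most `k`, so the projection can be dropped.
Linearity of `b_h` in `u` then follows without linearity of `Qb`, which is defined by choice. -/
theorem integral_ntrace_mul_Qb (σ : M.Sigma k) (F : Fin M.numFace) (p : MvPolynomial (Fin d) ℝ) :
    ∫ x, M.ntrace σ F x * pval (M.Qb k F p) x ∂M.surf F =
      ∫ x, M.ntrace σ F x * pval p x ∂M.surf F := by
  have h := (M.Qb_spec k F p).2 _ (ntracePoly_mem σ F)
  have hc1 := continuous_pval p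
  have hc2 := continuous_pval (M.Qb k F p)
  have hc3 := continuous_ntrace σ F
  simp only [pval_ntracePoly] at h
  rw [eq_comm, ← sub_eq_zero, ← h, ← integral_sub (M.surf_integrable F (by fun_prop))
    (M.surf_integrable F (by fun_prop))]
  refine integral_congr_ae (Filter.Eventually.of_forall fun x => ?_)
  ring

theorem bh_eq (σ : M.Sigma k) (u : M.U k) : M.bh σ u = -(∑ T : M.SubElem, ∫ x in M.sub T,
      inner ℝ (M.sval σ.1 T x) (vval (grad (u T.1.1 : MvPolynomial (Fin d) ℝ)) x)) +
    ∑ F, ∫ x, M.ntrace σ F x * pval (M.jump u F) x ∂(M.surf F) := by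
  rw [bh]
  congr 1
  exact Finset.sum_congr rfl fun F _ => integral_ntrace_mul_Qb σ F _

/-! ### The discrete problem as a linear system -/

section Linear

theorem ntrace_add (σ τ : M.Sigma k) (F : Fin M.numFace) (x : Eu d) :
    M.ntrace (σ + τ) F x = M.ntrace σ F x + M.ntrace τ F x := by
  simp only [ntrace, Submodule.coe_add, sval_add, inner_add_left]

theorem ntrace_smul (c : ℝ) (σ : M.Sigma k) (F : Fin M.numFace) (x : Eu d) :
    M.ntrace (c • σ) F x = c * M.ntrace σ F x := by
  simp only [ntrace, Submodule.coe_smul, sval_smul, real_inner_smul_left]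

theorem jump_add (u v : M.U k) (F : Fin M.numFace) : M.jump (u + v) F = M.jump u F + M.jump v F := by
  rcases h : M.right F with _ | K <;> simp [jump, h]
  ring

theorem jump_smul (c : ℝ) (u : M.U k) (F : Fin M.numFace) : M.jump (c • u) F = c • M.jump u F := by
  rcases h : M.right F with _ | K <;> simp [jump, h, smul_sub]

theorem vval_grad_add (p q : MvPolynomial (Fin d) ℝ) (x : Eu d) :
    vval (grad (p + q)) x = vval (grad p) x + vval (grad q) x := by
  ext i
  simp [vval_apply, grad, pval_add]

theorem vval_grad_smul (c : ℝ) (p : MvPolynomial (Fin d) ℝ) (x : Eu d) :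
    vval (grad (c • p)) x = c • vval (grad p) x := by
  ext i
  simp [vval_apply, grad, pval_smul]

variable (M k)

/-- The form `a_h` as a bilinear map. -/
noncomputable def ahLin : M.Sigma k →ₗ[ℝ] M.Sigma k →ₗ[ℝ] ℝ :=
  have hc (σ τ : M.Sigma k) (T : M.SubElem) :
      IntegrableOn (fun x => inner ℝ (M.sval σ.1 T x) (M.sval τ.1 T x)) (M.sub T) :=
    M.integrableOn_sub T ((continuous_sval σ.1 T).inner (continuous_sval τ.1 T))
  LinearMap.mk₂ ℝ M.ah
    (fun σ σ' τ => by
      simp only [ah, ← Finset.sum_add_distrib, Submodule.coe_add, sval_add, inner_add_left]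
      exact Finset.sum_congr rfl fun T _ => integral_add (hc σ τ T) (hc σ' τ T))
    (fun c σ τ => by
      simp only [ah, Finset.mul_sum, Submodule.coe_smul, sval_smul, real_inner_smul_left,
        integral_const_mul, smul_eq_mul])
    (fun σ τ τ' => by
      simp only [ah, ← Finset.sum_add_distrib, Submodule.coe_add, sval_add, inner_add_right]
      exact Finset.sum_congr rfl fun T _ => integral_add (hc σ τ T) (hc σ τ' T))
    (fun c σ τ => by
      simp only [ah, Finset.mul_sum, Submodule.coe_smul, sval_smul, real_inner_smul_right,
        integral_const_mul, smul_eq_mul])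

/-- The form `b_h` as a bilinear map. -/
noncomputable def bhLin : M.Sigma k →ₗ[ℝ] M.U k →ₗ[ℝ] ℝ :=
  have hc (σ : M.Sigma k) (u : M.U k) (T : M.SubElem) : IntegrableOn (fun x =>
      inner ℝ (M.sval σ.1 T x) (vval (grad (u T.1.1 : MvPolynomial (Fin d) ℝ)) x)) (M.sub T) :=
    M.integrableOn_sub T ((continuous_sval σ.1 T).inner (continuous_vval _))
  have hs (σ : M.Sigma k) (u : M.U k) (F : Fin M.numFace) :
      Integrable (fun x => M.ntrace σ F x * pval (M.jump u F) x) (M.surf F) :=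
    M.surf_integrable F ((continuous_ntrace σ F).mul (continuous_pval _))
  LinearMap.mk₂ ℝ M.bh
    (fun σ σ' u => by
      simp only [bh_eq, Submodule.coe_add, sval_add, inner_add_left, ntrace_add, add_mul]
      rw [Finset.sum_congr rfl fun T _ => integral_add (hc σ u T) (hc σ' u T),
        Finset.sum_congr rfl fun F _ => integral_add (hs σ u F) (hs σ' u F),
        Finset.sum_add_distrib, Finset.sum_add_distrib]
      ring)
    (fun c σ u => by
      simp only [bh_eq, Submodule.coe_smul, sval_smul, real_inner_smul_left, ntrace_smul,
        mul_assoc c, integral_const_mul, smul_eq_mul, ← Finset.mul_sum]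
      ring)
    (fun σ u v => by
      simp only [bh_eq, Pi.add_apply, Submodule.coe_add, vval_grad_add, inner_add_right, jump_add,
        pval_add, mul_add]
      rw [Finset.sum_congr rfl fun T _ => integral_add (hc σ u T) (hc σ v T),
        Finset.sum_congr rfl fun F _ => integral_add (hs σ u F) (hs σ v F),
        Finset.sum_add_distrib, Finset.sum_add_distrib]
      ring)
    (fun c σ u => by
      simp only [bh_eq, Pi.smul_apply, Submodule.coe_smul, vval_grad_smul, real_inner_smul_right,
        jump_smul, pval_smul, mul_left_comm _ c, integral_const_mul, smul_eq_mul, ← Finset.mul_sum]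
      ring)

variable {M k}

theorem integrableOn_load (f : Lp ℝ 2 (volume.restrict Ω)) (K : Fin M.numElem)
    (p : MvPolynomial (Fin d) ℝ) : IntegrableOn (fun x => f x * pval p x) (Ω ∩ M.elem K) := by
  have hf : MemLp f 2 (volume.restrict (Ω ∩ M.elem K)) :=
    (Lp.memLp f).mono_measure (Measure.restrict_mono Set.inter_subset_left le_rfl)
  have hc := M.isCompact_elem K
  obtain ⟨B, hB⟩ := hc.exists_bound_of_continuousOn (continuous_pval p).continuousOn
  have hfin : IsFiniteMeasure (volume.restrict (M.elem K)) := ⟨by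
    simpa using hc.measure_lt_top⟩
  have hp : MemLp (pval p) 2 (volume.restrict (M.elem K)) := by
    refine MemLp.of_bound (continuous_pval p).aestronglyMeasurable B ?_
    filter_upwards [ae_restrict_mem hc.measurableSet] with x hx using hB x hx
  exact hf.integrable_mul
    (hp.mono_measure (Measure.restrict_mono Set.inter_subset_right le_rfl))

variable (M k)

noncomputable def loadLin (f : Lp ℝ 2 (volume.restrict Ω)) : M.U k →ₗ[ℝ] ℝ where
  toFun := M.load f
  map_add' u v := by
    simp only [load, ← Finset.sum_add_distrib, Pi.add_apply, Submodule.coe_add, pval_add, mul_add]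
    exact Finset.sum_congr rfl fun K _ =>
      integral_add (integrableOn_load f K _) (integrableOn_load f K _)
  map_smul' c u := by
    simp only [load, Pi.smul_apply, Submodule.coe_smul, pval_smul, mul_left_comm _ c,
      integral_const_mul, ← Finset.mul_sum, RingHom.id_apply, smul_eq_mul]

/-- The bilinear form of the saddle-point problem. -/
noncomputable def saddle : (M.Sigma k × M.U k) →ₗ[ℝ] Module.Dual ℝ (M.Sigma k × M.U k) :=
  LinearMap.mk₂ ℝ (fun s t => ahLin M k s.1 t.1 + bhLin M k t.1 s.2 + bhLin M k s.1 t.2)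
    (fun s s' t => by simp only [Prod.fst_add, Prod.snd_add, map_add, LinearMap.add_apply]; ring)
    (fun c s t => by
      simp only [Prod.smul_fst, Prod.smul_snd, map_smul, LinearMap.smul_apply, smul_eq_mul]; ring)
    (fun s t t' => by simp only [Prod.fst_add, Prod.snd_add, map_add, LinearMap.add_apply]; ring)
    (fun c s t => by
      simp only [Prod.smul_fst, Prod.smul_snd, map_smul, LinearMap.smul_apply, smul_eq_mul]; ring)

variable {M k}

/-- Testing with `(τ, 0)` and `(0, v)` separates the two equations, so the problem is one equation
between a space and its dual. -/
theorem isSolution_iff (f : Lp ℝ 2 (volume.restrict Ω)) (s : M.Sigma k × M.U k) :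
    M.IsSolution f s ↔ saddle M k s = -(loadLin M k f ∘ₗ LinearMap.snd ℝ _ _) := by
  have key (τ : M.Sigma k) (v : M.U k) : saddle M k s (τ, v) =
    M.ah s.1 τ + M.bh τ s.2 + M.bh s.1 v := rfl
  have key2 (τ : M.Sigma k) (v : M.U k) :
    (-(loadLin M k f ∘ₗ LinearMap.snd ℝ (M.Sigma k) (M.U k))) (τ, v) = - M.load f v := rfl
  have hb0 (σ : M.Sigma k) : M.bh σ 0 = 0 := map_zero (bhLin M k σ)
  have hb0' (u : M.U k) : M.bh 0 u = 0 := LinearMap.map_zero₂ (bhLin M k) u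
  have ha0 (σ : M.Sigma k) : M.ah σ 0 = 0 := map_zero (ahLin M k σ)
  have hl0 : M.load (k := k) f 0 = 0 := map_zero (loadLin M k f)
  constructor
  · rintro ⟨h1, h2⟩
    refine LinearMap.ext fun t => ?_
    obtain ⟨τ, v⟩ := t
    rw [key, key2, h1, h2, zero_add]
  · intro h
    refine ⟨fun τ => ?_, fun v => ?_⟩
    · have h1 := LinearMap.congr_fun h (τ, 0)
      rw [key, key2, hb0, hl0] at h1
      simpa using h1
    · have h1 := LinearMap.congr_fun h (0, v)
      rw [key, key2, hb0', ha0] at h1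
      simpa using h1

end Linear

/-! ### Young inequalities for `a_h` and for the load -/

theorem ah_le (σ τ : M.Sigma k) {ε : ℝ} (hε : 0 < ε) :
    -M.ah σ τ ≤ ε * M.ah σ σ + (4 * ε)⁻¹ * M.ah τ τ := by
  have hcσ := fun T => continuous_sval σ.1 T
  have hcτ := fun T => continuous_sval τ.1 T
  rw [ah_self, ah_self, ah, ← Finset.sum_neg_distrib, Finset.mul_sum, Finset.mul_sum,
    ← Finset.sum_add_distrib]
  refine Finset.sum_le_sum fun T _ => ?_
  have i1 := M.integrableOn_sub T ((hcσ T).inner (hcτ T))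
  have i2 : IntegrableOn (fun x => ε * ‖M.sval σ.1 T x‖ ^ 2) (M.sub T) :=
    M.integrableOn_sub T (((hcσ T).norm.pow 2).const_mul ε)
  have i3 : IntegrableOn (fun x => (4 * ε)⁻¹ * ‖M.sval τ.1 T x‖ ^ 2) (M.sub T) :=
    M.integrableOn_sub T (((hcτ T).norm.pow 2).const_mul (4 * ε)⁻¹)
  rw [← integral_const_mul, ← integral_const_mul, ← integral_neg, ← integral_add i2 i3]
  refine integral_mono i1.neg (i2.add i3) fun x => ?_
  have h1 := (abs_le.1 (abs_real_inner_le_norm (M.sval σ.1 T x) (M.sval τ.1 T x))).1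
  have h2 : ε * ‖M.sval σ.1 T x‖ ^ 2 + (4 * ε)⁻¹ * ‖M.sval τ.1 T x‖ ^ 2 -
      ‖M.sval σ.1 T x‖ * ‖M.sval τ.1 T x‖ =
      ε⁻¹ * (ε * ‖M.sval σ.1 T x‖ - ‖M.sval τ.1 T x‖ / 2) ^ 2 := by
    field_simp
    ring
  have h3 : 0 ≤ ε⁻¹ * (ε * ‖M.sval σ.1 T x‖ - ‖M.sval τ.1 T x‖ / 2) ^ 2 := by positivity
  change -inner ℝ (M.sval σ.1 T x) (M.sval τ.1 T x) ≤
    ε * ‖M.sval σ.1 T x‖ ^ 2 + (4 * ε)⁻¹ * ‖M.sval τ.1 T x‖ ^ 2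
  linarith

theorem volume_frontier_elem (M : PolytopalMesh Ω) (K : Fin M.numElem) :
    volume (frontier (M.elem K)) = 0 := by
  rw [M.frontier_elem]
  refine measure_iUnion_null fun F => measure_iUnion_null fun _ => ?_
  exact measure_mono_null (M.face_flat F) (volume_hyperplane (M.normal_norm F) _)

/-- A common point of two elements lies on the frontier of one of them, and frontiers are covered by
finitely many hyperplanes. -/
theorem aedisjoint_elem (M : PolytopalMesh Ω) {K K' : Fin M.numElem} (h : K ≠ K') :
    volume (M.elem K ∩ M.elem K') = 0 := by
  refine measure_mono_null (t := frontier (M.elem K) ∪ frontier (M.elem K')) (fun x hx => ?_)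
    (measure_union_null (M.volume_frontier_elem K) (M.volume_frontier_elem K'))
  rw [(M.isCompact_elem K).isClosed.frontier_eq, (M.isCompact_elem K').isClosed.frontier_eq]
  by_cases h1 : x ∈ interior (M.elem K)
  · exact Or.inr ⟨hx.2, fun h2 => Set.disjoint_left.1 (M.elem_disjoint K K' h) h1 h2⟩
  · exact Or.inl ⟨hx.1, h1⟩

/-- Young's inequality on each element; as the elements overlap in null sets, the local integrals of
`f²` add up to at most `‖f‖²`. -/
theorem load_le (hΩ : IsOpen Ω) (f : Lp ℝ 2 (volume.restrict Ω)) (u : M.U k) {ε : ℝ} (hε : 0 < ε) :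
    M.load f u ≤ ε * ‖f‖ ^ 2 + (4 * ε)⁻¹ * massSq u := by
  have hfi : IntegrableOn (fun x => f x ^ 2) Ω := (Lp.memLp f).integrable_sq
  have hm (K) : MeasurableSet (Ω ∩ M.elem K) :=
    hΩ.measurableSet.inter (M.isCompact_elem K).measurableSet
  have hnorm : ‖f‖ ^ 2 = ∫ x in Ω, f x ^ 2 := by
    rw [← real_inner_self_eq_norm_sq, L2.inner_def]
    refine integral_congr_ae (Filter.Eventually.of_forall fun x => ?_)
    simp [sq]
  have hfs : ∑ K, ∫ x in Ω ∩ M.elem K, f x ^ 2 ≤ ‖f‖ ^ 2 := by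
    rw [hnorm, ← tsum_fintype (L := .unconditional _), ← integral_iUnion_ae
      (fun K => (hm K).nullMeasurableSet) (fun K K' h =>
        measure_mono_null (Set.inter_subset_inter Set.inter_subset_right Set.inter_subset_right)
          (M.aedisjoint_elem h))
      (hfi.mono_set (Set.iUnion_subset fun K => Set.inter_subset_left))]
    exact setIntegral_mono_subset (fun _ => sq_nonneg _) hfi
      (Set.iUnion_subset fun K => Set.inter_subset_left)
  have hK (K) : ∫ x in Ω ∩ M.elem K, f x * pval (u K : MvPolynomial (Fin d) ℝ) x ≤
      ε * (∫ x in Ω ∩ M.elem K, f x ^ 2) +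
      (4 * ε)⁻¹ * ∫ x in M.elem K, pval (u K : MvPolynomial (Fin d) ℝ) x ^ 2 := by
    have hpi : IntegrableOn (fun x => pval (u K : MvPolynomial (Fin d) ℝ) x ^ 2) (M.elem K) :=
      (continuous_pval_sq _).continuousOn.integrableOn_compact (M.isCompact_elem K)
    have h1 : ∫ x in Ω ∩ M.elem K, pval (u K : MvPolynomial (Fin d) ℝ) x ^ 2 ≤
        ∫ x in M.elem K, pval (u K : MvPolynomial (Fin d) ℝ) x ^ 2 :=
      setIntegral_mono_subset (fun _ => sq_nonneg _) hpi Set.inter_subset_right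
    have i2 := (hfi.mono_set (Set.inter_subset_left (t := M.elem K))).const_mul ε
    have i3 := (hpi.mono_set (Set.inter_subset_right (s := Ω))).const_mul (4 * ε)⁻¹
    refine le_trans ?_ (add_le_add_right (mul_le_mul_of_nonneg_left h1 (by positivity)) _)
    rw [← integral_const_mul, ← integral_const_mul, ← integral_add i2 i3]
    refine integral_mono (integrableOn_load f K _) (i2.add i3) fun x => ?_
    have h2 : ε * f x ^ 2 + (4 * ε)⁻¹ * pval (u K : MvPolynomial (Fin d) ℝ) x ^ 2 -
        f x * pval (u K : MvPolynomial (Fin d) ℝ) x =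
        ε⁻¹ * (ε * f x - pval (u K : MvPolynomial (Fin d) ℝ) x / 2) ^ 2 := by
      field_simp
      ring
    have h3 : 0 ≤ ε⁻¹ * (ε * f x - pval (u K : MvPolynomial (Fin d) ℝ) x / 2) ^ 2 := by positivity
    change f x * pval (u K : MvPolynomial (Fin d) ℝ) x ≤
      ε * f x ^ 2 + (4 * ε)⁻¹ * pval (u K : MvPolynomial (Fin d) ℝ) x ^ 2
    linarith
  refine (Finset.sum_le_sum fun K _ => hK K).trans ?_
  rw [Finset.sum_add_distrib, ← Finset.mul_sum, ← Finset.mul_sum]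
  exact add_le_add_left (mul_le_mul_of_nonneg_left hfs hε.le) _

end PolytopalMesh

/-- A finite-dimensional space and its dual have equal dimension, so uniqueness yields existence. -/
theorem surjective_of_injective_dual {V W : Type*} [AddCommGroup V] [Module ℝ V]
    [FiniteDimensional ℝ V] [AddCommGroup W] [Module ℝ W] [FiniteDimensional ℝ W]
    (p : Submodule ℝ V) (B : (p × W) →ₗ[ℝ] Module.Dual ℝ (p × W)) (hB : Function.Injective B) :
    Function.Surjective B :=
  (LinearMap.injective_iff_surjective_of_finrank_eq_finrank Subspace.dual_finrank_eq.symm).1 hB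

/-! ### Inf-sup condition, stability and unique solvability -/

namespace PolytopalMesh

variable {d : ℕ} {Ω : Set (Eu d)} {M : PolytopalMesh Ω} {γ η : ℝ} {k : ℕ}

/-- The field on the sub-mesh with tangential part `-α ∇u` and with normal component `q F` on the
sub-elements at the face `F`. -/
noncomputable def testField (α : ℝ) (u : M.U k) (q : Fin M.numFace → Poly d k) : M.SigmaDisc k :=
  fun T i => ⟨-α • polyTangent (M.normal T.1.2) (grad (u T.1.1 : MvPolynomial (Fin d) ℝ)) i +
      M.normal T.1.2 i • (q T.1.2 : MvPolynomial (Fin d) ℝ),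
    Submodule.add_mem _ (Submodule.smul_mem _ _ (polyTangent_mem _ (grad_mem_Poly (u T.1.1).2) i))
      (Submodule.smul_mem _ _ (q T.1.2).2)⟩

theorem sval_testField (α : ℝ) (u : M.U k) (q : Fin M.numFace → Poly d k) (T : M.SubElem)
    (x : Eu d) : M.sval (testField α u q) T x =
      -α • tangent (M.normal T.1.2) (vval (grad (u T.1.1 : MvPolynomial (Fin d) ℝ)) x) +
        pval (q T.1.2 : MvPolynomial (Fin d) ℝ) x • M.normal T.1.2 := by
  rw [← vval_polyTangent]
  ext i
  simp only [sval, testField, vval_apply, pval_add, pval_smul, PiLp.add_apply, PiLp.smul_apply,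
    smul_eq_mul]
  ring

theorem inner_sval_testField (α : ℝ) (u : M.U k) (q : Fin M.numFace → Poly d k) (T : M.SubElem)
    (x : Eu d) : inner ℝ (M.sval (testField α u q) T x) (M.normal T.1.2) =
      pval (q T.1.2 : MvPolynomial (Fin d) ℝ) x := by
  rw [sval_testField, inner_add_left, real_inner_smul_left, real_inner_smul_left,
    inner_tangent (M.normal_norm _), real_inner_self_eq_norm_sq, M.normal_norm]
  ring

theorem testField_mem (α : ℝ) (u : M.U k) (q : Fin M.numFace → Poly d k) :
    testField α u q ∈ M.Sigma k := by
  intro F K h x _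
  exact (inner_sval_testField α u q (M.leftSub F) x).trans
    (inner_sval_testField α u q (M.rightSub F K h) x).symm

theorem norm_sval_testField_sq (α : ℝ) (u : M.U k) (q : Fin M.numFace → Poly d k) (T : M.SubElem)
    (x : Eu d) : ‖M.sval (testField α u q) T x‖ ^ 2 =
      α ^ 2 * ‖tangent (M.normal T.1.2) (vval (grad (u T.1.1 : MvPolynomial (Fin d) ℝ)) x)‖ ^ 2 +
        pval (q T.1.2 : MvPolynomial (Fin d) ℝ) x ^ 2 := by
  rw [sval_testField, norm_add_sq_real, norm_smul, norm_smul, real_inner_smul_left,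
    real_inner_smul_right, inner_tangent (M.normal_norm _), M.normal_norm, mul_pow, Real.norm_eq_abs,
    Real.norm_eq_abs, sq_abs, mul_one, sq_abs]
  ring

theorem inner_sval_testField_grad (α : ℝ) (u : M.U k) (q : Fin M.numFace → Poly d k)
    (T : M.SubElem) (x : Eu d) :
    inner ℝ (M.sval (testField α u q) T x) (vval (grad (u T.1.1 : MvPolynomial (Fin d) ℝ)) x) =
      -α * ‖tangent (M.normal T.1.2) (vval (grad (u T.1.1 : MvPolynomial (Fin d) ℝ)) x)‖ ^ 2 +
        pval (q T.1.2 : MvPolynomial (Fin d) ℝ) x *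
          inner ℝ (M.normal T.1.2) (vval (grad (u T.1.1 : MvPolynomial (Fin d) ℝ)) x) := by
  rw [sval_testField, inner_add_left, real_inner_smul_left, real_inner_smul_left,
    inner_tangent_self (M.normal_norm _)]

theorem ShapeRegular.sum_integral_grad_sq (hM : M.ShapeRegular γ η) (hd : 2 ≤ d) (u : M.U k) :
    ∑ T : M.SubElem, ∫ x in M.sub T, ‖vval (grad (u T.1.1 : MvPolynomial (Fin d) ℝ)) x‖ ^ 2 =
      gradSq u :=
  (hM.sum_integral_elem hd (φ := fun K x => ‖vval (grad (u K : MvPolynomial (Fin d) ℝ)) x‖ ^ 2)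
    fun _ => continuous_norm_vval_sq _).symm

/-- The factor `2` is the largest number of pyramids over one face. -/
theorem sum_subElem_le (M : PolytopalMesh Ω) {g : Fin M.numFace → ℝ} (hg : ∀ F, 0 ≤ g F) :
    ∑ T : M.SubElem, g T.1.2 ≤ 2 * ∑ F, g F := by
  rw [M.sum_subElem_eq_sum_face fun _ F => g F, Finset.mul_sum]
  refine Finset.sum_le_sum fun F _ => ?_
  rcases M.right F with _ | K
  · simp only [Option.elim_none]
    linarith [hg F]
  · simp only [Option.elim_some]
    linarith

/-- The inf-sup condition: a field on which `b_h(·, u)` is large. -/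
theorem exists_infSup_const (hd : 2 ≤ d) (k : ℕ) (hγ : 1 ≤ γ) (hη : 1 ≤ η) :
    ∃ C : ℝ, 0 < C ∧ ∀ {Ω : Set (Eu d)} {M : PolytopalMesh Ω}, M.ShapeRegular γ η →
      ∀ u : M.U k, ∃ τ : M.Sigma k, (gradSq u + jumpSq u) / 2 ≤ M.bh τ u ∧
        M.ah τ τ ≤ C * (gradSq u + jumpSq u) := by
  obtain ⟨CT, hCT, htan⟩ := exists_tangent_const hd k hγ hη
  obtain ⟨CE, hCE, hext⟩ := exists_extension_const d k hγ hη
  -- Young's inequality for the cross term costs `jumpSq u / 2` and `CE * gradSq u`; this `α` makes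
  -- the tangential term at least `(CE + 1 / 2) * gradSq u`, leaving half of both.
  let α : ℝ := CT * (CE + 1 / 2)
  have hα : 0 < α := by positivity
  refine ⟨α ^ 2 + 2 * CE, by positivity, fun {Ω M} hM u => ?_⟩
  let Q : Fin M.numFace → MvPolynomial (Fin d) ℝ := fun F => M.Qb k F (M.jump u F)
  choose e he heq hle using fun F => hext hM F (Q F) (M.Qb_spec k F (M.jump u F)).1
  -- The factor `h_F⁻¹` makes the pairing of the normal trace with `Q_b[u]` equal to the jump term
  -- of the norm.
  let q : Fin M.numFace → Poly d k := fun F => (Metric.diam (M.face F))⁻¹ • ⟨e F, he F⟩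
  have hq (F x) : pval (q F : MvPolynomial (Fin d) ℝ) x =
      (Metric.diam (M.face F))⁻¹ * pval (e F) x := pval_smul _ _ _
  let j : Fin M.numFace → ℝ := fun F =>
    (Metric.diam (M.face F))⁻¹ * ∫ x, pval (Q F) x ^ 2 ∂M.surf F
  have hj0 (F) : 0 ≤ j F := mul_nonneg (inv_nonneg.2 Metric.diam_nonneg)
    (integral_nonneg fun _ => sq_nonneg _)
  have hJ : ∑ F, j F = jumpSq u := rfl
  have hqle (T : M.SubElem) :
      ∫ x in M.sub T, pval (q T.1.2 : MvPolynomial (Fin d) ℝ) x ^ 2 ≤ CE * j T.1.2 := by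
    have hD : 0 < Metric.diam (M.face T.1.2) := hM.diam_face_pos hη _
    simp only [hq, mul_pow, integral_const_mul]
    refine (mul_le_mul_of_nonneg_left (hle T.1.2 T rfl) (by positivity)).trans_eq ?_
    simp only [j]
    field_simp
  have hqsum : ∑ T : M.SubElem, ∫ x in M.sub T, pval (q T.1.2 : MvPolynomial (Fin d) ℝ) x ^ 2 ≤
      2 * CE * jumpSq u := by
    refine (Finset.sum_le_sum fun T _ => hqle T).trans ?_
    rw [← Finset.mul_sum, ← hJ]
    have := mul_le_mul_of_nonneg_left (M.sum_subElem_le hj0) hCE.le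
    linarith
  let tg : M.SubElem → ℝ := fun T => ∫ x in M.sub T,
    ‖tangent (M.normal T.1.2) (vval (grad (u T.1.1 : MvPolynomial (Fin d) ℝ)) x)‖ ^ 2
  have hctan (T : M.SubElem) : Continuous fun x =>
      ‖tangent (M.normal T.1.2) (vval (grad (u T.1.1 : MvPolynomial (Fin d) ℝ)) x)‖ ^ 2 := by
    simp only [← vval_polyTangent]
    exact continuous_norm_vval_sq _
  have hcg (T : M.SubElem) := continuous_vval (grad (u T.1.1 : MvPolynomial (Fin d) ℝ))
  have htg1 : ∑ T, tg T ≤ gradSq u := by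
    rw [← hM.sum_integral_grad_sq hd]
    refine Finset.sum_le_sum fun T _ => ?_
    exact integral_mono (M.integrableOn_sub T (hctan T))
      (M.integrableOn_sub T (continuous_norm_vval_sq _))
      fun x => norm_tangent_le (M.normal_norm _) _
  have htg2 : gradSq u ≤ CT * ∑ T, tg T := by
    rw [← M.sum_subElemOf, Finset.mul_sum]
    refine Finset.sum_le_sum fun K _ => ?_
    refine (htan hM K _ (grad_mem_Poly (u K).2)).trans_eq ?_
    congr 1
    refine Finset.sum_congr rfl fun T _ => ?_
    simp only [tg, T.2]
  refine ⟨⟨testField α u q, testField_mem α u q⟩, ?_, ?_⟩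
  · have hface : ∑ F, ∫ x, M.ntrace ⟨testField α u q, testField_mem α u q⟩ F x *
        pval (M.Qb k F (M.jump u F)) x ∂M.surf F = jumpSq u := by
      rw [← hJ]
      refine Finset.sum_congr rfl fun F _ => ?_
      simp only [j]
      rw [← integral_const_mul]
      refine setIntegral_congr_fun (M.isCompact_face F).measurableSet fun x hx => ?_
      have h1 : M.ntrace ⟨testField α u q, testField_mem α u q⟩ F x =
          pval (q F : MvPolynomial (Fin d) ℝ) x := inner_sval_testField α u q (M.leftSub F) x
      rw [h1, hq, heq F x hx]
      ring
    have hvol (T : M.SubElem) : ∫ x in M.sub T, inner ℝ (M.sval (testField α u q) T x)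
        (vval (grad (u T.1.1 : MvPolynomial (Fin d) ℝ)) x) ≤ -α * tg T +
        ((4 * CE)⁻¹ * (∫ x in M.sub T, pval (q T.1.2 : MvPolynomial (Fin d) ℝ) x ^ 2) +
        CE * ∫ x in M.sub T, ‖vval (grad (u T.1.1 : MvPolynomial (Fin d) ℝ)) x‖ ^ 2) := by
      have i1 : IntegrableOn (fun x => -α *
          ‖tangent (M.normal T.1.2) (vval (grad (u T.1.1 : MvPolynomial (Fin d) ℝ)) x)‖ ^ 2)
          (M.sub T) := (M.integrableOn_sub T (hctan T)).const_mul _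
      have i2 : IntegrableOn (fun x => (4 * CE)⁻¹ *
          pval (q T.1.2 : MvPolynomial (Fin d) ℝ) x ^ 2) (M.sub T) :=
        (M.integrableOn_sub T (continuous_pval_sq _)).const_mul _
      have i3 : IntegrableOn (fun x => CE *
          ‖vval (grad (u T.1.1 : MvPolynomial (Fin d) ℝ)) x‖ ^ 2) (M.sub T) :=
        (M.integrableOn_sub T (continuous_norm_vval_sq _)).const_mul _
      have i23 : IntegrableOn (fun x => (4 * CE)⁻¹ * pval (q T.1.2 : MvPolynomial (Fin d) ℝ) x ^ 2 +
          CE * ‖vval (grad (u T.1.1 : MvPolynomial (Fin d) ℝ)) x‖ ^ 2) (M.sub T) := i2.add i3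
      rw [← integral_const_mul, ← integral_const_mul, ← integral_const_mul, ← integral_add i2 i3,
        ← integral_add i1 i23]
      refine integral_mono (M.integrableOn_sub T ((continuous_sval _ T).inner (hcg T)))
        (i1.add i23) fun x => ?_
      dsimp only
      rw [inner_sval_testField_grad]
      refine add_le_add_right ?_ _
      set g := vval (grad (u T.1.1 : MvPolynomial (Fin d) ℝ)) x
      set a := pval (q T.1.2 : MvPolynomial (Fin d) ℝ) x
      have h1 := abs_real_inner_le_norm (M.normal T.1.2) g
      rw [M.normal_norm, one_mul] at h1
      have h2 := sq_le_sq' (abs_le.1 h1).1 (abs_le.1 h1).2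
      have h3 : (4 * CE)⁻¹ * a ^ 2 + CE * inner ℝ (M.normal T.1.2) g ^ 2 -
          a * inner ℝ (M.normal T.1.2) g =
          CE⁻¹ * (a / 2 - CE * inner ℝ (M.normal T.1.2) g) ^ 2 := by
        field_simp
        ring
      have h4 : 0 ≤ CE⁻¹ * (a / 2 - CE * inner ℝ (M.normal T.1.2) g) ^ 2 := by positivity
      change a * inner ℝ (M.normal T.1.2) g ≤ (4 * CE)⁻¹ * a ^ 2 + CE * ‖g‖ ^ 2
      have h5 := mul_le_mul_of_nonneg_left h2 hCE.le
      linarith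
    have hsum := Finset.sum_le_sum fun T (_ : T ∈ Finset.univ) => hvol T
    rw [Finset.sum_add_distrib, Finset.sum_add_distrib, ← Finset.mul_sum, ← Finset.mul_sum,
      ← Finset.mul_sum, hM.sum_integral_grad_sq hd] at hsum
    rw [bh, hface]
    have h1 := mul_le_mul_of_nonneg_left hqsum (by positivity : 0 ≤ (4 * CE)⁻¹)
    have h2 : (4 * CE)⁻¹ * (2 * CE * jumpSq u) = jumpSq u / 2 := by
      field_simp
      ring
    have h3 : (CE + 1 / 2) * gradSq u ≤ α * ∑ T, tg T := by
      have := mul_le_mul_of_nonneg_left htg2 (by positivity : 0 ≤ CE + 1 / 2)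
      refine this.trans_eq ?_
      simp only [α]
      ring
    linarith
  · rw [ah_self]
    -- Tangential and normal parts are orthogonal pointwise, so there is no cross term.
    have h1 (T : M.SubElem) : ∫ x in M.sub T, ‖M.sval (testField α u q) T x‖ ^ 2 =
        α ^ 2 * tg T + ∫ x in M.sub T, pval (q T.1.2 : MvPolynomial (Fin d) ℝ) x ^ 2 := by
      simp only [norm_sval_testField_sq]
      rw [integral_add ((M.integrableOn_sub T (hctan T)).const_mul _)
        (M.integrableOn_sub T (continuous_pval_sq _)), integral_const_mul]
    refine (Finset.sum_congr rfl fun T _ => h1 T).trans_le ?_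
    rw [Finset.sum_add_distrib, ← Finset.mul_sum]
    have h2 := mul_le_mul_of_nonneg_left htg1 (sq_nonneg α)
    have h3 := gradSq_nonneg u
    have h4 := jumpSq_nonneg u
    have h5 : 0 ≤ α ^ 2 * jumpSq u := by positivity
    have h6 : 0 ≤ CE * gradSq u := by positivity
    nlinarith

/-- A priori bounds for solutions of the discrete problem. -/
theorem exists_stability_const (hd : 2 ≤ d) (k : ℕ) (hγ : 1 ≤ γ) (hη : 1 ≤ η)
    (hΩ : Bornology.IsBounded Ω) (hΩo : IsOpen Ω) :
    ∃ C : ℝ, 0 < C ∧ ∀ {M : PolytopalMesh Ω}, M.ShapeRegular γ η →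
      ∀ (f : Lp ℝ 2 (volume.restrict Ω)) (s : M.Sigma k × M.U k), M.IsSolution f s →
        M.ah s.1 s.1 ≤ C * ‖f‖ ^ 2 ∧ gradSq s.2 + jumpSq s.2 ≤ C * ‖f‖ ^ 2 ∧
          massSq s.2 ≤ C * ‖f‖ ^ 2 := by
  obtain ⟨C₁, hC₁, hinf⟩ := exists_infSup_const hd k hγ hη
  obtain ⟨C₂, hC₂, hpoin⟩ := exists_poincare_const hd k hγ hη hΩ
  let CA : ℝ := 4 * (C₁ * C₂)
  let CN : ℝ := 4 * C₁ * CA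
  have hCA : 0 < CA := by positivity
  have hCN : 0 < CN := by positivity
  have hCM : 0 < C₂ * CN := by positivity
  refine ⟨CA + CN + C₂ * CN, by positivity, fun {M} hM f s hs => ?_⟩
  obtain ⟨σ, u⟩ := s
  obtain ⟨h1, h2⟩ := hs
  dsimp only at h1 h2 ⊢
  set N := gradSq u + jumpSq u with hN
  obtain ⟨τ, hτ1, hτ2⟩ := hinf hM u
  rw [← hN] at hτ1 hτ2
  have hmass : massSq u ≤ C₂ * N := hpoin hM u
  have hb : M.bh τ u = -M.ah σ τ := by linarith [h1 τ]
  have hA : M.ah σ σ = M.load f u := by linarith [h1 σ, h2 u]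
  -- The first equation and Young's inequality give `N / 2 ≤ -a_h(σ, τ) ≤ C₁ a_h(σ, σ) + N / 4`.
  have hNA : N ≤ 4 * C₁ * M.ah σ σ := by
    have h3 := ah_le σ τ hC₁
    have h4 := mul_le_mul_of_nonneg_left hτ2 (by positivity : 0 ≤ (4 * C₁)⁻¹)
    have h5 : (4 * C₁)⁻¹ * (C₁ * N) = N / 4 := by
      field_simp
    linarith
  -- As `massSq u ≤ 4 C₁ C₂ a_h(σ, σ)`, this `ε` turns the mass term into half of `a_h(σ, σ)`, which
  -- is absorbed.
  have hload := load_le hΩo f u (ε := 2 * (C₁ * C₂)) (by positivity)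
  have hAf : M.ah σ σ ≤ CA * ‖f‖ ^ 2 := by
    have h3 := mul_le_mul_of_nonneg_left (hmass.trans (mul_le_mul_of_nonneg_left hNA hC₂.le))
      (by positivity : 0 ≤ (4 * (2 * (C₁ * C₂)))⁻¹)
    have h5 : (4 * (2 * (C₁ * C₂)))⁻¹ * (C₂ * (4 * C₁ * M.ah σ σ)) = M.ah σ σ / 2 := by
      field_simp
    simp only [CA]
    linarith
  have hNf : N ≤ CN * ‖f‖ ^ 2 := by
    have h3 := mul_le_mul_of_nonneg_left hAf (by positivity : 0 ≤ 4 * C₁)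
    simp only [CN]
    linarith
  have hMf : massSq u ≤ C₂ * CN * ‖f‖ ^ 2 := by
    have h3 := mul_le_mul_of_nonneg_left hNf hC₂.le
    linarith
  have hf := sq_nonneg ‖f‖
  refine ⟨hAf.trans ?_, hNf.trans ?_, hMf.trans ?_⟩ <;>
    refine mul_le_mul_of_nonneg_right ?_ hf <;> linarith

/-- The sup bound spreads vanishing from the pyramid to the element, which contains a ball. The
degree of `p` itself may be used because the size of the constant is irrelevant here. -/
theorem ShapeRegular.eq_zero_of_sub (hM : M.ShapeRegular γ η) (hγ : 1 ≤ γ) (hη : 1 ≤ η)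
    (T : M.SubElem) {p : MvPolynomial (Fin d) ℝ} (h : ∫ x in M.sub T, pval p x ^ 2 ≤ 0) : p = 0 := by
  obtain ⟨C, -, hsup⟩ := exists_sup_const d p.totalDegree hγ hη
  obtain ⟨ρ, hρ, -, hs⟩ := hM.elem_star T.1.1
  have h0 : ∫ x in M.sub T, pval p x ^ 2 = 0 := le_antisymm h (integral_nonneg fun _ => sq_nonneg _)
  refine eq_zero_of_pval_eq_zero_on_ball (y := M.center T.1.1) hρ fun x hx => ?_
  have h1 := hsup hM T p ((MvPolynomial.mem_restrictTotalDegree _ _ _).2 le_rfl) x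
    (hs x (Metric.ball_subset_closedBall hx)).1
  rw [h0, mul_zero] at h1
  exact pow_eq_zero_iff two_ne_zero |>.1 (le_antisymm h1 (sq_nonneg _))

theorem ShapeRegular.sigma_eq_zero (hM : M.ShapeRegular γ η) (hγ : 1 ≤ γ) (hη : 1 ≤ η)
    {σ : M.Sigma k} (h : M.ah σ σ ≤ 0) : σ = 0 := by
  rw [ah_self] at h
  refine Subtype.ext (funext fun T => funext fun i => Subtype.ext ?_)
  have hnn (T : M.SubElem) : 0 ≤ ∫ x in M.sub T, ‖M.sval σ.1 T x‖ ^ 2 :=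
    integral_nonneg fun _ => sq_nonneg _
  have h1 := (Finset.single_le_sum (fun T _ => hnn T) (Finset.mem_univ T)).trans h
  refine hM.eq_zero_of_sub hγ hη T (le_trans ?_ h1)
  refine integral_mono (M.integrableOn_sub T (continuous_pval_sq _))
    (M.integrableOn_sub T ((continuous_sval σ.1 T).norm.pow 2)) fun x => ?_
  simp only [sval, norm_vval_sq]
  exact Finset.single_le_sum (f := fun i => pval (σ.1 T i : MvPolynomial (Fin d) ℝ) x ^ 2)
    (fun _ _ => sq_nonneg _) (Finset.mem_univ i)

theorem ShapeRegular.u_eq_zero (hM : M.ShapeRegular γ η) (hd : 2 ≤ d) (hγ : 1 ≤ γ) (hη : 1 ≤ η)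
    {u : M.U k} (h : massSq u ≤ 0) : u = 0 := by
  refine funext fun K => Subtype.ext ?_
  have hnn (K) : 0 ≤ ∫ x in M.elem K, pval (u K : MvPolynomial (Fin d) ℝ) x ^ 2 :=
    integral_nonneg fun _ => sq_nonneg _
  have h1 := (Finset.single_le_sum (fun K _ => hnn K) (Finset.mem_univ K)).trans h
  -- Only the existence of some pyramid in `K` matters here.
  obtain ⟨T, -, rfl, -⟩ := hM.exists_transversal hd hγ K
  exact hM.eq_zero_of_sub hγ hη T ((setIntegral_mono_subset (fun _ => sq_nonneg _)
    ((continuous_pval_sq _).continuousOn.integrableOn_compact (M.isCompact_elem _))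
    (hM.sub_subset T)).trans h1)

/-- The a priori bounds with zero data make the saddle map injective, the bound on `massSq` serving
for `u`; equality of dimensions does the rest. -/
theorem ShapeRegular.existsUnique_isSolution (hM : M.ShapeRegular γ η) (hd : 2 ≤ d) (hγ : 1 ≤ γ)
    (hη : 1 ≤ η) (hΩ : Bornology.IsBounded Ω) (hΩo : IsOpen Ω) (f : Lp ℝ 2 (volume.restrict Ω)) :
    ∃! s : M.Sigma k × M.U k, M.IsSolution f s := by
  obtain ⟨C, -, hstab⟩ := exists_stability_const hd k hγ hη hΩ hΩo
  have hinj : Function.Injective (saddle M k) := by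
    rw [injective_iff_map_eq_zero]
    intro s hs
    have hl : loadLin M k (0 : Lp ℝ 2 (volume.restrict Ω)) = 0 := by
      refine LinearMap.ext fun v => ?_
      change M.load 0 v = 0
      refine Finset.sum_eq_zero fun K _ => integral_eq_zero_of_ae ?_
      have h0 := (Lp.coeFn_zero ℝ 2 (volume.restrict Ω)).filter_mono
        (ae_mono (Measure.restrict_mono (Set.inter_subset_left (t := M.elem K)) le_rfl))
      filter_upwards [h0] with x hx
      rw [hx]
      simp
    obtain ⟨h1, -, h3⟩ := hstab hM 0 s ((isSolution_iff 0 s).2 (by rw [hs, hl]; simp))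
    rw [norm_zero, zero_pow two_ne_zero, mul_zero] at h1 h3
    exact Prod.ext (hM.sigma_eq_zero hγ hη h1) (hM.u_eq_zero hd hγ hη h3)
  have hsurj := surjective_of_injective_dual (M.Sigma k) _ hinj
  simp only [isSolution_iff]
  exact Function.Bijective.existsUnique ⟨hinj, hsurj⟩ _

end PolytopalMesh

end SDG

/-! ### The main theorem -/

theorem theorem2p6 (d : ℕ) (hd : 2 ≤ d) (k : ℕ) (Ω : Set (SDG.Eu d))
    (hΩ : SDG.IsLipschitzPolyhedralDomain Ω) (γ η : ℝ) :
    ∃ C : ℝ, 0 < C ∧ ∀ M : SDG.PolytopalMesh Ω, M.ShapeRegular γ η →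
      ∀ f : MeasureTheory.Lp ℝ 2 (MeasureTheory.volume.restrict Ω),
        (∃! s : M.Sigma k × M.U k, M.IsSolution f s) ∧
        ∀ s : M.Sigma k × M.U k, M.IsSolution f s →
          M.normSigma s.1 + M.normU s.2 ≤ C * ‖f‖ := by
  have hγ : 1 ≤ max γ 1 := le_max_right _ _
  have hη : 1 ≤ max η 1 := le_max_right _ _
  obtain ⟨C, hC, hstab⟩ :=
    SDG.PolytopalMesh.exists_stability_const hd k hγ hη hΩ.isBounded hΩ.isOpen
  obtain ⟨C', hC', hnorm⟩ := SDG.PolytopalMesh.exists_normSigma_const hd k hγ hη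
  -- The first root combines `‖σ‖_{0,h}² ≤ C' a_h(σ, σ)` with `a_h(σ, σ) ≤ C ‖f‖²`; the second comes
  -- from `‖u‖_{1,h}² ≤ C ‖f‖²`.
  refine ⟨√(C' * C) + √C, by positivity, fun M hM₀ f => ?_⟩
  have hM := hM₀.mono (le_max_left γ 1) (le_max_left η 1)
  refine ⟨hM.existsUnique_isSolution hd hγ hη hΩ.isBounded hΩ.isOpen f, fun s hs => ?_⟩
  obtain ⟨h1, h2, -⟩ := hstab hM f s hs
  have h3 : M.normSigma s.1 ≤ √(C' * C) * ‖f‖ := by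
    refine le_of_sq_le_sq ?_ (by positivity)
    rw [mul_pow, Real.sq_sqrt (by positivity), mul_assoc]
    exact (hnorm hM s.1).trans (mul_le_mul_of_nonneg_left h1 hC'.le)
  have h4 : M.normU s.2 ≤ √C * ‖f‖ := by
    refine le_of_sq_le_sq ?_ (by positivity)
    rw [mul_pow, Real.sq_sqrt hC.le, SDG.PolytopalMesh.normU_sq]
    exact h2
  linarith
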